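/- **Theorem (Main Theorem B).** Let $d\ge 3$. Over every field $\mathbb F$, $d$-Tensor Isomorphism reduces to Algebra Isomorphism by a polynomial-time computable map. In detail: Call two arrays $A,B$ of the same format $n_1\times\dots\times n_d$ over $\mathbb F$ *isomorphic* if there are $P_i\in \mathrm{GL}(n_i,\mathbb F)$ with $A(i_1,\dots,i_d)=\sum_{j_1,\dots,j_d}(P_1)_{i_1j_1}\cdots(P_d)_{i_dj_d}\,B(j_1,\dots,j_d)$ for all $i_1,\dots,i_d$. Call two $N\times N\times N$ arrays $S,T$ of structure constants *isomorphic as algebras* if there is $P\in\mathrm{GL}(N,\mathbb F)$ with $T(i',j',l')=\sum_{i,j,l}S(i,j,l)P_{i'i}P_{j'j}(P^{-1})_{ll'}$ for all $i',j',l'$. For an array $A$ of format $n_1\times\dots\times n_d$, let $G$ be the quiver with vertices $1,\dots,d$, with $n_i$ arrows $x_{i,1},\dots,x_{i,n_i}$ from $i$ to $i+1$ for $1\le i\le d-1$, and with $n_d$ arrows $x_{d,1},\dots,x_{d,n_d}$ from $1$ to $d$. Let $\mathcal A_A$ be the quotient of the path algebra $\mathbb F G$ by the relations $$x_{1,i_1}x_{2,i_2}\cdots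 x_{d-1,i_{d-1}}=\sum_{j=1}^{n_d}A(i_1,\dots,i_{d-1},j)\,x_{d,j}\qquad\text{for all } i_1,\dots,i_{d-1}.$$ Then there are a number $N(n_1,\dots,n_d)$, depending only on the format, and a map $r$ from arrays of format $n_1\times\dots\times n_d$ to $N\times N\times N$ arrays of structure constants such that: 1. $r(A)$ is the array of structure constants of $\mathcal A_A$ with respect to some basis; in particular $\dim\mathcal A_A=N(n_1,\dots,n_d)$. 2. For arrays $A,B$ of the same format, the following are equivalent: $A$ and $B$ are isomorphic tensors; $\mathcal A_A\cong\mathcal A_B$ as $\mathbb F$-algebras; $r(A)$ and $r(B)$ are isomorphic as algebras. 3. $N(n_1,\dots,n_d)\le C\,d^2n^{d-1}$ with $n=\max_i n_i\ge 1$ and an absolute constant $C$ (independent of $d$, the format and $\mathbb F$); that is, the output algebra has dimension $O(d^2n^{d-1})$. 4. For fixed $d$ and $\mathbb F$, the map $A\mapsto r(A)$ is computable in polynomial time: by a Blum–Shub–Smale machine over $\mathbb F$, and also, for every encoding of the elements of $\mathbb F$ by strings over a finite alphabet, by a Turing machine. Arrays are given by their side lengths in unary followed by the list of all entries. -/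

import Mathlib

/-! ### Tensors and tensor isomorphism -/

/-- `d`-way arrays of format `n 0 × ⋯ × n (d - 1)` over `F`. -/
abbrev Tensor (F : Type*) {d : ℕ} (n : Fin d → ℕ) : Type _ :=
  (∀ i, Fin (n i)) → F

/-- Two `d`-tensors of the same format are isomorphic if they are related by an invertible change
of basis in each of the `d` directions. -/
def TensorIso {F : Type*} [Field F] {d : ℕ} {n : Fin d → ℕ} (A B : Tensor F n) : Prop :=
  ∃ P : ∀ i, Matrix.GeneralLinearGroup (Fin (n i)) F,
    ∀ I, A I = ∑ J : ∀ i, Fin (n i),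
      (∏ i, (P i : Matrix (Fin (n i)) (Fin (n i)) F) (I i) (J i)) * B J

/-! ### Algebras given by structure constants -/

/-- `N × N × N` arrays, read as structure constants `x i * x j = ∑ l, S i j l • x l`. -/
abbrev StructureArray (F : Type*) (N : ℕ) : Type _ :=
  Fin N → Fin N → Fin N → F

/-- `S` is the array of structure constants of the algebra `R` with respect to some basis. -/
def IsStructureArrayOf {F : Type*} [Field F] {N : ℕ} (S : StructureArray F N)
    (R : Type*) [Ring R] [Algebra F R] : Prop :=
  ∃ b : Module.Basis (Fin N) F R, ∀ i j, b i * b j = ∑ l, S i j l • b l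

/-- Isomorphism of algebras given by structure constants: the change of basis
`x' i' = ∑ i, P i' i • x i` turns the structure constants `S` into `T`. -/
def StructureArrayIso {F : Type*} [Field F] {N : ℕ} (S T : StructureArray F N) : Prop :=
  ∃ P : Matrix.GeneralLinearGroup (Fin N) F, ∀ i' j' l',
    T i' j' l' = ∑ i, ∑ j, ∑ l, S i j l *
      (P : Matrix (Fin N) (Fin N) F) i' i * (P : Matrix (Fin N) (Fin N) F) j' j *
      ((P⁻¹ : Matrix.GeneralLinearGroup (Fin N) F) : Matrix (Fin N) (Fin N) F) l l'

/-! ### Path algebras -/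

section PathAlgebra

variable (F : Type*) [Field F] (V : Type*) [Quiver V] [Fintype V] [DecidableEq V]

/-- The defining relations of the path algebra of a quiver with finitely many vertices, on the
generators `e v` (`Sum.inl v`, one for each vertex) and `x a` (`Sum.inr a`, one for each arrow). -/
inductive PathRel :
    FreeAlgebra F (V ⊕ Quiver.Total V) → FreeAlgebra F (V ⊕ Quiver.Total V) → Prop
  | vertex_mul_vertex (v w : V) :
      PathRel (FreeAlgebra.ι F (Sum.inl v) * FreeAlgebra.ι F (Sum.inl w))
        (if v = w then FreeAlgebra.ι F (Sum.inl v) else 0)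
  | vertex_mul_arrow (v : V) (a : Quiver.Total V) :
      PathRel (FreeAlgebra.ι F (Sum.inl v) * FreeAlgebra.ι F (Sum.inr a))
        (if v = a.left then FreeAlgebra.ι F (Sum.inr a) else 0)
  | arrow_mul_vertex (v : V) (a : Quiver.Total V) :
      PathRel (FreeAlgebra.ι F (Sum.inr a) * FreeAlgebra.ι F (Sum.inl v))
        (if v = a.right then FreeAlgebra.ι F (Sum.inr a) else 0)
  | arrow_mul_arrow (a b : Quiver.Total V) (h : b.left ≠ a.right) :
      PathRel (FreeAlgebra.ι F (Sum.inr a) * FreeAlgebra.ι F (Sum.inr b)) 0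
  | one : PathRel (∑ v : V, FreeAlgebra.ι F (Sum.inl v)) 1

/-- The path algebra of a quiver: paths multiply by concatenation when the end of the first is the
start of the second, and to zero otherwise. -/
abbrev PathAlgebra : Type _ := RingQuot (PathRel F V)

variable {V}

/-- The arrow `a`, as an element of the path algebra. -/
noncomputable def PathAlgebra.arrow (a : Quiver.Total V) : PathAlgebra F V :=
  RingQuot.mkAlgHom F (PathRel F V) (FreeAlgebra.ι F (Sum.inr a))

end PathAlgebra

/-! ### The algebra of a tensor of order `d = k + 1` -/

section TensorAlgebra

variable {k : ℕ} (n : Fin (k + 1) → ℕ)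

/-- The `d = k + 1` vertices of the quiver attached to the format `n`. -/
def TensorVertex (_n : Fin (k + 1) → ℕ) : Type := Fin (k + 1)

instance : Fintype (TensorVertex n) := inferInstanceAs (Fintype (Fin (k + 1)))

instance : DecidableEq (TensorVertex n) := inferInstanceAs (DecidableEq (Fin (k + 1)))

/-- Arrows in direction `i` start at vertex `i`, except that those in the last direction start
at the first vertex. -/
def tensorArrowSource (i : Fin (k + 1)) : TensorVertex n :=
  (Fin.lastCases (motive := fun _ => Fin (k + 1)) 0 (fun j => j.castSucc) i : Fin (k + 1))

/-- Arrows in direction `i` end at vertex `i + 1`, except that those in the last direction end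
at the last vertex. -/
def tensorArrowTarget (i : Fin (k + 1)) : TensorVertex n :=
  (Fin.lastCases (motive := fun _ => Fin (k + 1)) (Fin.last k) (fun j => j.succ) i : Fin (k + 1))

/-- The quiver with `n i` parallel arrows from vertex `i` to vertex `i + 1` for each `i` but the
last, and `n (Fin.last k)` parallel arrows from the first vertex to the last vertex. -/
instance : Quiver (TensorVertex n) where
  Hom u v := {a : Σ i, Fin (n i) // tensorArrowSource n a.1 = u ∧ tensorArrowTarget n a.1 = v}

/-- The arrow `x_{i,a}`. -/
def tensorArrow (i : Fin (k + 1)) (a : Fin (n i)) : Quiver.Total (TensorVertex n) :=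
  ⟨tensorArrowSource n i, tensorArrowTarget n i, ⟨⟨i, a⟩, rfl, rfl⟩⟩

variable {n} {F : Type*} [Field F]

/-- The relation `x_{1,i_1} x_{2,i_2} ⋯ x_{d-1,i_{d-1}} = ∑ a, A(i_1, …, i_{d-1}, a) x_{d,a}`
(the product is taken in this order). -/
inductive TensorRel (A : Tensor F n) :
    PathAlgebra F (TensorVertex n) → PathAlgebra F (TensorVertex n) → Prop
  | rewrite (I : ∀ j : Fin k, Fin (n j.castSucc)) :
      TensorRel A
        (List.ofFn fun j : Fin k => PathAlgebra.arrow F (tensorArrow n j.castSucc (I j))).prod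
        (∑ a : Fin (n (Fin.last k)),
          A (Fin.snoc (α := fun i => Fin (n i)) I a) •
            PathAlgebra.arrow F (tensorArrow n (Fin.last k) a))

/-- The algebra attached to a tensor. -/
abbrev TensorQuiverAlgebra (A : Tensor F n) : Type _ := RingQuot (TensorRel A)

end TensorAlgebra

/-! ### Encoding arrays as strings

Side lengths are written in unary (`tick` repeated, then `sep`); entries are written one after
another in lexicographic order of their indices, each entry `x` as the string `tok x`. -/

section Encoding

variable {F Γ : Type*}

/-- The entries of an array in lexicographic order of their indices (last index fastest). -/
def tensorEntries : ∀ {d : ℕ} (n : Fin d → ℕ), Tensor F n → List F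
  | 0, _, A => [A fun i => i.elim0]
  | _ + 1, n, A => (List.finRange (n 0)).flatMap fun a =>
      tensorEntries (Fin.tail n) fun I => A (Fin.cons (α := fun i => Fin (n i)) a I)

def encodeTensor (tick sep : Γ) (tok : F → List Γ) {d : ℕ}
    (X : Σ n : Fin d → ℕ, Tensor F n) : List Γ :=
  ((List.finRange d).flatMap fun i => List.replicate (X.1 i) tick ++ [sep]) ++
    (tensorEntries X.1 X.2).flatMap tok

def encodeStructureArray (tick sep : Γ) (tok : F → List Γ)
    (X : Σ N : ℕ, StructureArray F N) : List Γ :=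
  List.replicate X.1 tick ++ [sep] ++
    (List.finRange X.1).flatMap fun i => (List.finRange X.1).flatMap fun j =>
      (List.finRange X.1).flatMap fun l => tok (X.2 i j l)

/-- Strings for the Turing model: a field element is written by means of an encoding over a finite
alphabet `Γ`, followed by a separator; the symbols `tick` and `sep` are new. -/
def turingToken {Γ : Type*} (enc : Computability.Encoding F Γ) (x : F) : List (Γ ⊕ Bool) :=
  (enc.encode x).map Sum.inl ++ [Sum.inr false]

end Encoding

/-! ### Polynomial time on Turing machines -/

/-- `f` is computed by a Turing machine in time polynomial in the length of the input string.
This is `Turing.TM2ComputableInPolyTime` as a proposition, for domains in any universe. -/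
def PolyTimeTuring {α β : Type*} {Γ₀ Γ₁ : Type} (ea : α → List Γ₀) (eb : β → List Γ₁)
    (f : α → β) : Prop :=
  ∃ (M : Turing.TM2ComputableAux Γ₀ Γ₁) (p : Polynomial ℕ), ∀ a,
    Nonempty (Turing.TM2OutputsInTime M.tm ((ea a).map M.inputAlphabet.symm)
      (some ((eb (f a)).map M.outputAlphabet.symm)) (p.eval (ea a).length))

/-! ### Polynomial time on Blum–Shub–Smale machines

Machines over a field `F` whose memory cells hold elements of `F`. The unbounded memory is organised
in finitely many stacks; every node performs one field operation, one test, or one stack operation,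
and costs one step. -/

namespace BSS

inductive Op
  | add | sub | mul | div

/-- The field operations; division by zero, which a machine can test for, returns zero. -/
def Op.eval {F : Type*} [Field F] : Op → F → F → F
  | .add, x, y => x + y
  | .sub, x, y => x - y
  | .mul, x, y => x * y
  | .div, x, y => x / y

/-- The nodes of a flowchart with labels in `Λ`, acting on stacks indexed by `K`. -/
inductive Node (F Λ K : Type*)
  /-- push the constant `c` on stack `s` -/
  | const (c : F) (s : K) (next : Λ)
  /-- push a copy of the top of stack `r` on stack `s` -/
  | copy (r s : K) (next : Λ)
  /-- push the result of `op`, applied to the tops of stacks `q` and `r`, on stack `s` -/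
  | arith (op : Op) (q r s : K) (next : Λ)
  /-- remove the top of stack `s` -/
  | pop (s : K) (next : Λ)
  /-- branch on whether the top of stack `s` is zero -/
  | ifZero (s : K) (yes no : Λ)
  /-- branch on whether stack `s` is empty -/
  | ifEmpty (s : K) (yes no : Λ)
  | halt

/-- A machine over `F`: a finite flowchart and finitely many stacks. -/
structure Machine (F : Type*) where
  Λ : Type
  K : Type
  [finΛ : Finite Λ]
  [finK : Finite K]
  [decK : DecidableEq K]
  start : Λ
  input : K
  output : K
  node : Λ → Node F Λ K

/-- A configuration: the current label (`none` after halting) and the contents of the stacks, with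
the top of each stack at the head of its list. -/
structure Cfg {F : Type*} (M : Machine F) where
  label : Option M.Λ
  stk : M.K → List F

variable {F : Type*} [Field F]

/-- The top of a stack; reading an empty stack returns zero. -/
def top (l : List F) : F := l.headD 0

/-- One step of a machine. -/
noncomputable def Machine.step (M : Machine F) : Cfg M → Option (Cfg M)
  | ⟨none, _⟩ => none
  | ⟨some q, S⟩ =>
    letI := M.decK
    some <| match M.node q with
      | .const c s next => ⟨some next, Function.update S s (c :: S s)⟩
      | .copy r s next => ⟨some next, Function.update S s (top (S r) :: S s)⟩
      | .arith op q r s next =>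
          ⟨some next, Function.update S s (op.eval (top (S q)) (top (S r)) :: S s)⟩
      | .pop s next => ⟨some next, Function.update S s (S s).tail⟩
      | .ifZero s yes no =>
          letI := Classical.dec (top (S s) = 0)
          ⟨some (if top (S s) = 0 then yes else no), S⟩
      | .ifEmpty s yes no => ⟨some (if (S s).isEmpty then yes else no), S⟩
      | .halt => ⟨none, S⟩

/-- The initial configuration: the input on the input stack, all other stacks empty. -/
def Machine.init (M : Machine F) (l : List F) : Cfg M :=
  letI := M.decK
  ⟨some M.start, fun s => if s = M.input then l else []⟩

/-- Started on the string `l`, the machine halts within `t` steps with the string `l'` on its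
output stack. -/
def Machine.OutputsInTime (M : Machine F) (l l' : List F) (t : ℕ) : Prop :=
  ∃ c : Cfg M, c.label = none ∧ c.stk M.output = l' ∧
    Nonempty (StateTransition.EvalsToInTime M.step (M.init l) (some c) t)

end BSS

/-- `f` is computed by a machine over `F` in a number of steps polynomial in the length of the
input, a string of field elements. -/
def PolyTimeBSS (F : Type*) [Field F] {α β : Type*} (ea : α → List F) (eb : β → List F)
    (f : α → β) : Prop :=
  ∃ (M : BSS.Machine F) (p : Polynomial ℕ), ∀ a,
    M.OutputsInTime (ea a) (eb (f a)) (p.eval (ea a).length)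

/-!
The algebra of a tensor `A` of order `k + 1` has a basis of paths: a vertex, an arrow in the last
direction, or a path `x_{u,a_u} ⋯ x_{w-1,a_{w-1}}` with `(u, w)` different from (first, last). They
span, since every longer product is rewritten by the relations; they are independent, since left
multiplication by vertices and arrows can be written down on the space with this basis and satisfies
the relations (`isTensorRep_regular`, `pathValue_bijective`). The number of paths is at most
`(k + 1) ^ 2 * n ^ k`, and a structure constant (`pathCoeff`) is `0`, `1` or an entry of `A`; the
entries occur when a path from the first to an inner vertex is multiplied by a path from there to
the last vertex.

An isomorphism of tensors acts on the arrows and so induces an isomorphism of algebras. Conversely,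
let `φ` be an isomorphism of algebras. The characters of the algebra correspond to the vertices, and
an element killed by all of them is nilpotent. So there is a permutation `τ` of the
vertices such that `f_v = φ (e_{τ v})` has the same characters as the vertex idempotent `e_v`; then
`∑ f_v e_v` is a unit, and after conjugation by it `φ` sends `e_{τ v}` to `e_v`
(`exists_algEquiv_idem`). If all side
lengths are positive, the corner `e_v R e_w` is nonzero exactly for `v ≤ w`, so `τ` is monotone and
hence the identity. Now `φ` preserves the corners `e_i R e_{i+1}` and `e_1 R e_d`, which for `d ≥ 3`
are spanned by the arrows in one direction; the resulting matrices, with the contragredient one in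
the last direction, form an isomorphism of tensors (`tensorIso_iff`, `tensorIso_of_algEquiv`).

For the running time, the structure constants are computed by a structured program on finitely many
stacks (`StackProg`) which is translated step by step both to Blum–Shub–Smale machines (`Exec.bss`)
and to Turing machines (`Exec.turing`). The program stores the side lengths and the loop variables in
unary, and loops over all triples of paths in the order of the output. The entries of `A` are only
copied: for the paths from the first vertex to a fixed inner vertex as first factor, the loops need
the entries exactly once and in the order in which they are given (`row_input`), so that the input
is streamed and then rewound. Each loop multiplies the time by a polynomial, and there are
boundedly many nested loops for fixed `k` (`exec_mainProg`).
-/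

/-! ### Structured programs on stacks -/

/-- Structured programs acting on stacks of symbols from `S`, the stacks being indexed by `K`. -/
inductive StackProg (S K : Type*)
  /-- push the symbol `c` on stack `s` -/
  | const (c : S) (s : K)
  /-- push a copy of the top of stack `r` on stack `s` -/
  | copy (r s : K)
  /-- remove the top of stack `s` -/
  | pop (s : K)
  | seq (P Q : StackProg S K)
  /-- repeat `P` as long as stack `s` is nonempty -/
  | whileNonempty (s : K) (P : StackProg S K)
  /-- repeat `P` as long as the top of stack `s` is not the mark symbol -/
  | whileUnmarked (s : K) (P : StackProg S K)

namespace StackProg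

variable {S K : Type*}

section Exec

variable [DecidableEq K]

open Function (update)

/-- `Exec z P σ σ' t`: with mark symbol `z`, the program `P` turns the stack contents `σ` into `σ'`
in `t` steps. Reading an empty stack returns `z`. -/
inductive Exec (z : S) : StackProg S K → (K → List S) → (K → List S) → ℕ → Prop
  | const (c : S) (s : K) (σ : K → List S) : Exec z (.const c s) σ (update σ s (c :: σ s)) 1
  | copy (r s : K) (σ : K → List S) :
      Exec z (.copy r s) σ (update σ s ((σ r).headD z :: σ s)) 1
  | pop (s : K) (σ : K → List S) : Exec z (.pop s) σ (update σ s (σ s).tail) 1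
  | seq {P Q : StackProg S K} {σ σ₁ σ₂ : K → List S} {t₁ t₂ : ℕ} :
      Exec z P σ σ₁ t₁ → Exec z Q σ₁ σ₂ t₂ → Exec z (.seq P Q) σ σ₂ (t₁ + t₂)
  | nonempty_done {s : K} (P : StackProg S K) {σ : K → List S} :
      σ s = [] → Exec z (.whileNonempty s P) σ σ 1
  | nonempty_step {s : K} {P : StackProg S K} {σ σ₁ σ₂ : K → List S} {t₁ t₂ : ℕ} :
      σ s ≠ [] → Exec z P σ σ₁ t₁ → Exec z (.whileNonempty s P) σ₁ σ₂ t₂ →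
      Exec z (.whileNonempty s P) σ σ₂ (1 + t₁ + t₂)
  | unmarked_done {s : K} (P : StackProg S K) {σ : K → List S} :
      (σ s).headD z = z → Exec z (.whileUnmarked s P) σ σ 1
  | unmarked_step {s : K} {P : StackProg S K} {σ σ₁ σ₂ : K → List S} {t₁ t₂ : ℕ} :
      (σ s).headD z ≠ z → Exec z P σ σ₁ t₁ → Exec z (.whileUnmarked s P) σ₁ σ₂ t₂ →
      Exec z (.whileUnmarked s P) σ σ₂ (1 + t₁ + t₂)

/-- Each step pushes at most one symbol. -/
theorem Exec.length_le {z : S} {P : StackProg S K} {σ σ' : K → List S} {t : ℕ}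
    (h : Exec z P σ σ' t) (s : K) : (σ' s).length ≤ (σ s).length + t := by
  induction h with
  | const c r σ | copy _ r σ | pop r σ =>
    rcases eq_or_ne s r with rfl | hs
    · simp; try omega
    · simp [Function.update_of_ne hs]
  | seq _ _ ih₁ ih₂ => omega
  | nonempty_done | unmarked_done => omega
  | nonempty_step _ _ _ ih₁ ih₂ | unmarked_step _ _ _ ih₁ ih₂ => omega

theorem Exec.congr_right {z : S} {P : StackProg S K} {σ σ₁ σ₂ : K → List S} {t : ℕ}
    (h : Exec z P σ σ₁ t) (h' : σ₂ = σ₁) : Exec z P σ σ₂ t :=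
  h' ▸ h

end Exec

/-! ### Flowcharts of structured programs -/

/-- The program points of a structured program. -/
def Pos : StackProg S K → Type
  | .const _ _ | .copy _ _ | .pop _ => Unit
  | .seq P Q => P.Pos ⊕ Q.Pos
  | .whileNonempty _ P | .whileUnmarked _ P => Option P.Pos

instance finite_pos : ∀ P : StackProg S K, Finite P.Pos
  | .const _ _ | .copy _ _ | .pop _ => inferInstanceAs (Finite Unit)
  | .seq P Q =>
    have := finite_pos P
    have := finite_pos Q
    inferInstanceAs (Finite (P.Pos ⊕ Q.Pos))
  | .whileNonempty _ P | .whileUnmarked _ P =>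
    have := finite_pos P
    inferInstanceAs (Finite (Option P.Pos))

/-- The program point at which the execution starts. -/
def entry : ∀ P : StackProg S K, P.Pos
  | .const _ _ | .copy _ _ | .pop _ => ()
  | .seq P _ => Sum.inl P.entry
  | .whileNonempty _ _ | .whileUnmarked _ _ => none

/-- The nodes of a flowchart with labels in `Λ`: pushing a constant, copying the top of a stack,
popping, and branching on whether the top of a stack is the mark symbol or the stack is empty. -/
inductive FlowNode (S K Λ : Type*)
  | const (c : S) (s : K) (next : Λ)
  | copy (r s : K) (next : Λ)
  | pop (s : K) (next : Λ)
  | ifMark (s : K) (yes no : Λ)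
  | ifEmpty (s : K) (yes no : Λ)

/-- The node at each program point, where program points are turned into labels by `emb` and
control passes to `exit` at the end of the program. -/
def node {Λ : Type*} : ∀ (P : StackProg S K) (_emb : P.Pos → Λ) (_exit : Λ),
    P.Pos → FlowNode S K Λ
  | .const c s, _, exit, _ => .const c s exit
  | .copy r s, _, exit, _ => .copy r s exit
  | .pop s, _, exit, _ => .pop s exit
  | .seq P Q, emb, _, Sum.inl p => P.node (emb ∘ Sum.inl) (emb (Sum.inr Q.entry)) p
  | .seq _ Q, emb, exit, Sum.inr p => Q.node (emb ∘ Sum.inr) exit p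
  | .whileNonempty s P, emb, exit, none => .ifEmpty s exit (emb (some P.entry))
  | .whileNonempty _ P, emb, _, some p => P.node (emb ∘ some) (emb none) p
  | .whileUnmarked s P, emb, exit, none => .ifMark s exit (emb (some P.entry))
  | .whileUnmarked _ P, emb, _, some p => P.node (emb ∘ some) (emb none) p

open Classical in
/-- The effect of a node: the next label and the new contents of the stacks. -/
noncomputable def FlowNode.step [DecidableEq K] {Λ : Type*} (z : S) :
    FlowNode S K Λ → (K → List S) → Λ × (K → List S)
  | .const c s next, σ => (next, Function.update σ s (c :: σ s))
  | .copy r s next, σ => (next, Function.update σ s ((σ r).headD z :: σ s))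
  | .pop s next, σ => (next, Function.update σ s (σ s).tail)
  | .ifMark s yes no, σ => (if (σ s).headD z = z then yes else no, σ)
  | .ifEmpty s yes no, σ => (if σ s = [] then yes else no, σ)

/-- Any machine `f` whose steps follow the nodes of `P` executes the program `P`. -/
theorem Exec.iterate [DecidableEq K] {Λ C : Type*} {z : S} {f : C → Option C}
    {cfg : Λ → (K → List S) → C} {P : StackProg S K} {σ σ' : K → List S} {t : ℕ}
    (h : Exec z P σ σ' t) : ∀ (emb : P.Pos → Λ) (exit : Λ),
    (∀ p σ, f (cfg (emb p) σ) = some (cfg ((P.node emb exit p).step z σ).1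
      ((P.node emb exit p).step z σ).2)) →
    (flip bind f)^[t] (some (cfg (emb P.entry) σ)) = some (cfg exit σ') := by
  induction h with
  | const c s σ | copy r s σ | pop s σ => exact fun emb exit hf => hf () σ
  | seq _ _ ih₁ ih₂ =>
    intro emb exit hf
    rw [add_comm, Function.iterate_add_apply]
    erw [ih₁ (emb ∘ Sum.inl) (emb (Sum.inr _)) fun p σ => hf (Sum.inl p) σ]
    exact ih₂ (emb ∘ Sum.inr) exit fun p σ => hf (Sum.inr p) σ
  | nonempty_done P hs =>
    intro emb exit hf
    refine (hf none _).trans ?_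
    simp [node, FlowNode.step, hs]
  | unmarked_done P hs =>
    intro emb exit hf
    refine (hf none _).trans ?_
    simp only [node, FlowNode.step]
    rw [if_pos hs]
  | @nonempty_step _ _ σ₀ _ _ _ _ hs _ _ ih₁ ih₂ =>
    intro emb exit hf
    rw [add_comm 1, add_comm, Function.iterate_add_apply, Function.iterate_add_apply]
    have h1 := hf none σ₀
    simp only [node, FlowNode.step, if_neg hs] at h1
    have h2 := ih₁ (emb ∘ some) (emb none) fun p σ => hf (some p) σ
    have h3 : (flip bind f)^[1] (some (cfg (emb none) σ₀)) = _ := h1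
    exact (congrArg _ (congrArg _ h3)).trans ((congrArg _ h2).trans (ih₂ emb exit hf))
  | @unmarked_step _ _ σ₀ _ _ _ _ hs _ _ ih₁ ih₂ =>
    intro emb exit hf
    rw [add_comm 1, add_comm, Function.iterate_add_apply, Function.iterate_add_apply]
    have h1 := hf none σ₀
    simp only [node, FlowNode.step, if_neg hs] at h1
    have h2 := ih₁ (emb ∘ some) (emb none) fun p σ => hf (some p) σ
    have h3 : (flip bind f)^[1] (some (cfg (emb none) σ₀)) = _ := h1
    exact (congrArg _ (congrArg _ h3)).trans ((congrArg _ h2).trans (ih₂ emb exit hf))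

end StackProg

/-! ### Structured programs on the two machine models -/

namespace StackProg

/-- A flowchart node as a node of a Blum–Shub–Smale machine; the mark symbol is `0`. -/
def FlowNode.toBSS {F K Λ : Type*} : FlowNode F K Λ → BSS.Node F Λ K
  | .const c s next => .const c s next
  | .copy r s next => .copy r s next
  | .pop s next => .pop s next
  | .ifMark s yes no => .ifZero s yes no
  | .ifEmpty s yes no => .ifEmpty s yes no

/-- The Blum–Shub–Smale machine running a structured program; the label `none` halts. -/
def bssMachine {F : Type*} {K : Type} [Finite K] [DecidableEq K] (P : StackProg F K)
    (inp out : K) : BSS.Machine F where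
  Λ := Option P.Pos
  K := K
  start := some P.entry
  input := inp
  output := out
  node
    | none => .halt
    | some p => (P.node some none p).toBSS

/-- A structured program runs on a Blum–Shub–Smale machine with one more step, which halts. -/
theorem Exec.bss {F : Type*} [Field F] {K : Type} [Finite K] [DecidableEq K]
    {P : StackProg F K} {inp out : K} {l : List F} {σ : K → List F} {t : ℕ}
    (h : Exec 0 P (fun s => if s = inp then l else []) σ t) :
    (P.bssMachine inp out).OutputsInTime l (σ out) (t + 1) := by
  refine ⟨⟨none, σ⟩, rfl, rfl, ⟨⟨⟨t + 1, ?_⟩, le_rfl⟩⟩⟩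
  have key := h.iterate (K := K) (f := (P.bssMachine inp out).step) (Λ := Option P.Pos)
    (cfg := fun q σ => ⟨some q, σ⟩) some none ?_
  · rw [Function.iterate_succ_apply']
    erw [key]
    rfl
  · intro p σ
    cases hn : P.node some none p <;>
      simp [BSS.Machine.step, bssMachine, hn, FlowNode.toBSS, FlowNode.step, BSS.top] <;>
      rfl

/-- A flowchart node as a statement of a multi-stack Turing machine, whose internal state only
holds the symbol read last and is reset at the end of each statement. -/
noncomputable def FlowNode.toTM2 {S K Λ : Type} [DecidableEq S] (z : S) :
    FlowNode S K Λ → Turing.TM2.Stmt (fun _ : K => S) Λ (Option S)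
  | .const c s next => .push s (fun _ => c) <| .goto fun _ => next
  | .copy r s next => .peek r (fun _ x => x) <| .push s (fun v => v.getD z) <|
      .load (fun _ => none) <| .goto fun _ => next
  | .pop s next => .pop s (fun _ _ => none) <| .goto fun _ => next
  | .ifMark s yes no => .peek s (fun _ x => x) <| .branch (fun v => decide (v.getD z = z))
      (.load (fun _ => none) <| .goto fun _ => yes) (.load (fun _ => none) <| .goto fun _ => no)
  | .ifEmpty s yes no => .peek s (fun _ x => x) <| .branch (fun v => v.isNone)
      (.load (fun _ => none) <| .goto fun _ => yes) (.load (fun _ => none) <| .goto fun _ => no)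

theorem FlowNode.stepAux_toTM2 {S K Λ : Type} [DecidableEq S] [DecidableEq K] (z : S)
    (a : FlowNode S K Λ) (σ : K → List S) :
    Turing.TM2.stepAux (a.toTM2 z) none σ = ⟨some (a.step z σ).1, none, (a.step z σ).2⟩ := by
  cases a with
  | const | copy | pop => simp [FlowNode.toTM2, FlowNode.step]
  | ifMark s yes no =>
    by_cases hz : (σ s).head?.getD z = z <;> simp [FlowNode.toTM2, FlowNode.step, hz]
  | ifEmpty s yes no => cases hz : σ s <;> simp [FlowNode.toTM2, FlowNode.step, hz]

/-- The Turing machine running a structured program; the label `none` halts. -/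
noncomputable def turingMachine {S K : Type} [Fintype S] [DecidableEq S] [Fintype K]
    [DecidableEq K] (z : S) (P : StackProg S K) (inp out : K) : Turing.FinTM2 where
  K := K
  k₀ := inp
  k₁ := out
  Γ _ := S
  Λ := Option P.Pos
  main := some P.entry
  ΛFin := Fintype.ofFinite _
  σ := Option S
  initialState := none
  m
    | none => .halt
    | some p => (P.node some none p).toTM2 z

/-- A structured program runs on a Turing machine with one more step, which halts. All stacks but
the output stack have to be empty at the end. -/
theorem Exec.turing {S K : Type} [Fintype S] [DecidableEq S] [Fintype K] [DecidableEq K] {z : S}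
    {P : StackProg S K} {inp out : K} {l l' : List S} {t m : ℕ}
    (h : Exec z P (fun s => if s = inp then l else []) (fun s => if s = out then l' else []) t)
    (hm : t + 1 ≤ m) :
    Nonempty (Turing.TM2OutputsInTime (P.turingMachine z inp out) l (some l') m) := by
  refine ⟨⟨⟨t + 1, ?_⟩, hm⟩⟩
  have key := h.iterate (f := (P.turingMachine z inp out).step) (Λ := Option P.Pos)
    (cfg := fun q σ => ⟨some q, none, σ⟩) some none ?_
  · have h0 : ((⟨some (some P.entry), none, fun s => if s = inp then l else []⟩ :
        Turing.TM2.Cfg (fun _ : K => S) (Option P.Pos) (Option S))) =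
        Turing.initList (P.turingMachine z inp out) l := by
      simp only [Turing.initList, turingMachine]
      congr 1
    rw [Function.iterate_succ_apply']
    erw [← h0, key]
    simp only [Option.map, Turing.haltList, turingMachine]
    change some _ = some _
    congr 2
  · intro p σ
    exact congrArg some (FlowNode.stepAux_toTM2 z _ σ)

end StackProg

/-! ### Enumerating multi-indices -/

section Nest

variable {ι : Type*} [DecidableEq ι] (n : ι → ℕ)

/-- The multi-indices which agree with `I` off the directions in the list and are bounded by `n` in
these directions, in lexicographic order. -/
def nestList : List ι → (ι → ℕ) → List (ι → ℕ)
  | [], I => [I]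
  | i :: is, I => (List.range (n i)).flatMap fun a => nestList is (Function.update I i a)

variable {n}

theorem mem_nestList {is : List ι} (his : is.Nodup) {I J : ι → ℕ} :
    J ∈ nestList n is I ↔ (∀ i ∈ is, J i < n i) ∧ ∀ i ∉ is, J i = I i := by
  induction is generalizing I with
  | nil => simp [nestList, funext_iff]
  | cons i is ih =>
    rw [List.nodup_cons] at his
    simp only [nestList, List.mem_flatMap, List.mem_range, ih his.2, List.mem_cons]
    constructor
    · rintro ⟨a, ha, h1, h2⟩
      refine ⟨?_, fun j hj => ?_⟩
      · rintro j (rfl | hj)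
        · rw [h2 j his.1]; simpa using ha
        · exact h1 j hj
      · rw [not_or] at hj
        rw [h2 j hj.2, Function.update_of_ne hj.1]
    · rintro ⟨h1, h2⟩
      refine ⟨J i, h1 i (Or.inl rfl), fun j hj => h1 j (Or.inr hj), fun j hj => ?_⟩
      rcases eq_or_ne j i with rfl | hne
      · simp
      · rw [Function.update_of_ne hne, h2 j (not_or.2 ⟨hne, hj⟩)]

theorem nodup_nestList {is : List ι} (his : is.Nodup) {I : ι → ℕ} : (nestList n is I).Nodup := by
  induction is generalizing I with
  | nil => simp [nestList]
  | cons i is ih =>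
    rw [List.nodup_cons] at his
    rw [nestList, List.nodup_flatMap]
    refine ⟨fun a _ => ih his.2, List.nodup_range.imp fun {a b} hab J ha hb => hab ?_⟩
    rw [mem_nestList his.2] at ha hb
    have := (ha.2 i his.1).symm.trans (hb.2 i his.1)
    simpa using this

theorem nestList_append (is js : List ι) (I : ι → ℕ) :
    nestList n (is ++ js) I = (nestList n is I).flatMap (nestList n js) := by
  induction is generalizing I with
  | nil => simp [nestList]
  | cons i is ih => simp [nestList, ih, List.flatMap_assoc]

theorem length_nestList (is : List ι) (I : ι → ℕ) :
    (nestList n is I).length = (is.map n).prod := by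
  induction is generalizing I with
  | nil => simp [nestList]
  | cons i is ih => simp [nestList, ih, List.length_flatMap]

theorem nestList_add {is : List ι} {I : ι → ℕ} (hI : ∀ i ∈ is, I i = 0) (J : ι → ℕ) :
    nestList n is (I + J) = (nestList n is J).map (I + ·) := by
  induction is generalizing J with
  | nil => simp [nestList]
  | cons i is ih =>
    have h (a : ℕ) : Function.update (I + J) i a = I + Function.update J i a := by
      funext j
      rcases eq_or_ne j i with rfl | hne
      · simp [hI j (by simp)]
      · simp [hne]
    simp only [nestList, List.map_flatMap, h]
    congr 1
    funext a
    exact ih (fun j hj => hI j (List.mem_cons_of_mem _ hj)) _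

theorem nestList_eq_map {is : List ι} {I : ι → ℕ} (hI : ∀ i ∈ is, I i = 0) :
    nestList n is I = (nestList n is 0).map (I + ·) := by
  simpa using nestList_add (n := n) hI 0

end Nest

theorem List.flatMap_ite_eq {α β : Type*} [DecidableEq α] {l : List α} (hl : l.Nodup) {b : α}
    (hb : b ∈ l) (g : α → List β) : l.flatMap (fun a => if a = b then g a else []) = g b := by
  induction l with
  | nil => simp at hb
  | cons a l ih =>
    rw [List.nodup_cons] at hl
    rcases eq_or_ne a b with rfl | hab
    · have : l.flatMap (fun c => if c = a then g c else []) = [] := by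
        rw [List.flatMap_eq_nil_iff]
        intro c hc
        rw [if_neg]
        rintro rfl
        exact hl.1 hc
      simp [this]
    · simp [hab, ih hl.2 ((List.mem_cons.1 hb).resolve_left (Ne.symm hab))]

theorem List.flatMap_finRange_get {α β : Type*} (l : List α) (f : α → List β) :
    (List.finRange l.length).flatMap (fun i => f (l.get i)) = l.flatMap f := by
  conv_rhs => rw [← List.ofFn_get l, List.ofFn_eq_map]
  rw [List.flatMap_map]

/-! ### The entries of a tensor -/

section TensorVal

variable {F : Type*} [Zero F]

/-- The entry of a tensor at a tuple of natural numbers, which is `0` outside the format. -/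
def tensorVal {d : ℕ} {n : Fin d → ℕ} (A : Tensor F n) (I : Fin d → ℕ) : F :=
  if h : ∀ i, I i < n i then A fun i => ⟨I i, h i⟩ else 0

theorem tensorVal_coe {d : ℕ} {n : Fin d → ℕ} (A : Tensor F n) (I : ∀ i, Fin (n i)) :
    tensorVal A (fun i => I i) = A I := by
  simp [tensorVal]

theorem nestList_map_succ {d : ℕ} (n : Fin (d + 1) → ℕ) (is : List (Fin d)) (a : ℕ)
    (J : Fin d → ℕ) :
    nestList n (is.map Fin.succ) (Fin.cons a J : Fin (d + 1) → ℕ) =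
      (nestList (Fin.tail n) is J).map fun J' => (Fin.cons a J' : Fin (d + 1) → ℕ) := by
  induction is generalizing J with
  | nil => simp [nestList]
  | cons i is ih =>
    simp only [List.map_cons, nestList, List.map_flatMap, Fin.tail]
    congr 1
    funext b
    rw [← Fin.cons_update, ih]

theorem tensorVal_cons {d : ℕ} {n : Fin (d + 1) → ℕ} (A : Tensor F n) (a : Fin (n 0))
    (J : Fin d → ℕ) :
    tensorVal A (Fin.cons (a : ℕ) J : Fin (d + 1) → ℕ) =
      tensorVal (n := Fin.tail n) (fun I => A (Fin.cons (α := fun i => Fin (n i)) a I)) J := by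
  unfold tensorVal
  by_cases h : ∀ i, J i < Fin.tail n i
  · have h' : ∀ i, (Fin.cons (a : ℕ) J : Fin (d + 1) → ℕ) i < n i :=
      Fin.cases (by simp) fun i => by simpa [Fin.tail] using h i
    rw [dif_pos h, dif_pos h']
    congr 1
    funext i
    refine Fin.cases ?_ (fun i => ?_) i <;> rfl
  · rw [dif_neg h, dif_neg]
    intro h'
    exact h fun i => by simpa [Fin.tail] using h' i.succ

theorem tensorEntries_eq {d : ℕ} (n : Fin d → ℕ) (A : Tensor F n) (I : Fin d → ℕ) :
    tensorEntries n A = (nestList n (List.finRange d) I).map (tensorVal A) := by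
  induction d with
  | zero => simp [tensorEntries, nestList, tensorVal]; congr; funext i; exact i.elim0
  | succ d ih =>
    rw [List.finRange_succ, nestList, tensorEntries, ← List.map_coe_finRange_eq_range,
      List.flatMap_map, List.map_flatMap]
    congr 1
    funext a
    rw [← Fin.cons_self_tail I, Fin.update_cons_zero, nestList_map_succ, List.map_map,
      ih _ _ (Fin.tail I)]
    refine List.map_congr_left fun J _ => ?_
    exact (tensorVal_cons A a J).symm

end TensorVal

/-! ### Indices of the basis paths -/

section PathIndex

/-- An index for paths: the start vertex `b.1.1`, the end vertex `b.1.2`, and in every direction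
`i` the number `b.2 i` of the arrow in direction `i` on the path; it is `0` if there is none. -/
abbrev PathIndex (k : ℕ) : Type := (Fin (k + 1) × Fin (k + 1)) × (Fin (k + 1) → ℕ)

variable {k : ℕ}

/-- The vertices on the way from `u` to `w`, without `w`. -/
def steps (u w : Fin (k + 1)) : List (Fin (k + 1)) :=
  (List.finRange (k + 1)).filter fun i => u ≤ i ∧ i < w

/-- The directions of the arrows on a basis path from `u` to `w`. For the paths from the first to
the last vertex these are the arrows in the last direction only. -/
def acts (B : Fin (k + 1) × Fin (k + 1)) : List (Fin (k + 1)) :=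
  if B = (0, Fin.last k) then [Fin.last k] else steps B.1 B.2

variable (k) in
/-- The pairs of start and end vertices of basis paths. -/
def blocks : List (Fin (k + 1) × Fin (k + 1)) :=
  (List.finRange (k + 1) ×ˢ List.finRange (k + 1)).filter fun B => B.1 ≤ B.2

/-- The indices of the basis paths for the format `n`. -/
def pathList (n : Fin (k + 1) → ℕ) : List (PathIndex k) :=
  (blocks k).flatMap fun B => (nestList n (acts B) 0).map fun I => (B, I)

theorem mem_steps {u w i : Fin (k + 1)} : i ∈ steps u w ↔ u ≤ i ∧ i < w := by
  simp [steps]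

theorem steps_self (u : Fin (k + 1)) : steps u u = [] := by
  rw [List.eq_nil_iff_forall_not_mem]
  intro i hi
  rw [mem_steps] at hi
  exact hi.1.not_gt hi.2

theorem sortedLT_steps (u w : Fin (k + 1)) : (steps u w).SortedLT :=
  ((List.sortedLT_finRange _).pairwise.filter _).sortedLT

theorem acts_full : acts (0, Fin.last k) = [Fin.last k] := if_pos rfl

theorem acts_of_ne {B : Fin (k + 1) × Fin (k + 1)} (h : B ≠ (0, Fin.last k)) :
    acts B = steps B.1 B.2 := if_neg h

theorem nodup_acts (B : Fin (k + 1) × Fin (k + 1)) : (acts B).Nodup := by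
  rw [acts]
  split_ifs
  · simp
  · exact (sortedLT_steps _ _).nodup

theorem acts_self (hk : 1 ≤ k) (u : Fin (k + 1)) : acts (u, u) = [] := by
  rw [acts_of_ne]
  · simp only [steps, List.filter_eq_nil_iff]
    simp
  · intro h
    rw [Prod.mk.injEq] at h
    have := h.1.symm.trans h.2
    simp [Fin.ext_iff] at this
    omega

theorem mem_blocks {B : Fin (k + 1) × Fin (k + 1)} : B ∈ blocks k ↔ B.1 ≤ B.2 := by
  simp only [blocks, List.mem_filter, decide_eq_true_eq, and_iff_right_iff_imp]
  exact fun _ => List.mem_product.2 ⟨List.mem_finRange _, List.mem_finRange _⟩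

theorem nodup_blocks : (blocks k).Nodup :=
  ((List.nodup_finRange _).product (List.nodup_finRange _)).filter _

theorem mem_pathList {n : Fin (k + 1) → ℕ} {b : PathIndex k} :
    b ∈ pathList n ↔ b.1.1 ≤ b.1.2 ∧ (∀ i ∈ acts b.1, b.2 i < n i) ∧ ∀ i ∉ acts b.1, b.2 i = 0 := by
  obtain ⟨B, I⟩ := b
  simp only [pathList, List.mem_flatMap, List.mem_map, Prod.mk.injEq, mem_blocks]
  constructor
  · rintro ⟨B, hB, I, hI, rfl, rfl⟩
    exact ⟨hB, by simpa using (mem_nestList (nodup_acts B)).1 hI⟩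
  · rintro ⟨hB, hI⟩
    exact ⟨B, hB, I, (mem_nestList (nodup_acts B)).2 (by simpa using hI), rfl, rfl⟩

theorem nodup_pathList (n : Fin (k + 1) → ℕ) : (pathList n).Nodup := by
  rw [pathList, List.nodup_flatMap]
  refine ⟨fun B _ => (nodup_nestList (nodup_acts B)).map fun I J h => (Prod.mk.inj h).2,
    nodup_blocks.imp fun {B B'} hB b hb hb' => hB ?_⟩
  simp only [List.mem_map] at hb hb'
  obtain ⟨I, -, rfl⟩ := hb
  obtain ⟨J, -, h⟩ := hb'
  exact (Prod.mk.inj h).1.symm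

theorem steps_eq_cons {u v w : Fin (k + 1)} (hv : (v : ℕ) = u + 1) (h : u < w) :
    steps u w = u :: steps v w := by
  refine (sortedLT_steps u w).eq_of_mem_iff (List.Pairwise.sortedLT ?_) fun i => ?_
  · rw [List.pairwise_cons]
    refine ⟨fun i hi => ?_, (sortedLT_steps v w).pairwise⟩
    rw [mem_steps, Fin.le_def] at hi
    rw [Fin.lt_def]
    omega
  · simp only [mem_steps, List.mem_cons, Fin.le_def, Fin.lt_def, Fin.ext_iff] at *
    omega

theorem steps_append_steps_append_last (v : Fin (k + 1)) :
    steps 0 v ++ steps v (Fin.last k) ++ [Fin.last k] = List.finRange (k + 1) := by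
  refine List.SortedLT.eq_of_mem_iff (List.Pairwise.sortedLT ?_) (List.sortedLT_finRange _)
    fun i => ?_
  · simp only [List.pairwise_append, (sortedLT_steps _ _).pairwise, List.mem_append, mem_steps,
      List.mem_singleton, List.pairwise_singleton]
    simp only [Fin.le_def, Fin.lt_def, Fin.ext_iff, Fin.val_last, Fin.val_zero]
    refine ⟨⟨trivial, trivial, fun a ha b hb => by omega⟩, trivial, fun a ha b hb => by omega⟩
  · have := i.isLt
    simp only [List.mem_append, mem_steps, List.mem_singleton, List.mem_finRange, Fin.le_def,
      Fin.lt_def, Fin.ext_iff, Fin.val_last, Fin.val_zero, iff_true]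
    omega

theorem steps_zero_last : steps 0 (Fin.last k) = (List.finRange k).map Fin.castSucc := by
  refine (sortedLT_steps _ _).eq_of_mem_iff ?_ fun i => ?_
  · exact (List.pairwise_map.2 ((List.sortedLT_finRange _).pairwise.imp fun h => by
      simpa using h)).sortedLT
  · simp only [mem_steps, Fin.zero_le, true_and, List.mem_map, List.mem_finRange]
    constructor
    · intro h
      exact ⟨i.castPred h.ne, by simp⟩
    · rintro ⟨j, rfl⟩
      exact Fin.castSucc_lt_last j

theorem length_pathList_le (hk : 1 ≤ k) (n : Fin (k + 1) → ℕ) (hn : 1 ≤ Finset.univ.sup n) :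
    (pathList n).length ≤ (k + 1) ^ 2 * Finset.univ.sup n ^ k := by
  have hacts (B : Fin (k + 1) × Fin (k + 1)) : (acts B).length ≤ k := by
    rw [acts]
    split_ifs
    · simpa using hk
    · have h : steps B.1 B.2 ⊆ steps 0 (Fin.last k) := fun i hi => by
        rw [mem_steps] at hi ⊢
        exact ⟨Fin.zero_le _, hi.2.trans_le (Fin.le_last _)⟩
      have := ((sortedLT_steps B.1 B.2).nodup.subperm h).length_le
      simpa [steps_zero_last] using this
  have hprod (is : List (Fin (k + 1))) : (is.map n).prod ≤ Finset.univ.sup n ^ is.length := by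
    induction is with
    | nil => simp
    | cons i is ih =>
      rw [List.map_cons, List.prod_cons, List.length_cons, pow_succ']
      exact Nat.mul_le_mul (Finset.le_sup (f := n) (Finset.mem_univ i)) ih
  rw [pathList, List.length_flatMap]
  refine (List.sum_le_card_nsmul _ (Finset.univ.sup n ^ k) ?_).trans ?_
  · simp only [List.mem_map]
    rintro _ ⟨B, -, rfl⟩
    rw [List.length_map, length_nestList]
    exact (hprod _).trans (Nat.pow_le_pow_right hn (hacts B))
  · rw [smul_eq_mul, List.length_map]
    refine Nat.mul_le_mul_right _ ((List.length_filter_le _ _).trans ?_)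
    rw [List.length_product]
    simp [sq]

end PathIndex

/-! ### Structure constants -/

section StructureConstants

variable {k : ℕ} {F : Type*}

/-- The product of paths with start and end vertices `B` and `B'` is rewritten by the relations of
the algebra: it runs from the first to the last vertex through an inner vertex. -/
def Rewrites (B B' : Fin (k + 1) × Fin (k + 1)) : Prop :=
  B.2 = B'.1 ∧ B.1 = 0 ∧ B'.2 = Fin.last k ∧ B.2 ≠ 0 ∧ B.2 ≠ Fin.last k

instance : DecidableRel (Rewrites (k := k)) := fun _ _ => inferInstanceAs (Decidable (_ ∧ _))

/-- The coefficient of the path with index `c` in the product of the paths with indices `b` and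
`b'`. -/
def pathCoeff [Zero F] [One F] {n : Fin (k + 1) → ℕ} (A : Tensor F n) (b b' c : PathIndex k) : F :=
  if Rewrites b.1 b'.1 then
    if c.1 = (0, Fin.last k) then tensorVal A (b.2 + b'.2 + c.2) else 0
  else if b.1.2 = b'.1.1 ∧ c = ((b.1.1, b'.1.2), b.2 + b'.2) then 1 else 0

/-- The structure constants of the algebra of a tensor with respect to the basis of paths. -/
def tensorStructure [Zero F] [One F] (n : Fin (k + 1) → ℕ) (A : Tensor F n) :
    StructureArray F (pathList n).length :=
  fun i j l => pathCoeff A ((pathList n).get i) ((pathList n).get j) ((pathList n).get l)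

end StructureConstants

/-! ### Loops over bounded variables -/

/-- The stacks of the program that computes structure constants. A variable `(s, i)` with bound
`n i` and value `a` is stored as `a` ticks on `lo s i` and `n i - a` ticks on `hi s i`. The variables
with `s = 0, 1, 2` hold the indices of the first factor, of the second factor and of the path whose
coefficient is written. -/
inductive Stk (k : ℕ)
  /-- the part of the input which has not been read -/
  | inp
  /-- the part of the input which has been read, in reverse -/
  | back
  /-- the output written so far, in reverse -/
  | acc
  /-- the final output -/
  | out
  /-- a counter for comparing two variables -/
  | tmp
  | lo (s : Fin 3) (i : Fin (k + 1))
  | hi (s : Fin 3) (i : Fin (k + 1))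
  deriving DecidableEq, Fintype

namespace StackProg

open Function

variable {S : Type*} {k : ℕ} {z tick : S}

section Move

variable {K : Type*} [DecidableEq K]

/-- Move the top of stack `r` to stack `s`. -/
def move (r s : K) : StackProg S K := .seq (.copy r s) (.pop r)

theorem exec_move {r s : K} (hrs : r ≠ s) {σ : K → List S} {x : S} {l : List S} (h : σ r = x :: l) :
    Exec z (move r s) σ (update (update σ s (x :: σ s)) r l) 2 := by
  have h1 := Exec.copy (z := z) r s σ
  have h2 := Exec.pop (z := z) r (update σ s ((σ r).headD z :: σ s))
  have h3 := h1.seq h2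
  simp only [h, update_of_ne hrs, List.headD_cons, List.tail_cons] at h3
  exact h3

/-- Move the contents of stack `r` to stack `s`, which reverses their order. -/
theorem exec_moveAll {r s : K} (hrs : r ≠ s) (l : List S) {σ : K → List S} (h : σ r = l) :
    Exec z (.whileNonempty r (move r s)) σ (update (update σ s (l.reverse ++ σ s)) r [])
      (3 * l.length + 1) := by
  induction l generalizing σ with
  | nil =>
    have : update (update σ s (([] : List S).reverse ++ σ s)) r [] = σ := by
      rw [List.reverse_nil, List.nil_append, update_eq_self, ← h, update_eq_self]
    rw [this]
    exact .nonempty_done _ h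
  | cons x l ih =>
    have h1 := ih (σ := update (update σ s (x :: σ s)) r l) (by simp)
    have h2 := Exec.nonempty_step (by simp [h]) (exec_move hrs h) h1
    convert h2 using 1
    · rw [update_of_ne hrs.symm, update_self, update_comm hrs, update_idem, update_idem]
      simp
    · simp only [List.length_cons]
      omega

theorem exec_popAll (r : K) (l : List S) {σ : K → List S} (h : σ r = l) :
    Exec z (.whileNonempty r (.pop r)) σ (update σ r []) (2 * l.length + 1) := by
  induction l generalizing σ with
  | nil =>
    rw [show update σ r [] = σ by rw [← h, update_eq_self]]
    exact .nonempty_done _ h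
  | cons x l ih =>
    have h1 := ih (σ := update σ r (σ r).tail) (by simp [h])
    have h2 := Exec.nonempty_step (by simp [h]) (Exec.pop r σ) h1
    convert h2 using 1
    · simp
    · simp only [List.length_cons]
      omega

end Move

/-- The values of the variables. -/
abbrev Env (k : ℕ) : Type := Fin 3 → Fin (k + 1) → ℕ

/-- Give the variable `(s, i)` the value `a`. -/
def Env.set (ρ : Env k) (s : Fin 3) (i : Fin (k + 1)) (a : ℕ) : Env k :=
  update ρ s (update (ρ s) i a)

theorem Env.set_apply_self (ρ : Env k) (s : Fin 3) (i : Fin (k + 1)) (a : ℕ) :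
    ρ.set s i a s = update (ρ s) i a := by
  simp [Env.set]

theorem Env.set_apply_of_ne (ρ : Env k) {s s' : Fin 3} (h : s' ≠ s) (i : Fin (k + 1)) (a : ℕ) :
    ρ.set s i a s' = ρ s' := by
  simp [Env.set, h]

theorem Env.set_self (ρ : Env k) (s : Fin 3) (i : Fin (k + 1)) : ρ.set s i (ρ s i) = ρ := by
  simp [Env.set]

theorem Env.set_set (ρ : Env k) (s : Fin 3) (i : Fin (k + 1)) (a b : ℕ) :
    (ρ.set s i a).set s i b = ρ.set s i b := by
  simp [Env.set]

theorem Env.set_comm (ρ : Env k) {s s' : Fin 3} (h : s ≠ s') (i i' : Fin (k + 1)) (a b : ℕ) :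
    (ρ.set s i a).set s' i' b = (ρ.set s' i' b).set s i a := by
  simp [Env.set, update_of_ne h, update_of_ne h.symm, update_comm h]

/-- The stacks hold the variables with values `ρ` and bounds `n`. -/
def Holds (tick : S) (n : Fin (k + 1) → ℕ) (ρ : Env k) (σ : Stk k → List S) : Prop :=
  ∀ s i, ρ s i ≤ n i ∧ σ (.lo s i) = List.replicate (ρ s i) tick ∧
    σ (.hi s i) = List.replicate (n i - ρ s i) tick

/-- The stacks after the input `c` has been read, with `rest` remaining, and the output `l` has been
written. -/
def streamed (σ : Stk k → List S) (rest c l : List S) : Stk k → List S :=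
  update (update (update σ .inp rest) .back (c.reverse ++ σ .back)) .acc (l.reverse ++ σ .acc)

/-- The stacks after the variable `(s, i)` has been given the value `a`. -/
def assign (tick : S) (n : Fin (k + 1) → ℕ) (σ : Stk k → List S) (s : Fin 3) (i : Fin (k + 1))
    (a : ℕ) : Stk k → List S :=
  update (update σ (.lo s i) (List.replicate a tick)) (.hi s i) (List.replicate (n i - a) tick)

/-- When the variables have the values `ρ`, the program reads `c` from the input, writes `l` to the
output and leaves the other stacks unchanged, in at most `T` steps. -/
def Streams (z tick : S) (P : StackProg S (Stk k)) (n : Fin (k + 1) → ℕ) (ρ : Env k)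
    (c l : List S) (T : ℕ) : Prop :=
  ∀ σ rest, Holds tick n ρ σ → σ .inp = c ++ rest →
    ∃ t ≤ T, Exec z P σ (streamed σ rest c l) t

variable {n : Fin (k + 1) → ℕ} {ρ : Env k} {σ : Stk k → List S}

theorem Holds.streamed (h : Holds tick n ρ σ) (rest c l : List S) :
    Holds tick n ρ (streamed σ rest c l) := by
  intro s i
  simpa [StackProg.streamed] using h s i

theorem Holds.update_tmp (h : Holds tick n ρ σ) (l : List S) :
    Holds tick n ρ (update σ .tmp l) := by
  intro s i
  simpa using h s i

theorem Holds.assign (h : Holds tick n ρ σ) (s : Fin 3) (i : Fin (k + 1)) {a : ℕ} (ha : a ≤ n i) :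
    Holds tick n (ρ.set s i a) (assign tick n σ s i a) := by
  intro s' i'
  have := h s' i'
  by_cases hs : s' = s
  · subst hs
    by_cases hi : i' = i
    · subst hi
      simpa [StackProg.assign, Env.set] using ha
    · simpa [StackProg.assign, Env.set, hi] using this
  · simpa [StackProg.assign, Env.set, hs] using this

theorem Holds.assign_eq (h : Holds tick n ρ σ) {s : Fin 3} {i : Fin (k + 1)} {a : ℕ}
    (ha : ρ s i = a) : StackProg.assign tick n σ s i a = σ := by
  rw [StackProg.assign, ← ha, ← (h s i).2.1, ← (h s i).2.2]
  simp

theorem streamed_nil (σ : Stk k → List S) : streamed σ (σ .inp) [] [] = σ := by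
  simp [streamed]

theorem streamed_streamed (σ : Stk k → List S) (rest rest' c c' l l' : List S) :
    streamed (streamed σ rest' c l) rest c' l' = streamed σ rest (c ++ c') (l ++ l') := by
  funext s
  cases s <;> simp [streamed]

theorem assign_streamed (σ : Stk k → List S) (rest c l : List S) (s : Fin 3) (i : Fin (k + 1))
    (a : ℕ) :
    assign tick n (streamed σ rest c l) s i a = streamed (assign tick n σ s i a) rest c l := by
  funext r
  cases r <;> simp [streamed, assign, update]

theorem assign_assign (σ : Stk k → List S) (s : Fin 3) (i : Fin (k + 1)) (a b : ℕ) :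
    assign tick n (assign tick n σ s i a) s i b = assign tick n σ s i b := by
  funext r
  cases r <;> simp [assign, update] <;> aesop

theorem assign_comm (σ : Stk k → List S) {s s' : Fin 3} (hs : s ≠ s') (i i' : Fin (k + 1))
    (a b : ℕ) :
    assign tick n (assign tick n σ s i a) s' i' b = assign tick n (assign tick n σ s' i' b) s i a := by
  funext r
  cases r <;> simp [assign, update] <;> aesop

theorem assign_update_tmp (σ : Stk k → List S) (s : Fin 3) (i : Fin (k + 1)) (a : ℕ) (l : List S) :
    assign tick n (update σ .tmp l) s i a = update (assign tick n σ s i a) .tmp l := by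
  funext r
  cases r <;> simp [assign, update]

theorem streamed_update_tmp (σ : Stk k → List S) (rest c l l' : List S) :
    streamed (update σ .tmp l') rest c l = update (streamed σ rest c l) .tmp l' := by
  funext r
  cases r <;> simp [streamed, update]

theorem exec_incr (h : Holds tick n ρ σ) {s : Fin 3} {i : Fin (k + 1)} (hi : ρ s i < n i) :
    Exec z (move (.hi s i) (.lo s i)) σ (assign tick n σ s i (ρ s i + 1)) 2 := by
  obtain ⟨m, hm⟩ : ∃ m, n i - ρ s i = m + 1 := ⟨n i - ρ s i - 1, by omega⟩
  have h1 : σ (.hi s i) = tick :: List.replicate m tick := by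
    rw [(h s i).2.2, hm, List.replicate_succ]
  have h2 := exec_move (z := z) (r := Stk.hi s i) (s := Stk.lo s i) (by simp) h1
  rw [(h s i).2.1] at h2
  rwa [assign, List.replicate_succ, show n i - (ρ s i + 1) = m by omega]

theorem exec_decr (h : Holds tick n ρ σ) {s : Fin 3} {i : Fin (k + 1)} {a : ℕ} (hi : ρ s i = a + 1) :
    Exec z (move (.lo s i) (.hi s i)) σ (assign tick n σ s i a) 2 := by
  have h1 : σ (.lo s i) = tick :: List.replicate a tick := by
    rw [(h s i).2.1, hi, List.replicate_succ]
  have h2 := exec_move (z := z) (r := Stk.lo s i) (s := Stk.hi s i) (by simp) h1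
  rw [(h s i).2.2, ← List.replicate_succ] at h2
  have h3 := (h s i).1
  rw [assign, update_comm (by simp)]
  rw [show n i - ρ s i + 1 = n i - a by omega] at h2
  exact h2

/-- Set the variable `(s, i)` to `0`. -/
def reset (s : Fin 3) (i : Fin (k + 1)) : StackProg S (Stk k) :=
  .whileNonempty (.lo s i) (move (.lo s i) (.hi s i))

theorem exec_reset (h : Holds tick n ρ σ) (s : Fin 3) (i : Fin (k + 1)) :
    Exec z (reset s i) σ (assign tick n σ s i 0) (3 * ρ s i + 1) := by
  have h1 := exec_moveAll (z := z) (r := Stk.lo s i) (s := Stk.hi s i) (by simp) _ (h s i).2.1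
  rw [(h s i).2.2] at h1
  have h3 := (h s i).1
  simp only [List.length_replicate, List.reverse_replicate, ← List.replicate_add] at h1
  rw [Nat.add_sub_cancel' h3] at h1
  rw [assign, update_comm (by simp)]
  exact h1

/-- Repeat `P` for the values of the variable `(s, i)` from the present one on. -/
def advance (s : Fin 3) (i : Fin (k + 1)) (P : StackProg S (Stk k)) : StackProg S (Stk k) :=
  .whileNonempty (.hi s i) (.seq P (move (.hi s i) (.lo s i)))

theorem exec_advance {P : StackProg S (Stk k)} {s : Fin 3} {i : Fin (k + 1)} {T : ℕ}
    {c l : ℕ → List S} (m : ℕ) : ∀ {a : ℕ} {σ : Stk k → List S} {rest : List S}, a + m = n i →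
    (∀ b, a ≤ b → b < n i → Streams z tick P n (ρ.set s i b) (c b) (l b) T) →
    Holds tick n (ρ.set s i a) σ → σ .inp = (List.range' a m).flatMap c ++ rest →
    ∃ t ≤ m * (T + 3) + 1, Exec z (advance s i P) σ
      (streamed (assign tick n σ s i (n i)) rest ((List.range' a m).flatMap c)
        ((List.range' a m).flatMap l)) t := by
  induction m with
  | zero =>
    intro a σ rest ha _ hσ hinp
    refine ⟨1, by simp, ?_⟩
    have h1 : ρ.set s i a s i = n i := by simpa [Env.set] using ha
    rw [hσ.assign_eq h1]
    simp only [List.range'_zero, List.flatMap_nil, List.nil_append] at hinp ⊢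
    rw [← hinp, streamed_nil]
    exact .nonempty_done _ (by rw [(hσ s i).2.2, h1]; simp)
  | succ m ih =>
    intro a σ rest ha hP hσ hinp
    have h1 : ρ.set s i a s i = a := by simp [Env.set]
    rw [List.range'_succ, List.flatMap_cons, List.append_assoc] at hinp
    obtain ⟨t₁, ht₁, e₁⟩ := hP a le_rfl (by omega) σ _ hσ hinp
    have hσ₁ := hσ.streamed ((List.range' (a + 1) m).flatMap c ++ rest) (c a) (l a)
    have e₂ := exec_incr (z := z) hσ₁ (s := s) (i := i) (by rw [h1]; omega)
    rw [h1] at e₂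
    have hσ₂ := hσ₁.assign s i (a := a + 1) (by omega)
    rw [Env.set_set] at hσ₂
    obtain ⟨t₃, ht₃, e₃⟩ := ih (rest := rest) (by omega) (fun b hb => hP b (by omega)) hσ₂
      (by simp [assign, streamed])
    have e := Exec.nonempty_step (by rw [(hσ s i).2.2, h1]; simp; omega) (e₁.seq e₂) e₃
    refine ⟨_, ?_, e.congr_right ?_⟩
    rotate_left
    · rw [assign_assign, assign_streamed, streamed_streamed]
      simp [List.range'_succ]
    · rw [Nat.add_mul, one_mul]
      omega

/-- Repeat `P` for all values of the variable `(s, i)`, which has to be `0` initially. -/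
def forLoop (s : Fin 3) (i : Fin (k + 1)) (P : StackProg S (Stk k)) : StackProg S (Stk k) :=
  .seq (advance s i P) (reset s i)

theorem Streams.forLoop {P : StackProg S (Stk k)} {s : Fin 3} {i : Fin (k + 1)} {T : ℕ}
    {c l : ℕ → List S} (h0 : ρ s i = 0)
    (hP : ∀ a < n i, Streams z tick P n (ρ.set s i a) (c a) (l a) T) :
    Streams z tick (forLoop s i P) n ρ ((List.range (n i)).flatMap c) ((List.range (n i)).flatMap l)
      (n i * (T + 6) + 2) := by
  intro σ rest hσ hinp
  rw [List.range_eq_range'] at *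
  have hσ' : Holds tick n (ρ.set s i 0) σ := by rwa [← h0, Env.set_self]
  obtain ⟨t₁, ht₁, e₁⟩ := exec_advance (n i) (zero_add _) (fun b _ => hP b) hσ' hinp
  have hσ₁ := (hσ.assign s i le_rfl).streamed rest ((List.range' 0 (n i)).flatMap c)
        ((List.range' 0 (n i)).flatMap l)
  have e₂ := exec_reset (z := z) hσ₁ s i
  rw [assign_streamed, assign_assign, hσ.assign_eq h0] at e₂
  refine ⟨_, ?_, e₁.seq e₂⟩
  have : ρ.set s i (n i) s i = n i := by simp [Env.set]
  rw [this, Nat.mul_add] at *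
  omega

theorem Streams.seq {P Q : StackProg S (Stk k)} {c c' l l' : List S} {T T' : ℕ}
    (hP : Streams z tick P n ρ c l T) (hQ : Streams z tick Q n ρ c' l' T') :
    Streams z tick (.seq P Q) n ρ (c ++ c') (l ++ l') (T + T') := by
  intro σ rest hσ hinp
  rw [List.append_assoc] at hinp
  obtain ⟨t₁, ht₁, e₁⟩ := hP σ _ hσ hinp
  obtain ⟨t₂, ht₂, e₂⟩ := hQ _ rest (hσ.streamed (c' ++ rest) c l) (by simp [streamed])
  rw [streamed_streamed] at e₂
  exact ⟨_, Nat.add_le_add ht₁ ht₂, e₁.seq e₂⟩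

theorem Streams.mono {P : StackProg S (Stk k)} {c l : List S} {T T' : ℕ}
    (hP : Streams z tick P n ρ c l T) (hT : T ≤ T') : Streams z tick P n ρ c l T' := by
  intro σ rest hσ hinp
  obtain ⟨t, ht, e⟩ := hP σ rest hσ hinp
  exact ⟨t, ht.trans hT, e⟩

/-! ### Loops that compare variables -/

/-- Repeat `Q` while the variable `(s, i)` is increased and `(s', i)` is decreased to `0`, and count
the steps on the stack `tmp`. -/
def approach (s s' : Fin 3) (i : Fin (k + 1)) (tick : S) (Q : StackProg S (Stk k)) :
    StackProg S (Stk k) :=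
  .whileNonempty (.lo s' i) (.seq (.seq (.const tick .tmp) (move (.lo s' i) (.hi s' i)))
    (.seq Q (move (.hi s i) (.lo s i))))

theorem exec_approach {Q : StackProg S (Stk k)} {s s' : Fin 3} (hs : s ≠ s') {i : Fin (k + 1)}
    {T : ℕ} {l : List S}
    (hQ : ∀ a b, a ≤ n i → b ≤ n i → Streams z tick Q n ((ρ.set s' i b).set s i a) [] l T) (b : ℕ) :
    ∀ {a : ℕ} {σ : Stk k → List S}, a + b ≤ n i → Holds tick n ((ρ.set s' i b).set s i a) σ →
    ∃ t ≤ b * (T + 6) + 1, Exec z (approach s s' i tick Q) σ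
      (update (streamed (assign tick n (assign tick n σ s' i 0) s i (a + b)) (σ .inp) []
        (List.replicate b l).flatten) .tmp (List.replicate b tick ++ σ .tmp)) t := by
  induction b with
  | zero =>
    intro a σ _ hσ
    refine ⟨1, by simp, ?_⟩
    have h1 : (ρ.set s' i 0).set s i a s i = a := by simp [Env.set]
    have h2 : (ρ.set s' i 0).set s i a s' i = 0 := by simp [Env.set, hs.symm]
    rw [hσ.assign_eq h2, add_zero, hσ.assign_eq h1]
    simp only [List.replicate_zero, List.flatten_nil, streamed_nil, List.nil_append, update_eq_self]
    have h3 : σ (.lo s' i) = [] := by rw [(hσ s' i).2.1, h2]; simp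
    exact .nonempty_done _ h3
  | succ b ih =>
    intro a σ hab hσ
    have h1 : (ρ.set s' i (b + 1)).set s i a s' i = b + 1 := by simp [Env.set, hs.symm]
    have e₁ := Exec.const (z := z) tick .tmp σ
    have hσ₁ := hσ.update_tmp (tick :: σ .tmp)
    have e₂ := exec_decr (z := z) hσ₁ h1
    have hσ₂ := hσ₁.assign s' i (a := b) (by omega)
    rw [Env.set_comm _ hs, Env.set_set] at hσ₂
    have h2 : (ρ.set s' i b).set s i a s i = a := by simp [Env.set]
    obtain ⟨t₃, ht₃, e₃⟩ := hQ a b (by omega) (by omega) _ _ hσ₂ rfl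
    have hσ₃ := hσ₂.streamed (assign tick n (update σ .tmp (tick :: σ .tmp)) s' i b .inp) [] l
    have e₄ := exec_incr (z := z) hσ₃ (s := s) (i := i) (by omega)
    rw [h2] at e₄
    have hσ₄ := hσ₃.assign s i (a := a + 1) (by omega)
    rw [Env.set_set] at hσ₄
    obtain ⟨t₅, ht₅, e₅⟩ := ih (by omega) hσ₄
    have e := Exec.nonempty_step (by rw [(hσ s' i).2.1, h1]; simp) ((e₁.seq e₂).seq (e₃.seq e₄)) e₅
    refine ⟨_, ?_, e.congr_right ?_⟩
    rotate_left
    · have h3 : ∀ τ : Stk k → List S, assign tick n τ s' i b .inp = τ .inp := fun τ => by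
        simp [assign]
      have h4 : ∀ (τ : Stk k → List S) (a : ℕ), assign tick n τ s i a .tmp = τ .tmp := fun τ a => by
        simp [assign]
      have h5 : ∀ (τ : Stk k → List S) (a : ℕ), assign tick n τ s i a .inp = τ .inp := fun τ a => by
        simp [assign]
      simp only [assign_streamed, assign_update_tmp, streamed_streamed, streamed_update_tmp,
        assign_comm _ hs, assign_assign, update_idem, h3, h4, h5]
      congr 1
      · rw [show a + (b + 1) = a + 1 + b by omega]
        simp [streamed, List.replicate_succ, update, assign]
      · simp [List.replicate_succ', update]
    · rw [Nat.add_mul, one_mul]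
      omega

/-- Undo the decrease of the variable `(s, i)` that was counted on the stack `tmp`. -/
def retreat (s : Fin 3) (i : Fin (k + 1)) : StackProg S (Stk k) :=
  .whileUnmarked .tmp (.seq (.pop .tmp) (move (.hi s i) (.lo s i)))

theorem exec_retreat (hz : tick ≠ z) {s : Fin 3} {i : Fin (k + 1)} {l : List S} (b : ℕ) :
    ∀ {a : ℕ} {σ : Stk k → List S}, a + b ≤ n i → Holds tick n (ρ.set s i a) σ →
    σ .tmp = List.replicate b tick ++ z :: l →
    Exec z (retreat s i) σ (update (assign tick n σ s i (a + b)) .tmp (z :: l)) (4 * b + 1) := by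
  induction b with
  | zero =>
    intro a σ _ hσ htmp
    have h1 : ρ.set s i a s i = a := by simp [Env.set]
    simp only [List.replicate_zero, List.nil_append] at htmp
    rw [add_zero, hσ.assign_eq h1, ← htmp, update_eq_self]
    exact .unmarked_done _ (by simp [htmp])
  | succ b ih =>
    intro a σ hab hσ htmp
    have h1 : ρ.set s i a s i = a := by simp [Env.set]
    have e₁ := Exec.pop (z := z) .tmp σ
    have hσ₁ := hσ.update_tmp (σ .tmp).tail
    have e₂ := exec_incr (z := z) hσ₁ (s := s) (i := i) (by rw [h1]; omega)
    rw [h1] at e₂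
    have hσ₂ := hσ₁.assign s i (a := a + 1) (by omega)
    rw [Env.set_set] at hσ₂
    have e₃ := ih (by omega) hσ₂ (by simp [assign, htmp, List.replicate_succ])
    have e := Exec.unmarked_step (by simp [htmp, List.replicate_succ, hz]) (e₁.seq e₂) e₃
    rw [show 4 * (b + 1) + 1 = 1 + (1 + 2) + (4 * b + 1) by omega,
      show a + (b + 1) = a + 1 + b by omega]
    refine e.congr_right ?_
    simp only [assign_update_tmp, assign_assign, update_idem]

/-- Run through the values of the variable `(s, i)`, which has to be `0` initially. Execute `P` if
its value equals that of the variable `(s', i)`, and execute `Q` otherwise. The first loop counts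
`(s', i)` down to `0`, so that it ends when the values agree; then `(s', i)` is restored from the
counter, whose end is marked by `z`. -/
def forCompare (s s' : Fin 3) (i : Fin (k + 1)) (z tick : S) (P Q : StackProg S (Stk k)) :
    StackProg S (Stk k) :=
  .seq (.seq (.seq (.const z .tmp) (approach s s' i tick Q)) (.seq (retreat s' i) (.pop .tmp)))
    (.seq (.seq P (move (.hi s i) (.lo s i))) (.seq (advance s i Q) (reset s i)))

theorem flatMap_range_ite {v m : ℕ} (l l' : List S) :
    (List.range (v + 1 + m)).flatMap (fun a => if a = v then l else l') =
      (List.replicate v l').flatten ++ (l ++ (List.replicate m l').flatten) := by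
  have h1 : (List.range v).flatMap (fun a => if a = v then l else l') =
      (List.replicate v l').flatten := by
    rw [List.flatMap_def]
    congr 1
    rw [List.eq_replicate_iff]
    refine ⟨by simp, fun b hb => ?_⟩
    simp only [List.mem_map, List.mem_range] at hb
    obtain ⟨a, ha, rfl⟩ := hb
    rw [if_neg ha.ne]
  have h2 : (List.range m).flatMap ((fun a => if a = v then l else l') ∘ (v + 1 + ·)) =
      (List.replicate m l').flatten := by
    rw [List.flatMap_def]
    congr 1
    rw [List.eq_replicate_iff]
    refine ⟨by simp, fun b hb => ?_⟩
    simp only [List.mem_map, List.mem_range] at hb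
    obtain ⟨a, ha, rfl⟩ := hb
    simp only [Function.comp_apply]
    rw [if_neg (by omega)]
  rw [List.range_add, List.flatMap_append, List.range_succ, List.flatMap_append, h1, List.flatMap_map,
    ← h2]
  simp [Function.comp_def]

theorem Streams.forCompare (hz : tick ≠ z) {P Q : StackProg S (Stk k)} {s s' : Fin 3} (hs : s ≠ s')
    {i : Fin (k + 1)} {T : ℕ} {l l' : List S} (h0 : ρ s i = 0) (hi : ρ s' i < n i)
    (hP : Streams z tick P n (ρ.set s i (ρ s' i)) [] l T)
    (hQ : ∀ a b, a ≤ n i → b ≤ n i → Streams z tick Q n ((ρ.set s' i b).set s i a) [] l' T) :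
    Streams z tick (forCompare s s' i z tick P Q) n ρ []
      ((List.range (n i)).flatMap fun a => if a = ρ s' i then l else l')
      (n i * (2 * T + 20) + T + 20) := by
  intro σ rest hσ hinp
  simp only [List.nil_append] at hinp
  obtain ⟨v, hv⟩ : ∃ v, ρ s' i = v := ⟨_, rfl⟩
  obtain ⟨m, hm⟩ : ∃ m, n i = v + 1 + m := ⟨n i - v - 1, by omega⟩
  rw [hv] at hP hi ⊢
  have hset : (ρ.set s' i v).set s i 0 = ρ := by
    rw [← hv, Env.set_self, ← h0, Env.set_self]
  have e₁ := Exec.const (z := z) z .tmp σ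
  have hσ₁ := hσ.update_tmp (z :: σ .tmp)
  rw [← hset] at hσ₁
  obtain ⟨t₂, ht₂, e₂⟩ := exec_approach hs hQ v (by omega) hσ₁
  have hσ₂ : Holds tick n ((ρ.set s i v).set s' i 0)
      (update (streamed (assign tick n (assign tick n (update σ .tmp (z :: σ .tmp)) s' i 0) s i
        (0 + v)) (update σ .tmp (z :: σ .tmp) .inp) [] (List.replicate v l').flatten) .tmp
        (List.replicate v tick ++ update σ .tmp (z :: σ .tmp) .tmp)) := by
    rw [zero_add]
    refine Holds.update_tmp (Holds.streamed ?_ _ _ _) _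
    rw [assign_comm _ hs.symm]
    exact ((hσ.update_tmp _).assign s i hi.le).assign s' i (by omega)
  have e₃ := exec_retreat (z := z) hz (l := σ .tmp) v (by omega) hσ₂ (by simp)
  have e₅ := ((e₁.seq e₂).seq (e₃.seq (.pop .tmp _))).congr_right
    (σ₂ := streamed (assign tick n σ s i v) rest [] (List.replicate v l').flatten) (by
      simp only [zero_add, update_self, List.tail_cons, assign_update_tmp, assign_streamed,
        streamed_update_tmp, update_idem, assign_comm _ hs, assign_assign, hσ.assign_eq hv]
      rw [update_of_ne (by simp), hinp]
      simp [streamed, assign])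
  have hσ₅ := (hσ.assign s i hi.le).streamed rest [] (List.replicate v l').flatten
  obtain ⟨t₆, ht₆, e₆⟩ := hP _ rest hσ₅ (by simp [streamed])
  have hσ₆ := hσ₅.streamed rest [] l
  have hval : ρ.set s i v s i = v := by simp [Env.set]
  have e₇ := exec_incr (z := z) hσ₆ (s := s) (i := i) (by omega)
  rw [hval] at e₇
  have hσ₇ := hσ₆.assign s i (a := v + 1) (by omega)
  rw [Env.set_set] at hσ₇
  have hQ' : ∀ b, v + 1 ≤ b → b < n i →
      Streams z tick Q n (ρ.set s i b) ((fun _ => []) b) ((fun _ => l') b) T := fun b _ hb => by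
    have := hQ b v hb.le hi.le
    rwa [← hv, Env.set_self] at this
  obtain ⟨t₈, ht₈, e₈⟩ := exec_advance (ρ := ρ) m (rest := rest) (by omega) hQ' hσ₇
    (by simp [streamed, assign, List.flatMap_def])
  have hσ₈ := (hσ₇.assign s i (a := n i) le_rfl).streamed rest
    ((List.range' (v + 1) m).flatMap fun _ => []) ((List.range' (v + 1) m).flatMap fun _ => l')
  have e₉ := exec_reset (z := z) hσ₈ s i
  have e := e₅.seq ((e₆.seq e₇).seq (e₈.seq e₉))
  refine ⟨_, ?_, e.congr_right ?_⟩
  rotate_left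
  · simp only [assign_streamed, assign_assign, streamed_streamed, hσ.assign_eq h0]
    rw [hm, flatMap_range_ite]
    simp [List.flatMap_def]
  · have h1 : (ρ.set s i (v + 1)).set s i (n i) s i = n i := by simp [Env.set]
    rw [h1]
    rw [hm] at *
    ring_nf at *
    omega

end StackProg

/-! ### Programs that write lists -/

namespace StackProg

open Function

variable {S : Type*} {k : ℕ} {z tick : S}

/-- The program streams lists that depend on an input `x` and the values `ρ` of the variables, in
time polynomial in `L x`, provided that `pre x ρ` holds. -/
def Emits {X : Type*} (z tick : S) (n : X → Fin (k + 1) → ℕ) (L : X → ℕ) (P : StackProg S (Stk k))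
    (pre : X → Env k → Prop) (c l : X → Env k → List S) : Prop :=
  ∃ p : Polynomial ℕ, ∀ x ρ, pre x ρ → Streams z tick P (n x) ρ (c x ρ) (l x ρ) (p.eval (L x))

section Emits

variable {X : Type*} {n : X → Fin (k + 1) → ℕ} {L : X → ℕ} {P Q : StackProg S (Stk k)}
  {pre pre' : X → Env k → Prop} {c c' l l' : X → Env k → List S}

theorem Emits.congr (h : Emits z tick n L P pre c l)
    (h' : ∀ x ρ, pre' x ρ → pre x ρ ∧ c' x ρ = c x ρ ∧ l' x ρ = l x ρ) :
    Emits z tick n L P pre' c' l' := by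
  obtain ⟨p, hp⟩ := h
  refine ⟨p, fun x ρ hx => ?_⟩
  obtain ⟨h1, h2, h3⟩ := h' x ρ hx
  rw [h2, h3]
  exact hp x ρ h1

theorem Emits.seq (hP : Emits z tick n L P pre c l) (hQ : Emits z tick n L Q pre c' l') :
    Emits z tick n L (.seq P Q) pre (fun x ρ => c x ρ ++ c' x ρ) (fun x ρ => l x ρ ++ l' x ρ) := by
  obtain ⟨p, hp⟩ := hP
  obtain ⟨q, hq⟩ := hQ
  refine ⟨p + q, fun x ρ hx => ?_⟩
  rw [Polynomial.eval_add]
  exact (hp x ρ hx).seq (hq x ρ hx)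

theorem Emits.forLoop (hL : ∀ x i, n x i ≤ L x) {s : Fin 3} {i : Fin (k + 1)}
    (hP : Emits z tick n L P pre c l) :
    Emits z tick n L (forLoop s i P)
      (fun x ρ => ρ s i = 0 ∧ ∀ a < n x i, pre x (ρ.set s i a))
      (fun x ρ => (List.range (n x i)).flatMap fun a => c x (ρ.set s i a))
      (fun x ρ => (List.range (n x i)).flatMap fun a => l x (ρ.set s i a)) := by
  obtain ⟨p, hp⟩ := hP
  refine ⟨.X * (p + 6) + 2, fun x ρ hx => ?_⟩
  refine (Streams.forLoop hx.1 fun a ha => hp x _ (hx.2 a ha)).mono ?_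
  simp only [Polynomial.eval_add, Polynomial.eval_mul, Polynomial.eval_X, Polynomial.eval_ofNat]
  gcongr
  exact hL x i

/-- Nested loops over the variables `(s, i)` for `i` in a list. -/
def nest (s : Fin 3) (is : List (Fin (k + 1))) (P : StackProg S (Stk k)) : StackProg S (Stk k) :=
  is.foldr (forLoop s) P

theorem Emits.nest (hL : ∀ x i, n x i ≤ L x) (s : Fin 3) {is : List (Fin (k + 1))}
    (his : is.Nodup) (hP : Emits z tick n L P pre c l) :
    Emits z tick n L (nest s is P)
      (fun x ρ => (∀ i ∈ is, ρ s i = 0) ∧ ∀ J ∈ nestList (n x) is (ρ s), pre x (update ρ s J))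
      (fun x ρ => (nestList (n x) is (ρ s)).flatMap fun J => c x (update ρ s J))
      (fun x ρ => (nestList (n x) is (ρ s)).flatMap fun J => l x (update ρ s J)) := by
  induction is with
  | nil => exact hP.congr fun x ρ hx => by simpa [nestList] using hx
  | cons i is ih =>
    rw [List.nodup_cons] at his
    refine ((ih his.2).forLoop hL (s := s) (i := i)).congr fun x ρ hx => ⟨⟨?_, ?_⟩, ?_, ?_⟩
    · exact hx.1 i (by simp)
    · intro a ha
      constructor
      · intro j hj
        rw [Env.set_apply_self, update_of_ne (by rintro rfl; exact his.1 hj)]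
        exact hx.1 j (by simp [hj])
      · intro J hJ
        rw [Env.set_apply_self] at hJ
        rw [Env.set, update_idem]
        exact hx.2 J (by
          rw [nestList, List.mem_flatMap]
          exact ⟨a, List.mem_range.2 ha, hJ⟩)
    · simp only [nestList, List.flatMap_assoc, Env.set, update_self, update_idem]
    · simp only [nestList, List.flatMap_assoc, Env.set, update_self, update_idem]

/-- The program that does nothing. -/
def skip (z : S) : StackProg S (Stk k) := .seq (.const z .tmp) (.pop .tmp)

theorem exec_skip (σ : Stk k → List S) : Exec z (skip z) σ σ 2 :=
  ((Exec.const z .tmp σ).seq (.pop .tmp _)).congr_right (by simp)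

theorem emits_skip : Emits z tick n L (skip z) pre (fun _ _ => []) (fun _ _ => []) := by
  refine ⟨2, fun x ρ _ σ rest _ hinp => ⟨2, by simp, (exec_skip σ).congr_right ?_⟩⟩
  rw [List.nil_append] at hinp
  rw [← hinp, streamed_nil]

/-- Execute a list of programs. -/
def seqAll (z : S) (Ps : List (StackProg S (Stk k))) : StackProg S (Stk k) :=
  Ps.foldr .seq (skip z)

theorem Emits.seqAll {β : Type*} {bs : List β} {P : β → StackProg S (Stk k)}
    {c l : β → X → Env k → List S} (h : ∀ b ∈ bs, Emits z tick n L (P b) pre (c b) (l b)) :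
    Emits z tick n L (seqAll z (bs.map P)) pre (fun x ρ => bs.flatMap fun b => c b x ρ)
      (fun x ρ => bs.flatMap fun b => l b x ρ) := by
  induction bs with
  | nil => exact emits_skip
  | cons b bs ih => exact (h b (by simp)).seq (ih fun b' hb' => h b' (by simp [hb']))

theorem emits_const (a : S) :
    Emits z tick n L (.const a .acc) pre (fun _ _ => []) (fun _ _ => [a]) := by
  refine ⟨1, fun x ρ _ σ rest _ hinp => ⟨1, by simp, (Exec.const a .acc σ).congr_right ?_⟩⟩
  rw [List.nil_append] at hinp
  rw [← hinp]
  simp [streamed]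

/-- Write a fixed list of symbols. -/
def write (z : S) (as : List S) : StackProg S (Stk k) :=
  seqAll z (as.map fun a => .const a .acc)

theorem emits_write (as : List S) :
    Emits z tick n L (write z as) pre (fun _ _ => []) (fun _ _ => as) := by
  have h := Emits.seqAll (z := z) (tick := tick) (n := n) (L := L) (pre := pre)
    (P := fun a : S => StackProg.const a Stk.acc) (bs := as) fun a _ => emits_const a
  exact h.congr fun x ρ hx => ⟨hx, by simp, by simp⟩

/-- Run through the values of the variables `(s, i)` for `i` in a list. Write `l₁` if they agree
with the values of the variables `(y i, i)`, and `l₀` otherwise. -/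
def delta (s : Fin 3) (y : Fin (k + 1) → Fin 3) (z tick : S) (l₁ l₀ : List S) :
    List (Fin (k + 1)) → StackProg S (Stk k)
  | [] => write z l₁
  | i :: is =>
    forCompare s (y i) i z tick (delta s y z tick l₁ l₀ is) (StackProg.nest s is (write z l₀))

theorem flatMap_const_eq_flatten {α β : Type*} (l : List α) (b : List β) :
    (l.flatMap fun _ => b) = (List.replicate l.length b).flatten := by
  rw [List.flatMap_def, List.map_const']

/-- The loop over the first variable is split at the value it is compared with: only there do the
remaining variables have to be compared. -/
theorem emits_delta (hz : tick ≠ z) (hL : ∀ x i, n x i ≤ L x) {s : Fin 3}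
    {y : Fin (k + 1) → Fin 3} {l₁ l₀ : List S} {is : List (Fin (k + 1))} (his : is.Nodup)
    (hy : ∀ i ∈ is, y i ≠ s) :
    Emits z tick n L (delta s y z tick l₁ l₀ is)
      (fun x ρ => ∀ i ∈ is, ρ s i = 0 ∧ ρ (y i) i < n x i) (fun _ _ => [])
      (fun x ρ => (nestList (n x) is (ρ s)).flatMap fun J =>
        if ∀ i ∈ is, J i = ρ (y i) i then l₁ else l₀) := by
  induction is with
  | nil => exact (emits_write l₁).congr fun x ρ hx => ⟨hx, by simp, by simp [nestList]⟩
  | cons i is ih =>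
    rw [List.nodup_cons] at his
    obtain ⟨p, hp⟩ := ih his.2 fun j hj => hy j (by simp [hj])
    obtain ⟨q, hq⟩ := (emits_write (z := z) (tick := tick) (n := n) (L := L)
      (pre := fun _ _ => True) l₀).nest hL s his.2
    refine ⟨.X * (2 * (p + q) + 20) + (p + q) + 20, fun x ρ hx => ?_⟩
    have hyi : y i ≠ s := hy i (by simp)
    have h := Streams.forCompare (z := z) (tick := tick) (n := n x) (ρ := ρ)
      (Q := StackProg.nest s is (write z l₀)) hz hyi.symm
      (T := p.eval (L x) + q.eval (L x)) (hx i (by simp)).1 (hx i (by simp)).2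
      ((hp x (ρ.set s i (ρ (y i) i)) ?_).mono (by omega))
      (l' := (List.replicate (nestList (n x) is 0).length l₀).flatten)
      (fun a b ha hb => ?_)
    · have hT : n x i * (2 * (p.eval (L x) + q.eval (L x)) + 20) +
          (p.eval (L x) + q.eval (L x)) + 20 ≤
          (.X * (2 * (p + q) + 20) + (p + q) + 20 : Polynomial ℕ).eval (L x) := by
        simp only [Polynomial.eval_add, Polynomial.eval_mul, Polynomial.eval_X,
          Polynomial.eval_ofNat]
        have := hL x i
        gcongr
      have h' := h.mono hT
      convert h' using 1
      · rfl
      simp only [nestList, List.flatMap_assoc, Env.set_apply_self]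
      refine List.flatMap_congr fun a _ => ?_
      split_ifs with ha
      · rw [← ha]
        refine List.flatMap_congr fun J hJ => ?_
        have hJi := ((mem_nestList his.2).1 hJ).2 i his.1
        rw [update_self] at hJi
        have : (∀ j ∈ i :: is, J j = ρ (y j) j) ↔ ∀ j ∈ is, J j = ρ.set s i a (y j) j := by
          rw [List.forall_mem_cons, hJi, and_iff_right ha]
          refine forall₂_congr fun j hj => ?_
          rw [Env.set_apply_of_ne _ (hy j (by simp [hj]))]
        simp only [this]
      · rw [length_nestList, ← length_nestList (n := n x) is (update (ρ s) i a),
          ← flatMap_const_eq_flatten]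
        refine List.flatMap_congr fun J hJ => ?_
        have hJi := ((mem_nestList his.2).1 hJ).2 i his.1
        rw [update_self] at hJi
        rw [if_neg]
        intro h
        exact ha (hJi ▸ h i (by simp))
    · intro j hj
      have hji : j ≠ i := by rintro rfl; exact his.1 hj
      rw [Env.set_apply_self, update_of_ne hji, Env.set_apply_of_ne _ (hy j (by simp [hj]))]
      exact hx j (by simp [hj])
    · have := hq x ((ρ.set (y i) i b).set s i a) ⟨fun j hj => ?_, fun _ _ => trivial⟩
      · dsimp only at this
        rw [flatMap_const_eq_flatten, flatMap_const_eq_flatten, length_nestList,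
          ← length_nestList (n := n x) is 0] at this
        simpa using this.mono (Nat.le_add_left _ _)
      · have hji : j ≠ i := by rintro rfl; exact his.1 hj
        rw [Env.set_apply_self, update_of_ne hji, Env.set_apply_of_ne _ hyi.symm]
        exact (hx j (by simp [hj])).1

end Emits

/-! ### The program for the structure constants -/

/-- The directions on a concatenation of basis paths, when no relation applies to it. -/
theorem acts_concat (hk : 1 ≤ k) {u v w : Fin (k + 1)} (huv : u ≤ v) (hvw : v ≤ w)
    (h : ¬ Rewrites (u, v) (v, w)) (i : Fin (k + 1)) :
    (i ∈ acts (u, w) ↔ i ∈ acts (u, v) ∨ i ∈ acts (v, w)) ∧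
      ¬ (i ∈ acts (u, v) ∧ i ∈ acts (v, w)) := by
  rcases huv.eq_or_lt with rfl | huv
  · simp [acts_self hk]
  rcases hvw.eq_or_lt with rfl | hvw
  · simp [acts_self hk]
  have hv0 : v ≠ 0 := (Fin.zero_le u |>.trans_lt huv).ne'
  have hvl : v ≠ Fin.last k := (hvw.trans_le (Fin.le_last w)).ne
  rw [acts_of_ne, acts_of_ne, acts_of_ne]
  · simp only [mem_steps, Fin.le_def, Fin.lt_def] at *
    omega
  · rintro h'
    exact hv0 (Prod.mk.inj h').1
  · rintro h'
    exact hvl (Prod.mk.inj h').2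
  · rintro h'
    exact h ⟨rfl, (Prod.mk.inj h').1, (Prod.mk.inj h').2, hv0, hvl⟩

variable {F : Type*} [Field F]

/-- Write the structure constants for fixed paths from `B.1` to `B.2` and from `B'.1` to `B'.2` and
all paths from `C.1` to `C.2`. The program `E` copies one entry of the tensor; the entries are read
in the order of the input, so no access by address is needed. -/
def entryProg (z tick : S) (tok : F → List S) (E : StackProg S (Stk k))
    (B B' C : Fin (k + 1) × Fin (k + 1)) : StackProg S (Stk k) :=
  if Rewrites B B' then
    if C = (0, Fin.last k) then nest 2 (acts C) E else nest 2 (acts C) (write z (tok 0))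
  else if B.2 = B'.1 ∧ C = (B.1, B'.2) then
    delta 2 (fun i => if i ∈ acts B then 0 else 1) z tick (tok 1) (tok 0) (acts C)
  else nest 2 (acts C) (write z (tok 0))

/-- The program `E` copies one entry of the tensor from the input to the output. -/
def CopiesToken (z : S) (tok : F → List S) (E : StackProg S (Stk k)) : Prop :=
  ∃ C : ℕ, ∀ (a : F) (σ : Stk k → List S) (rest : List S), σ .inp = tok a ++ rest →
    ∃ t ≤ C * ((tok a).length + 1), Exec z E σ (streamed σ rest (tok a) (tok a)) t

/-- The variables hold multi-indices for paths from `B.1` to `B.2` and from `B'.1` to `B'.2`. -/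
def EntryPre (B B' : Fin (k + 1) × Fin (k + 1)) (n : Fin (k + 1) → ℕ) (ρ : Env k) : Prop :=
  ρ 0 ∈ nestList n (acts B) 0 ∧ ρ 1 ∈ nestList n (acts B') 0 ∧ ρ 2 = 0

variable {L : (Σ n : Fin (k + 1) → ℕ, Tensor F n) → ℕ} {tok : F → List S} {E : StackProg S (Stk k)}

theorem emits_entryProg (hk : 1 ≤ k) (hz : tick ≠ z) (hL : ∀ x i, x.1 i ≤ L x)
    (hL' : ∀ x I, (tok (tensorVal x.2 I)).length ≤ L x) (hE : CopiesToken z tok E)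
    {B B' : Fin (k + 1) × Fin (k + 1)} (hB : B ∈ blocks k) (hB' : B' ∈ blocks k)
    (C : Fin (k + 1) × Fin (k + 1)) :
    Emits z tick Sigma.fst L (entryProg z tick tok E B B' C)
      (fun x ρ => EntryPre B B' x.1 ρ)
      (fun x ρ => if Rewrites B B' ∧ C = (0, Fin.last k) then
        (nestList x.1 (acts C) 0).flatMap fun K => tok (tensorVal x.2 (ρ 0 + ρ 1 + K)) else [])
      (fun x ρ => (nestList x.1 (acts C) 0).flatMap fun K =>
        tok (pathCoeff x.2 (B, ρ 0) (B', ρ 1) (C, K))) := by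
  have hzero : Emits z tick Sigma.fst L (nest 2 (acts C) (write z (tok 0)))
      (fun x ρ => EntryPre B B' x.1 ρ) (fun _ _ => [])
      (fun x ρ => (nestList x.1 (acts C) 0).flatMap fun _ => tok 0) := by
    refine ((emits_write (pre := fun _ _ => True) (tok 0)).nest hL 2 (nodup_acts C)).congr
      fun x ρ hx => ⟨⟨fun i _ => ?_, fun _ _ => trivial⟩, by simp, ?_⟩
    · rw [hx.2.2]; rfl
    · rw [hx.2.2]
  rw [entryProg]
  by_cases h1 : Rewrites B B'
  · rw [if_pos h1]
    by_cases h2 : C = (0, Fin.last k)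
    swap
    · rw [if_neg h2]
      refine hzero.congr fun x ρ hx => ⟨hx, if_neg fun h => h2 h.2, ?_⟩
      simp [pathCoeff, h1, h2]
    rw [if_pos h2]
    have hE' : Emits z tick Sigma.fst L E (fun _ _ => True)
        (fun x ρ => tok (tensorVal x.2 (ρ 0 + ρ 1 + ρ 2)))
        (fun x ρ => tok (tensorVal x.2 (ρ 0 + ρ 1 + ρ 2))) := by
      obtain ⟨C, hC⟩ := hE
      refine ⟨Polynomial.C C * (.X + 1), fun x ρ _ σ rest _ hinp => ?_⟩
      obtain ⟨t, ht, e⟩ := hC _ σ rest hinp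
      refine ⟨t, ht.trans ?_, e⟩
      simp only [Polynomial.eval_mul, Polynomial.eval_C, Polynomial.eval_add, Polynomial.eval_X,
        Polynomial.eval_one]
      gcongr
      exact hL' x _
    refine (hE'.nest hL 2 (nodup_acts C)).congr
      fun x ρ hx => ⟨⟨fun i _ => ?_, fun _ _ => trivial⟩, ?_, ?_⟩
    · rw [hx.2.2]; rfl
    · rw [if_pos ⟨h1, h2⟩, hx.2.2]
      simp
    · rw [hx.2.2]
      simp [pathCoeff, h1, h2]
  rw [if_neg h1]
  by_cases h3 : B.2 = B'.1 ∧ C = (B.1, B'.2)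
  · rw [if_pos h3]
    obtain ⟨u, v⟩ := B
    obtain ⟨v', w⟩ := B'
    obtain ⟨rfl, rfl⟩ := h3
    rw [mem_blocks] at hB hB'
    have hacts := acts_concat hk hB hB' h1
    dsimp only at *
    refine (emits_delta hz hL (nodup_acts _) fun i _ => ?_).congr fun x ρ hx => ⟨fun i hi => ?_,
      if_neg fun h => h1 h.1, ?_⟩
    · split_ifs <;> decide
    · refine ⟨by rw [hx.2.2]; rfl, ?_⟩
      split_ifs with h
      · exact ((mem_nestList (nodup_acts _)).1 hx.1).1 i h
      · exact ((mem_nestList (nodup_acts _)).1 hx.2.1).1 i (((hacts i).1.1 hi).resolve_left h)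
    · rw [hx.2.2]
      refine List.flatMap_congr fun K hK => ?_
      have hI := (mem_nestList (nodup_acts _)).1 hx.1
      have hJ := (mem_nestList (nodup_acts _)).1 hx.2.1
      rw [mem_nestList (nodup_acts _)] at hK
      have key : (∀ i ∈ acts (u, w), K i = ρ (if i ∈ acts (u, v) then 0 else 1) i) ↔
          K = ρ 0 + ρ 1 := by
        constructor
        · intro h
          funext i
          rw [Pi.add_apply]
          by_cases hi : i ∈ acts (u, w)
          · rw [h i hi]
            split_ifs with hi'
            · rw [hJ.2 i fun h => (hacts i).2 ⟨hi', h⟩]; simp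
            · rw [hI.2 i hi']; simp
          · have h3 := (not_congr (hacts i).1).1 hi
            rw [not_or] at h3
            rw [hK.2 i hi, hI.2 i h3.1, hJ.2 i h3.2]
            rfl
        · rintro rfl i hi
          rw [Pi.add_apply]
          split_ifs with hi'
          · rw [hJ.2 i fun h => (hacts i).2 ⟨hi', h⟩]; simp
          · rw [hI.2 i hi']; simp
      simp only [key, pathCoeff]
      rw [if_neg h1]
      by_cases h : K = ρ 0 + ρ 1
      · simp [h]
      · simp [h]
  · rw [if_neg h3]
    refine hzero.congr fun x ρ hx => ⟨hx, if_neg fun h => h1 h.1, ?_⟩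
    refine List.flatMap_congr fun K hK => ?_
    rw [pathCoeff, if_neg h1, if_neg]
    rintro ⟨h4, h5⟩
    exact h3 ⟨h4, (Prod.mk.inj h5).1⟩

/-- Write the structure constants for all products whose first factor is a path from `B.1` to
`B.2`. -/
def rowProg (z tick : S) (tok : F → List S) (E : StackProg S (Stk k))
    (B : Fin (k + 1) × Fin (k + 1)) : StackProg S (Stk k) :=
  nest 0 (acts B) <| seqAll z <| (blocks k).map fun B' =>
    nest 1 (acts B') <| seqAll z <| (blocks k).map fun C => entryProg z tick tok E B B' C

/-- The entries of the tensor are needed exactly in the rows of the paths from the first vertex to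
an inner vertex, and there they are needed in their lexicographic order. -/
theorem row_input {n : Fin (k + 1) → ℕ} (A : Tensor F n) (B : Fin (k + 1) × Fin (k + 1)) :
    ((nestList n (acts B) 0).flatMap fun I => (blocks k).flatMap fun B' =>
      (nestList n (acts B') 0).flatMap fun J => (blocks k).flatMap fun C =>
        if Rewrites B B' ∧ C = (0, Fin.last k) then
          (nestList n (acts C) 0).flatMap fun K => tok (tensorVal A (I + J + K)) else []) =
      if B.1 = 0 ∧ B.2 ≠ 0 ∧ B.2 ≠ Fin.last k then (tensorEntries n A).flatMap tok else [] := by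
  obtain ⟨u, v⟩ := B
  split_ifs with h
  · obtain ⟨hu, hv0, hvl⟩ := h
    dsimp only at hu hv0 hvl
    subst hu
    have hR (B' : Fin (k + 1) × Fin (k + 1)) :
        Rewrites (0, v) B' ↔ B' = (v, Fin.last k) := by
      obtain ⟨v', w⟩ := B'
      simp [Rewrites, hv0, hvl, eq_comm]
    have hC (B' : Fin (k + 1) × Fin (k + 1)) (I J : Fin (k + 1) → ℕ) :
        ((blocks k).flatMap fun C => if Rewrites (0, v) B' ∧ C = (0, Fin.last k) then
          (nestList n (acts C) 0).flatMap fun K => tok (tensorVal A (I + J + K)) else []) =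
        if B' = (v, Fin.last k) then
          (nestList n [Fin.last k] 0).flatMap fun K => tok (tensorVal A (I + J + K)) else [] := by
      simp only [hR]
      split_ifs with h
      · simp only [h, true_and]
        rw [List.flatMap_ite_eq nodup_blocks (mem_blocks.2 (Fin.zero_le _)), acts_full]
      · simp [h]
    have hB' (I : Fin (k + 1) → ℕ) : ((blocks k).flatMap fun B' =>
        (nestList n (acts B') 0).flatMap fun J => if B' = (v, Fin.last k) then
          (nestList n [Fin.last k] 0).flatMap fun K => tok (tensorVal A (I + J + K)) else []) =
        (nestList n (steps v (Fin.last k)) 0).flatMap fun J =>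
          (nestList n [Fin.last k] 0).flatMap fun K => tok (tensorVal A (I + J + K)) := by
      have := List.flatMap_ite_eq nodup_blocks (b := (v, Fin.last k))
        (mem_blocks.2 (Fin.le_last v))
        fun B' : Fin (k + 1) × Fin (k + 1) => (nestList n (acts B') 0).flatMap fun J =>
          (nestList n [Fin.last k] 0).flatMap fun K => tok (tensorVal A (I + J + K))
      rw [acts_of_ne fun h => hv0 (Prod.mk.inj h).1] at this
      rw [← this]
      refine List.flatMap_congr fun B' _ => ?_
      split_ifs <;> simp
    simp only [hC, hB']
    rw [acts_of_ne fun h => hvl (Prod.mk.inj h).2, tensorEntries_eq n A 0,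
      ← steps_append_steps_append_last v, nestList_append, nestList_append, List.flatMap_assoc,
      List.map_flatMap, List.flatMap_assoc]
    refine List.flatMap_congr fun I hI => ?_
    rw [mem_nestList (sortedLT_steps _ _).nodup] at hI
    have h1 : ∀ i ∈ steps v (Fin.last k), I i = 0 := fun i hi => hI.2 i fun h => by
      rw [mem_steps] at h hi
      exact absurd hi.1 (not_le.2 h.2)
    rw [nestList_eq_map h1, List.map_flatMap, List.flatMap_map, List.flatMap_assoc]
    refine List.flatMap_congr fun J hJ => ?_
    rw [mem_nestList (sortedLT_steps _ _).nodup] at hJ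
    have h2 : ∀ i ∈ [Fin.last k], (I + J) i = 0 := fun i hi => by
      rw [List.mem_singleton] at hi
      rw [Pi.add_apply, hI.2 i, hJ.2 i]
      · rfl
      · simp [mem_steps, hi]
      · simp [mem_steps, hi, Fin.le_last]
    rw [nestList_eq_map h2, List.map_map, List.flatMap_map]
    rfl
  · have hR (B' : Fin (k + 1) × Fin (k + 1)) : ¬ Rewrites (u, v) B' := fun hR =>
      h ⟨hR.2.1, hR.2.2.2⟩
    simp [hR]

/-- The structure constants for all products whose first factor is a path from `B.1` to `B.2`. -/
def rowList (tok : F → List S) {n : Fin (k + 1) → ℕ} (A : Tensor F n)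
    (B : Fin (k + 1) × Fin (k + 1)) : List S :=
  (nestList n (acts B) 0).flatMap fun I => (pathList n).flatMap fun b' =>
    (pathList n).flatMap fun c => tok (pathCoeff A (B, I) b' c)

theorem emits_rowProg (hk : 1 ≤ k) (hz : tick ≠ z) (hL : ∀ x i, x.1 i ≤ L x)
    (hL' : ∀ x I, (tok (tensorVal x.2 I)).length ≤ L x) (hE : CopiesToken z tok E)
    {B : Fin (k + 1) × Fin (k + 1)} (hB : B ∈ blocks k) :
    Emits z tick Sigma.fst L (rowProg z tick tok E B) (fun _ ρ => ρ = 0)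
      (fun x _ => if B.1 = 0 ∧ B.2 ≠ 0 ∧ B.2 ≠ Fin.last k then
        (tensorEntries x.1 x.2).flatMap tok else [])
      (fun x _ => rowList tok x.2 B) := by
  refine (Emits.nest hL 0 (nodup_acts B) <| Emits.seqAll fun B' hB' =>
    (Emits.nest hL 1 (nodup_acts B') <| Emits.seqAll fun C _ =>
      emits_entryProg hk hz hL hL' hE hB hB' C).congr
      (pre' := fun x ρ => ρ 0 ∈ nestList x.1 (acts B) 0 ∧ ρ 1 = 0 ∧ ρ 2 = 0)
      fun x ρ hx => ⟨⟨fun i _ => ?_, fun J hJ => ?_⟩, rfl, rfl⟩).congr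
      fun x ρ hx => ⟨⟨fun i _ => ?_, fun J hJ => ?_⟩, ?_, ?_⟩
  · rw [hx.2.1]; rfl
  · rw [hx.2.1] at hJ
    exact ⟨by simpa using hx.1, by simpa using hJ, by simpa using hx.2.2⟩
  · rw [hx]; rfl
  · subst hx
    exact ⟨by simpa using hJ, rfl, rfl⟩
  · subst hx
    rw [← row_input]
    simp
  · subst hx
    simp [rowList, pathList, List.flatMap_assoc, List.flatMap_map]

end StackProg

/-! ### Reading the format -/

namespace StackProg

open Function

variable {S : Type*} {k : ℕ} {z tick : S}

/-- The stacks after the symbols on the input stack have been replaced by `l` and the bounds of the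
variables `(s, i)` with `i` in a list have been increased by `n i`. -/
def loaded (tick : S) (n : Fin (k + 1) → ℕ) (is : List (Fin (k + 1))) (σ : Stk k → List S)
    (l : List S) : Stk k → List S
  | .inp => l
  | .hi s i => if i ∈ is then List.replicate (n i) tick ++ σ (.hi s i) else σ (.hi s i)
  | r => σ r

/-- Remove a tick from the input and increase the bounds of the variables `(s, i)` by `1`. -/
def readTick (tick : S) (i : Fin (k + 1)) : StackProg S (Stk k) :=
  .seq (.const tick (.hi 0 i)) (.seq (.const tick (.hi 1 i)) (.seq (.const tick (.hi 2 i))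
    (.pop .inp)))

theorem exec_readTick {i : Fin (k + 1)} {σ : Stk k → List S} {l : List S}
    (h : σ .inp = tick :: l) :
    Exec z (readTick tick i) σ (loaded tick (fun _ => 1) [i] σ l) 4 := by
  refine ((Exec.const tick (.hi 0 i) σ).seq ((Exec.const tick (.hi 1 i) _).seq
    ((Exec.const tick (.hi 2 i) _).seq (.pop .inp _)))).congr_right ?_
  funext r
  cases r with
  | hi s j =>
    by_cases hj : j = i
    · subst hj
      fin_cases s <;> simp [loaded]
    · simp [loaded, hj]
  | _ => simp [loaded, h]

theorem exec_readTicks (hz : tick ≠ z) {i : Fin (k + 1)} {l : List S} (m : ℕ) :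
    ∀ {σ : Stk k → List S}, σ .inp = List.replicate m tick ++ z :: l →
    Exec z (.whileUnmarked .inp (readTick tick i)) σ
      (loaded tick (fun _ => m) [i] σ (z :: l)) (5 * m + 1) := by
  induction m with
  | zero =>
    intro σ h
    simp only [List.replicate_zero, List.nil_append] at h
    refine (Exec.unmarked_done _ (by simp [h])).congr_right ?_
    funext r
    cases r <;> simp [loaded, h]
  | succ m ih =>
    intro σ h
    rw [List.replicate_succ, List.cons_append] at h
    have e := Exec.unmarked_step (by simp [h, hz]) (exec_readTick (z := z) (i := i) h) (ih rfl)
    rw [show 5 * (m + 1) + 1 = 1 + 4 + (5 * m + 1) by omega]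
    refine e.congr_right ?_
    funext r
    cases r with
    | hi s j =>
      by_cases hj : j = i
      · simp [loaded, hj, List.replicate_succ']
      · simp [loaded, hj]
    | _ => simp [loaded]

/-- Read the side lengths in a list of directions. -/
def parse (z tick : S) (is : List (Fin (k + 1))) : StackProg S (Stk k) :=
  seqAll z <| is.map fun i => .seq (.whileUnmarked .inp (readTick tick i)) (.pop .inp)

theorem exec_parse (hz : tick ≠ z) {n : Fin (k + 1) → ℕ} {M : ℕ} (hn : ∀ i, n i ≤ M)
    {is : List (Fin (k + 1))} (his : is.Nodup) (l : List S) : ∀ {σ : Stk k → List S},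
    σ .inp = (is.flatMap fun i => List.replicate (n i) tick ++ [z]) ++ l →
    ∃ t ≤ is.length * (5 * M + 2) + 2, Exec z (parse z tick is) σ (loaded tick n is σ l) t := by
  induction is with
  | nil =>
    intro σ h
    refine ⟨2, by simp, (exec_skip σ).congr_right ?_⟩
    funext r
    cases r <;> simp_all [loaded]
  | cons i is ih =>
    intro σ h
    rw [List.nodup_cons] at his
    simp only [List.flatMap_cons, List.append_assoc, List.cons_append,
      List.nil_append] at h
    have e₁ := (exec_readTicks hz (i := i) (n i) h).seq (.pop .inp _)
    obtain ⟨t, ht, e₂⟩ := ih his.2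
      (σ := update (loaded tick (fun _ => n i) [i] σ (z :: ((is.flatMap fun i =>
        List.replicate (n i) tick ++ [z]) ++ l))) .inp
        ((is.flatMap fun i => List.replicate (n i) tick ++ [z]) ++ l)) (by simp)
    refine ⟨_, ?_, (e₁.seq e₂).congr_right ?_⟩
    · have := hn i
      rw [List.length_cons, Nat.add_mul, one_mul]
      omega
    · funext r
      cases r with
      | hi s j =>
        by_cases hj : j = i
        · subst hj
          simp [loaded, his.1]
        · simp [loaded, hj]
      | _ => simp [loaded]

/-! ### The complete program -/

/-- Empty a list of stacks. -/
def clear (z : S) (rs : List (Stk k)) : StackProg S (Stk k) :=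
  seqAll z <| rs.map fun r => .whileNonempty r (.pop r)

theorem exec_clear {M : ℕ} (rs : List (Stk k)) : ∀ {σ : Stk k → List S},
    (∀ r, (σ r).length ≤ M) →
    ∃ t ≤ rs.length * (2 * M + 1) + 2,
      Exec z (clear z rs) σ (fun r => if r ∈ rs then [] else σ r) t := by
  induction rs with
  | nil => exact fun {σ} _ => ⟨2, by simp, (exec_skip σ).congr_right (by simp)⟩
  | cons r rs ih =>
    intro σ hσ
    have e₁ := exec_popAll (z := z) r (σ r) rfl
    obtain ⟨t, ht, e₂⟩ := ih (σ := update σ r []) fun r' => by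
      by_cases h : r' = r
      · simp [h]
      · simpa [h] using hσ r'
    refine ⟨_, ?_, (e₁.seq e₂).congr_right ?_⟩
    · have := hσ r
      rw [List.length_cons, Nat.add_mul, one_mul]
      omega
    · funext r'
      by_cases h : r' = r
      · simp [h]
      · simp [h]

/-- Write the dimension in unary, followed by the mark symbol. -/
def headerProg (z tick : S) : StackProg S (Stk k) :=
  .seq (seqAll z <| (blocks k).map fun B => nest 0 (acts B) (write z [tick])) (write z [z])

theorem emits_headerProg {X : Type*} {n : X → Fin (k + 1) → ℕ} {L : X → ℕ}
    (hL : ∀ x i, n x i ≤ L x) :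
    Emits z tick n L (headerProg z tick) (fun _ ρ => ρ = 0) (fun _ _ => [])
      (fun x _ => List.replicate (pathList (n x)).length tick ++ [z]) := by
  refine (Emits.seq (Emits.seqAll fun B _ => ((emits_write (pre := fun _ _ => True) [tick]).nest
    hL 0 (nodup_acts B)).congr (pre' := fun _ ρ => ρ = 0) fun x ρ hx =>
      ⟨⟨fun i _ => by rw [hx]; rfl, fun _ _ => trivial⟩, rfl, rfl⟩) (emits_write [z])).congr
    fun x ρ hx => ⟨hx, by simp, ?_⟩
  subst hx
  have := flatMap_const_eq_flatten (pathList (n x)) [tick]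
  rw [List.flatten_replicate_singleton] at this
  rw [← this]
  simp [pathList, List.flatMap_assoc, List.flatMap_map]

variable {F : Type*} [Field F]

/-- Write all structure constants, rewinding the input after every row. -/
def rowsProg (z tick : S) (tok : F → List S) (E : StackProg S (Stk k))
    (Bs : List (Fin (k + 1) × Fin (k + 1))) : StackProg S (Stk k) :=
  seqAll z <| Bs.map fun B =>
    .seq (rowProg z tick tok E B) (.whileNonempty .back (move .back .inp))

variable {L : (Σ n : Fin (k + 1) → ℕ, Tensor F n) → ℕ} {tok : F → List S} {E : StackProg S (Stk k)}

theorem exec_rowsProg (hk : 1 ≤ k) (hz : tick ≠ z) (hL : ∀ x i, x.1 i ≤ L x)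
    (hL' : ∀ x I, (tok (tensorVal x.2 I)).length ≤ L x)
    (hL'' : ∀ x, ((tensorEntries x.1 x.2).flatMap tok).length ≤ L x) (hE : CopiesToken z tok E)
    {Bs : List (Fin (k + 1) × Fin (k + 1))} (hBs : Bs ⊆ blocks k) :
    ∃ p : Polynomial ℕ, ∀ x σ, Holds tick x.1 0 σ → σ .back = [] →
      σ .inp = (tensorEntries x.1 x.2).flatMap tok →
      ∃ t ≤ p.eval (L x), Exec z (rowsProg z tick tok E Bs) σ (update σ .acc
        ((Bs.flatMap (rowList tok x.2)).reverse ++ σ .acc)) t := by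
  induction Bs with
  | nil =>
    exact ⟨2, fun x σ _ _ _ => ⟨2, by simp, (exec_skip σ).congr_right (by simp)⟩⟩
  | cons B Bs ih =>
    rw [List.cons_subset] at hBs
    obtain ⟨p, hp⟩ := ih hBs.2
    obtain ⟨q, hq⟩ := emits_rowProg (tok := tok) hk hz hL hL' hE hBs.1
    refine ⟨q + (3 * .X + 1) + p, fun x σ hσ hback hinp => ?_⟩
    obtain ⟨c, hc⟩ : ∃ c, c = if B.1 = 0 ∧ B.2 ≠ 0 ∧ B.2 ≠ Fin.last k then
      (tensorEntries x.1 x.2).flatMap tok else [] := ⟨_, rfl⟩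
    obtain ⟨rest, hrest⟩ : ∃ rest, (tensorEntries x.1 x.2).flatMap tok = c ++ rest := by
      split_ifs at hc
      · exact ⟨[], by simp [hc]⟩
      · exact ⟨_, by rw [hc]; rfl⟩
    have hq' := hq x 0 rfl
    dsimp only at hq'
    rw [← hc] at hq'
    rw [hrest] at hinp
    obtain ⟨t₁, ht₁, e₁⟩ := hq' σ rest hσ hinp
    have e₂ := exec_moveAll (z := z) (r := Stk.back) (s := Stk.inp) (by simp) c.reverse
      (σ := streamed σ rest c (rowList tok x.2 B)) (by simp [streamed, hback])
    have e₁₂ := (e₁.seq e₂).congr_right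
      (σ₂ := update σ .acc ((rowList tok x.2 B).reverse ++ σ .acc)) (by
        funext r
        cases r <;> simp [streamed, update, hinp, hback])
    obtain ⟨t₃, ht₃, e₃⟩ := hp x (update σ .acc ((rowList tok x.2 B).reverse ++ σ .acc))
      (fun s i => by simpa using hσ s i) (by rw [update_of_ne (by simp), hback])
      (by rw [update_of_ne (by simp), hinp, hrest])
    refine ⟨_, ?_, (e₁₂.seq e₃).congr_right ?_⟩
    · simp only [Polynomial.eval_add, Polynomial.eval_mul, Polynomial.eval_X, Polynomial.eval_one,
        Polynomial.eval_ofNat]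
      have := hL'' x
      rw [hrest, List.length_append] at this
      rw [List.length_reverse]
      omega
    · simp

/-- The program that computes the structure constants of the algebra of a tensor. -/
noncomputable def mainProg (k : ℕ) (z tick : S) (tok : F → List S) (E : StackProg S (Stk k)) :
    StackProg S (Stk k) :=
  .seq (.seq (parse z tick (List.finRange (k + 1))) (.seq (headerProg z tick)
    (rowsProg z tick tok E (blocks k))))
    (.seq (.whileNonempty .acc (move .acc .out))
      (clear z (Finset.univ.erase (Stk.out : Stk k)).toList))

theorem length_tok_le (tok : F → List S) {n : Fin (k + 1) → ℕ} (A : Tensor F n)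
    (I : Fin (k + 1) → ℕ) :
    (tok (tensorVal A I)).length ≤
      ((tensorEntries n A).flatMap tok).length + (tok 0).length := by
  by_cases h : ∀ i, I i < n i
  · have h1 : tensorVal A I ∈ tensorEntries n A := by
      rw [tensorEntries_eq n A 0]
      exact List.mem_map_of_mem ((mem_nestList (List.nodup_finRange _)).2 (by simpa using h))
    rw [List.length_flatMap]
    exact (List.le_sum_of_mem (List.mem_map_of_mem (f := fun a => (tok a).length) h1)).trans
      (Nat.le_add_right _ _)
  · rw [tensorVal, dif_neg h]
    exact Nat.le_add_left _ _

/-- The program computes the structure constants in polynomial time; it leaves all stacks but the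
output stack empty, as a Turing machine has to. -/
theorem exec_mainProg (hk : 1 ≤ k) (hz : tick ≠ z) (hE : CopiesToken z tok E) :
    ∃ p : Polynomial ℕ, ∀ x : Σ n : Fin (k + 1) → ℕ, Tensor F n,
      ∃ t ≤ p.eval (encodeTensor tick z tok x).length,
      Exec z (mainProg k z tick tok E) (fun s => if s = .inp then encodeTensor tick z tok x else [])
        (fun s => if s = .out then encodeStructureArray tick z tok
          (⟨(pathList x.1).length, tensorStructure x.1 x.2⟩ : Σ N : ℕ, StructureArray F N)
          else []) t := by
  obtain ⟨L, hLdef⟩ : ∃ L : (Σ n : Fin (k + 1) → ℕ, Tensor F n) → ℕ,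
      ∀ x, L x = (encodeTensor tick z tok x).length + (tok 0).length := ⟨_, fun _ => rfl⟩
  have hlen (x : Σ n : Fin (k + 1) → ℕ, Tensor F n) :
      (encodeTensor tick z tok x).length =
        ((List.finRange (k + 1)).map fun i => x.1 i + 1).sum +
        ((tensorEntries x.1 x.2).flatMap tok).length := by
    simp [encodeTensor, List.length_flatMap]
  have hL (x : Σ n : Fin (k + 1) → ℕ, Tensor F n) (i : Fin (k + 1)) : x.1 i ≤ L x := by
    have := List.le_sum_of_mem
      (List.mem_map_of_mem (f := fun i => x.1 i + 1) (List.mem_finRange i))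
    rw [hLdef, hlen]
    omega
  have hL' (x : Σ n : Fin (k + 1) → ℕ, Tensor F n) (I : Fin (k + 1) → ℕ) :
      (tok (tensorVal x.2 I)).length ≤ L x := by
    have := length_tok_le tok x.2 I
    rw [hLdef, hlen]
    omega
  have hL'' (x : Σ n : Fin (k + 1) → ℕ, Tensor F n) :
      ((tensorEntries x.1 x.2).flatMap tok).length ≤ L x := by
    rw [hLdef, hlen]
    omega
  obtain ⟨p, hp⟩ := emits_headerProg (z := z) (tick := tick) hL
  obtain ⟨q, hq⟩ := exec_rowsProg hk hz hL hL' hL'' hE (List.Subset.refl (blocks k))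
  obtain ⟨p₁, hp₁⟩ : ∃ p₁ : Polynomial ℕ,
      p₁ = (.C (k + 1) * (5 * .X + 2) + 2) + (p + q) := ⟨_, rfl⟩
  obtain ⟨p₂, hp₂⟩ : ∃ p₂ : Polynomial ℕ, p₂ = 3 * (.X + p₁) + 1 := ⟨_, rfl⟩
  obtain ⟨N, hN⟩ : ∃ N, N = (Finset.univ.erase (Stk.out : Stk k)).toList.length := ⟨_, rfl⟩
  refine ⟨(p₁ + (p₂ + (.C N * (2 * (.X + p₁ + p₂) + 1) + 2))).comp (.X + .C (tok 0).length),
    fun x => ?_⟩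
  simp only [Polynomial.eval_comp, Polynomial.eval_add, Polynomial.eval_X, Polynomial.eval_C,
    Polynomial.eval_mul, Polynomial.eval_one, Polynomial.eval_ofNat, ← hLdef]
  -- reading the format
  obtain ⟨t₁, ht₁, e₁⟩ := exec_parse hz (hL x) (List.nodup_finRange (k + 1))
    ((tensorEntries x.1 x.2).flatMap tok)
    (σ := fun s => if s = .inp then encodeTensor tick z tok x else []) rfl
  have hσ₁ : Holds tick x.1 0 (loaded tick x.1 (List.finRange (k + 1))
      (fun s => if s = .inp then encodeTensor tick z tok x else [])
      ((tensorEntries x.1 x.2).flatMap tok)) := fun s i => by simp [loaded]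
  -- writing the output in reverse
  obtain ⟨t₂, ht₂, e₂⟩ := hp x 0 rfl _ _ hσ₁ rfl
  obtain ⟨t₃, ht₃, e₃⟩ := hq x _ (hσ₁.streamed ((tensorEntries x.1 x.2).flatMap tok) []
    (List.replicate (pathList x.1).length tick ++ [z])) (by simp [streamed, loaded])
    (by simp [streamed])
  have e₁₃ := e₁.seq (e₂.seq e₃)
  obtain ⟨τ, hτ⟩ : ∃ τ, τ = update (loaded tick x.1 (List.finRange (k + 1))
      (fun s => if s = .inp then encodeTensor tick z tok x else [])
      ((tensorEntries x.1 x.2).flatMap tok)) .acc (encodeStructureArray tick z tok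
        (⟨(pathList x.1).length, tensorStructure x.1 x.2⟩ : Σ N : ℕ, StructureArray F N)).reverse :=
    ⟨_, rfl⟩
  replace e₁₃ := e₁₃.congr_right (σ₂ := τ) <| by
    have h : (pathList x.1).flatMap (fun b => (pathList x.1).flatMap fun b' =>
        (pathList x.1).flatMap fun c => tok (pathCoeff x.2 b b' c)) =
        (List.finRange (pathList x.1).length).flatMap fun i =>
          (List.finRange (pathList x.1).length).flatMap fun j =>
          (List.finRange (pathList x.1).length).flatMap fun l =>
            tok (tensorStructure x.1 x.2 i j l) := by
      rw [← List.flatMap_finRange_get]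
      refine List.flatMap_congr fun i _ => ?_
      rw [← List.flatMap_finRange_get]
      refine List.flatMap_congr fun j _ => ?_
      rw [← List.flatMap_finRange_get]
      rfl
    have hrow : (blocks k).flatMap (rowList tok x.2) = (pathList x.1).flatMap fun b =>
        (pathList x.1).flatMap fun b' => (pathList x.1).flatMap fun c =>
          tok (pathCoeff x.2 b b' c) := by
      generalize hl : (fun b => (pathList x.1).flatMap fun b' => (pathList x.1).flatMap fun c =>
        tok (pathCoeff x.2 b b' c)) = g
      rw [pathList, List.flatMap_assoc]
      simp only [List.flatMap_map, ← hl]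
      rfl
    rw [hτ, encodeStructureArray, ← h, ← hrow]
    funext r
    cases r <;> simp [streamed, loaded, update]
  have hlen₁ := e₁₃.length_le
  have hT₁ : t₁ + (t₂ + t₃) ≤ p₁.eval (L x) := by
    simp only [hp₁, Polynomial.eval_add, Polynomial.eval_X, Polynomial.eval_C,
      Polynomial.eval_mul, Polynomial.eval_ofNat]
    rw [List.length_finRange] at ht₁
    omega
  have hbound₁ (r : Stk k) := (hlen₁ r).trans
    (Nat.add_le_add (b := L x) (by split_ifs <;> simp [hLdef]) hT₁)
  have e₄ := exec_moveAll (z := z) (r := Stk.acc) (s := Stk.out) (by simp) _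
    (σ := τ) rfl
  have hlen₄ := e₄.length_le
  have hT₂ := hbound₁ .acc
  have hbound₂ (r : Stk k) := (hlen₄ r).trans (Nat.add_le_add (hbound₁ r)
    (d := p₂.eval (L x)) (by
      simp only [hp₂, Polynomial.eval_add, Polynomial.eval_X, Polynomial.eval_one,
        Polynomial.eval_mul, Polynomial.eval_ofNat]
      omega))
  obtain ⟨t₅, ht₅, e₅⟩ := exec_clear (z := z) (Finset.univ.erase (Stk.out : Stk k)).toList hbound₂
  refine ⟨_, ?_, (e₁₃.seq (e₄.seq e₅)).congr_right ?_⟩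
  · rw [← hN] at ht₅
    have : 3 * (τ .acc).length + 1 ≤ p₂.eval (L x) := by
      simp only [hp₂, Polynomial.eval_add, Polynomial.eval_X, Polynomial.eval_one,
        Polynomial.eval_mul, Polynomial.eval_ofNat]
      omega
    omega
  · funext r
    by_cases hr : r = .out
    · subst hr
      simp [hτ, loaded]
    · simp [hr]

/-- Copy one symbol from the input to the output. -/
def copySymbol : StackProg S (Stk k) := .seq (.copy .inp .acc) (move .inp .back)

theorem exec_copySymbol {a : S} {σ : Stk k → List S} {rest : List S} (h : σ .inp = a :: rest) :
    Exec z copySymbol σ (streamed σ rest [a] [a]) 3 := by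
  have e₁ := Exec.copy (z := z) .inp .acc σ
  have e₂ := exec_move (z := z) (r := Stk.inp) (s := Stk.back) (x := a) (l := rest)
    (σ := update σ .acc ((σ .inp).headD z :: σ .acc)) (by simp) (by simpa using h)
  refine (e₁.seq e₂).congr_right ?_
  funext r
  cases r <;> simp [streamed, update, h]

end StackProg

/-! ### Polynomial time -/

section PolyTime

open StackProg Function

variable {F : Type*} [Field F] {k : ℕ}

theorem polyTimeBSS_tensorStructure (hk : 1 ≤ k) :
    PolyTimeBSS F (encodeTensor 1 0 fun x => [x]) (encodeStructureArray 1 0 fun x => [x])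
      (fun X : Σ n : Fin (k + 1) → ℕ, Tensor F n =>
        (⟨(pathList X.1).length, tensorStructure X.1 X.2⟩ : Σ N : ℕ, StructureArray F N)) := by
  have hE : CopiesToken (k := k) (0 : F) (fun x => [x]) copySymbol :=
    ⟨3, fun a σ rest h => ⟨3, by simp, exec_copySymbol h⟩⟩
  obtain ⟨p, hp⟩ := exec_mainProg hk one_ne_zero hE
  refine ⟨(mainProg k (0 : F) 1 (fun x => [x]) copySymbol).bssMachine .inp .out, p + 1, fun a => ?_⟩
  obtain ⟨t, ht, e⟩ := hp a
  obtain ⟨c, hc, hout, ⟨ev⟩⟩ := e.bss (out := .out)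
  refine ⟨c, hc, hout.trans (if_pos rfl), ⟨⟨ev.toEvalsTo, ev.steps_le_m.trans ?_⟩⟩⟩
  rw [Polynomial.eval_add, Polynomial.eval_one]
  omega

theorem polyTimeTuring_tensorStructure (hk : 1 ≤ k) {Γ : Type} [Finite Γ]
    (enc : Computability.Encoding F Γ) :
    PolyTimeTuring (encodeTensor (Sum.inr true) (Sum.inr false) (turingToken enc))
      (encodeStructureArray (Sum.inr true) (Sum.inr false) (turingToken enc))
      (fun X : Σ n : Fin (k + 1) → ℕ, Tensor F n =>
        (⟨(pathList X.1).length, tensorStructure X.1 X.2⟩ : Σ N : ℕ, StructureArray F N)) := by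
  classical
  have := Fintype.ofFinite Γ
  have hE : CopiesToken (k := k) (Sum.inr false) (turingToken enc)
      (.seq (.whileUnmarked .inp copySymbol) copySymbol) := by
    have hloop (w : List Γ) : ∀ (σ : Stk k → List (Γ ⊕ Bool)) (rest : List (Γ ⊕ Bool)),
        σ .inp = w.map Sum.inl ++ Sum.inr false :: rest →
        Exec (Sum.inr false) (.whileUnmarked .inp copySymbol) σ
          (streamed σ (Sum.inr false :: rest) (w.map Sum.inl) (w.map Sum.inl))
          (4 * w.length + 1) := by
      induction w with
      | nil =>
        intro σ rest h
        simp only [List.map_nil, List.nil_append] at h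
        refine (Exec.unmarked_done _ (by simp [h])).congr_right ?_
        rw [List.map_nil, ← h, streamed_nil]
      | cons a w ih =>
        intro σ rest h
        rw [List.map_cons, List.cons_append] at h
        have e := Exec.unmarked_step (by simp [h]) (exec_copySymbol h)
          (ih _ rest (by simp [streamed]))
        rw [streamed_streamed] at e
        rw [List.length_cons, show 4 * (w.length + 1) + 1 = 1 + 3 + (4 * w.length + 1) by omega]
        exact e
    refine ⟨4, fun a σ rest h => ?_⟩
    rw [turingToken, List.append_assoc] at h
    have e := (hloop _ σ rest h).seq (exec_copySymbol (a := Sum.inr false)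
      (rest := rest) (by simp [streamed]))
    rw [streamed_streamed] at e
    refine ⟨_, ?_, e⟩
    simp [turingToken]
    omega
  obtain ⟨p, hp⟩ := exec_mainProg (tick := Sum.inr true) hk (by simp) hE
  refine ⟨⟨(mainProg k (Sum.inr false) (Sum.inr true) (turingToken enc)
    (.seq (.whileUnmarked .inp copySymbol) copySymbol)).turingMachine
    (Sum.inr false) .inp .out, Equiv.refl _, Equiv.refl _⟩, p + 1, fun a => ?_⟩
  obtain ⟨t, ht, e⟩ := hp a
  have h := e.turing (m := (p + 1).eval (encodeTensor (Sum.inr true) (Sum.inr false)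
    (turingToken enc) a).length) (by rw [Polynomial.eval_add, Polynomial.eval_one]; omega)
  have map_id {M : Turing.FinTM2} (l : List (M.Γ M.k₀)) (l' : List (M.Γ M.k₁)) (m : ℕ)
      (h : Nonempty (Turing.TM2OutputsInTime M l (some l') m)) :
      Nonempty (Turing.TM2OutputsInTime M (l.map (Equiv.refl _).symm)
        (some (l'.map (Equiv.refl _).symm)) m) := by
    have hid {α : Type} (l : List α) : l.map (Equiv.refl α).symm = l := List.map_id l
    rwa [hid, hid]
  exact map_id _ _ _ h

end PolyTime

/-! ### Generators and relations -/

section Presentation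

variable {k : ℕ}

/-- The start vertex of the arrows in direction `i`. -/
def arrowSource (i : Fin (k + 1)) : Fin (k + 1) :=
  Fin.lastCases (motive := fun _ => Fin (k + 1)) 0 (fun j => j.castSucc) i

/-- The end vertex of the arrows in direction `i`. -/
def arrowTarget (i : Fin (k + 1)) : Fin (k + 1) :=
  Fin.lastCases (motive := fun _ => Fin (k + 1)) (Fin.last k) (fun j => j.succ) i

@[simp]
theorem arrowSource_last : arrowSource (Fin.last k) = 0 := by simp [arrowSource]

@[simp]
theorem arrowTarget_last : arrowTarget (Fin.last k) = Fin.last k := by simp [arrowTarget]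

@[simp]
theorem arrowSource_castSucc (j : Fin k) : arrowSource j.castSucc = j.castSucc := by
  simp [arrowSource]

@[simp]
theorem arrowTarget_castSucc (j : Fin k) : arrowTarget j.castSucc = j.succ := by
  simp [arrowTarget]

theorem arrowSource_of_ne {i : Fin (k + 1)} (hi : i ≠ Fin.last k) : arrowSource i = i := by
  obtain ⟨j, rfl⟩ := Fin.exists_castSucc_eq.2 hi
  simp

theorem val_arrowTarget {i : Fin (k + 1)} (hi : i ≠ Fin.last k) : (arrowTarget i : ℕ) = i + 1 := by
  obtain ⟨j, rfl⟩ := Fin.exists_castSucc_eq.2 hi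
  simp

theorem arrowTarget_ne_zero (hk : 1 ≤ k) (i : Fin (k + 1)) : arrowTarget i ≠ 0 := by
  induction i using Fin.lastCases with
  | last => simp [Fin.ext_iff]; omega
  | cast j => simp

variable {n : Fin (k + 1) → ℕ} {F : Type*} [Field F]

/-- Elements `e v` and `x i a` of an algebra satisfying the relations between the vertices and the
arrows in the algebra of the tensor `A`. -/
structure IsTensorRep {S : Type*} [Ring S] [Algebra F S] (A : Tensor F n) (e : Fin (k + 1) → S)
    (x : ∀ i, Fin (n i) → S) : Prop where
  idem_mul_idem (v w) : e v * e w = if v = w then e v else 0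
  idem_mul_arrow (v i a) : e v * x i a = if v = arrowSource i then x i a else 0
  arrow_mul_idem (i a v) : x i a * e v = if v = arrowTarget i then x i a else 0
  sum_idem : ∑ v, e v = 1
  prod_arrow (I : ∀ j : Fin k, Fin (n j.castSucc)) :
    (List.ofFn fun j : Fin k => x j.castSucc (I j)).prod =
      ∑ a : Fin (n (Fin.last k)),
        A (Fin.snoc (α := fun i => Fin (n i)) I a) • x (Fin.last k) a

namespace TensorQuiverAlgebra

variable (A : Tensor F n)

/-- The quotient map onto the algebra of a tensor from the free algebra on vertices and arrows. -/
noncomputable def proj :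
    FreeAlgebra F (TensorVertex n ⊕ Quiver.Total (TensorVertex n)) →ₐ[F] TensorQuiverAlgebra A :=
  (RingQuot.mkAlgHom F (TensorRel A)).comp (RingQuot.mkAlgHom F (PathRel F (TensorVertex n)))

/-- The idempotent of the vertex `v` in the algebra of a tensor. -/
noncomputable def idem (v : Fin (k + 1)) : TensorQuiverAlgebra A :=
  proj A (FreeAlgebra.ι F (Sum.inl v))

/-- The arrow `x_{i,a}` in the algebra of a tensor. -/
noncomputable def arrow (i : Fin (k + 1)) (a : Fin (n i)) : TensorQuiverAlgebra A :=
  proj A (FreeAlgebra.ι F (Sum.inr (tensorArrow n i a)))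

theorem exists_eq_tensorArrow (t : Quiver.Total (TensorVertex n)) :
    ∃ i a, t = tensorArrow n i a := by
  obtain ⟨u, v, ⟨⟨i, a⟩, h₁, h₂⟩⟩ := t
  dsimp only at h₁ h₂
  subst h₁ h₂
  exact ⟨i, a, rfl⟩

theorem proj_eq_of_pathRel {x y} (h : PathRel F (TensorVertex n) x y) : proj A x = proj A y := by
  simp only [proj, AlgHom.comp_apply]
  rw [RingQuot.mkAlgHom_rel F h]

theorem isTensorRep : IsTensorRep A (idem A) (arrow A) where
  idem_mul_idem v w := by
    have := proj_eq_of_pathRel A (.vertex_mul_vertex (V := TensorVertex n) v w)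
    rw [map_mul] at this
    refine this.trans ?_
    split_ifs with h₁ h₂ h₂
    · rfl
    · exact absurd h₁ h₂
    · exact absurd h₂ h₁
    · exact map_zero _
  idem_mul_arrow v i a := by
    have := proj_eq_of_pathRel A (.vertex_mul_arrow (V := TensorVertex n) v (tensorArrow n i a))
    rw [map_mul] at this
    refine this.trans ?_
    split_ifs with h₁ h₂ h₂
    · rfl
    · exact absurd h₁ h₂
    · exact absurd h₂ h₁
    · exact map_zero _
  arrow_mul_idem i a v := by
    have := proj_eq_of_pathRel A (.arrow_mul_vertex (V := TensorVertex n) v (tensorArrow n i a))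
    rw [map_mul] at this
    refine this.trans ?_
    split_ifs with h₁ h₂ h₂
    · rfl
    · exact absurd h₁ h₂
    · exact absurd h₂ h₁
    · exact map_zero _
  sum_idem := by
    have := proj_eq_of_pathRel A (.one (V := TensorVertex n))
    rw [map_sum, map_one] at this
    exact this
  prod_arrow I := by
    have := RingQuot.mkAlgHom_rel F (.rewrite I : TensorRel A _ _)
    rw [map_list_prod, map_sum, List.map_ofFn] at this
    simp only [map_smul] at this
    exact this

variable {A} {S : Type*} [Ring S] [Algebra F S] {e : Fin (k + 1) → S} {x : ∀ i, Fin (n i) → S}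

/-- The universal property of the algebra of a tensor. -/
theorem exists_lift (h : IsTensorRep A e x) : ∃ f : TensorQuiverAlgebra A →ₐ[F] S,
    (∀ v, f (idem A v) = e v) ∧ ∀ i a, f (arrow A i a) = x i a := by
  let f₀ : FreeAlgebra F (TensorVertex n ⊕ Quiver.Total (TensorVertex n)) →ₐ[F] S :=
    FreeAlgebra.lift F (Sum.elim e fun t => x t.hom.1.1 t.hom.1.2)
  have hv (v : TensorVertex n) : f₀ (FreeAlgebra.ι F (Sum.inl v)) = e v :=
    FreeAlgebra.lift_ι_apply _ _
  have ha (i : Fin (k + 1)) (a : Fin (n i)) :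
      f₀ (FreeAlgebra.ι F (Sum.inr (tensorArrow n i a))) = x i a :=
    FreeAlgebra.lift_ι_apply _ _
  have h₀ : ∀ ⦃y z⦄, PathRel F (TensorVertex n) y z → f₀ y = f₀ z := by
    intro y z hyz
    cases hyz with
    | vertex_mul_vertex v w =>
      rw [map_mul, hv, hv, apply_ite f₀, hv, map_zero]
      refine (h.idem_mul_idem v w).trans ?_
      split_ifs with h₁ h₂ h₂ <;> first | rfl | exact absurd h₁ h₂ | exact absurd h₂ h₁
    | vertex_mul_arrow v t =>
      obtain ⟨i, a, rfl⟩ := exists_eq_tensorArrow t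
      rw [map_mul, hv, apply_ite f₀, ha, map_zero]
      refine (h.idem_mul_arrow v i a).trans ?_
      split_ifs with h₁ h₂ h₂ <;> first | rfl | exact absurd h₁ h₂ | exact absurd h₂ h₁
    | arrow_mul_vertex v t =>
      obtain ⟨i, a, rfl⟩ := exists_eq_tensorArrow t
      rw [map_mul, hv, apply_ite f₀, ha, map_zero]
      refine (h.arrow_mul_idem i a v).trans ?_
      split_ifs with h₁ h₂ h₂ <;> first | rfl | exact absurd h₁ h₂ | exact absurd h₂ h₁
    | arrow_mul_arrow s t hst =>
      obtain ⟨i, a, rfl⟩ := exists_eq_tensorArrow s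
      obtain ⟨j, b, rfl⟩ := exists_eq_tensorArrow t
      have h₁ := h.arrow_mul_idem i a (arrowTarget i)
      rw [if_pos rfl] at h₁
      rw [map_mul, ha, ha, map_zero, ← h₁, mul_assoc, h.idem_mul_arrow,
        if_neg fun h => hst h.symm, mul_zero]
    | one =>
      rw [map_sum, map_one]
      simp only [hv]
      exact h.sum_idem
  let f₁ := RingQuot.liftAlgHom F ⟨f₀, h₀⟩
  have hf₁ (y) : f₁ (RingQuot.mkAlgHom F _ y) = f₀ y := RingQuot.liftAlgHom_mkAlgHom_apply F f₀ h₀ y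
  have h₂ : ∀ ⦃y z⦄, TensorRel A y z → f₁ y = f₁ z := by
    intro y z hyz
    cases hyz with
    | rewrite I =>
      rw [map_list_prod, map_sum, List.map_ofFn]
      simp only [map_smul, Function.comp_def, PathAlgebra.arrow, hf₁, ha]
      exact h.prod_arrow I
  refine ⟨RingQuot.liftAlgHom F ⟨f₁, h₂⟩, fun v => ?_, fun i a => ?_⟩
  · exact (RingQuot.liftAlgHom_mkAlgHom_apply F f₁ h₂ _).trans ((hf₁ _).trans (hv v))
  · exact (RingQuot.liftAlgHom_mkAlgHom_apply F f₁ h₂ _).trans ((hf₁ _).trans (ha i a))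

/-- The vertices and the arrows generate the algebra of a tensor. -/
theorem eq_top_of_mem (T : Subalgebra F (TensorQuiverAlgebra A)) (h₁ : ∀ v, idem A v ∈ T)
    (h₂ : ∀ i a, arrow A i a ∈ T) : T = ⊤ := by
  have hproj : Function.Surjective (proj A) :=
    (RingQuot.mkAlgHom_surjective F _).comp (RingQuot.mkAlgHom_surjective F _)
  rw [eq_top_iff]
  rintro y -
  obtain ⟨z, rfl⟩ := hproj y
  induction z using FreeAlgebra.induction with
  | grade0 c => rw [AlgHom.commutes]; exact T.algebraMap_mem c
  | grade1 t =>
    obtain v | t := t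
    · exact h₁ v
    · obtain ⟨i, a, rfl⟩ := exists_eq_tensorArrow t
      exact h₂ i a
  | mul y z hy hz => rw [map_mul]; exact T.mul_mem hy hz
  | add y z hy hz => rw [map_add]; exact T.add_mem hy hz

end TensorQuiverAlgebra

end Presentation

/-! ### The regular representation on paths -/

section Regular

open Function

variable {k : ℕ} {n : Fin (k + 1) → ℕ} {F : Type*} [Field F]

/-- The restriction of a multi-index to the directions in a list, `0` in the others. -/
def restrictIndex (is : List (Fin (k + 1))) (J : Fin (k + 1) → ℕ) : Fin (k + 1) → ℕ :=
  fun i => if i ∈ is then J i else 0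

/-- The indicator function of the index `b` on the list of basis paths; it vanishes if `b` is not
in the list. -/
def pathSingle (n : Fin (k + 1) → ℕ) (F : Type*) [Field F] (b : PathIndex k) :
    Fin (pathList n).length → F :=
  fun i => if (pathList n).get i = b then 1 else 0

theorem pathSingle_get (i : Fin (pathList n).length) :
    pathSingle n F ((pathList n).get i) = Pi.single i 1 := by
  funext j
  simp only [pathSingle, (nodup_pathList n).get_inj_iff, Pi.single_apply]

/-- The linear map with prescribed values at the basis paths. -/
def pathExtend (n : Fin (k + 1) → ℕ) {M : Type*} [AddCommGroup M] [Module F M]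
    (f : PathIndex k → M) : (Fin (pathList n).length → F) →ₗ[F] M :=
  Fintype.linearCombination F fun i => f ((pathList n).get i)

section Extend

variable {M : Type*} [AddCommGroup M] [Module F M]

theorem pathExtend_single (f : PathIndex k → M) {b : PathIndex k} (hb : b ∈ pathList n) :
    pathExtend n f (pathSingle n F b) = f b := by
  obtain ⟨i, rfl⟩ := List.mem_iff_get.1 hb
  rw [pathSingle_get, pathExtend, Fintype.linearCombination_apply_single, one_smul]

theorem pathExtend_apply (f : PathIndex k → M) (m : Fin (pathList n).length → F) :
    pathExtend n f m = ∑ i, m i • f ((pathList n).get i) :=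
  Fintype.linearCombination_apply _ _ _

theorem path_hom_ext {f g : (Fin (pathList n).length → F) →ₗ[F] M}
    (h : ∀ b ∈ pathList n, f (pathSingle n F b) = g (pathSingle n F b)) : f = g := by
  refine LinearMap.pi_ext' fun i => LinearMap.ext_ring ?_
  have := h _ ((pathList n).get_mem i)
  rwa [pathSingle_get] at this

end Extend

variable (A : Tensor F n)

/-- The combination of arrows in the last direction whose coefficients are the entries of `A` in
the row through `I` in this direction. -/
def tensorRow (I : Fin (k + 1) → ℕ) : Fin (pathList n).length → F := fun c =>
  if ((pathList n).get c).1 = (0, Fin.last k) then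
    tensorVal A (I + ((pathList n).get c).2) else 0

/-- Left multiplication by the vertex `v`, on basis paths. -/
def idemPathAction (n : Fin (k + 1) → ℕ) (F : Type*) [Field F] (v : Fin (k + 1)) (b : PathIndex k) :
    Fin (pathList n).length → F :=
  if v = b.1.1 then pathSingle n F b else 0

/-- Left multiplication by the arrow `x_{i,a}`, on basis paths. -/
def arrowPathAction (i : Fin (k + 1)) (a : ℕ) (b : PathIndex k) : Fin (pathList n).length → F :=
  if b.1.1 = arrowTarget i then
    if i ≠ Fin.last k ∧ (arrowSource i, b.1.2) = (0, Fin.last k) then tensorRow A (update b.2 i a)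
    else pathSingle n F ((arrowSource i, b.1.2), update b.2 i a)
  else 0

/-- The endomorphism by which the vertex `v` acts on combinations of basis paths. -/
def idemEnd (n : Fin (k + 1) → ℕ) (F : Type*) [Field F] (v : Fin (k + 1)) :
    Module.End F (Fin (pathList n).length → F) :=
  pathExtend n (idemPathAction n F v)

/-- The endomorphism by which the arrow `x_{i,a}` acts on combinations of basis paths. -/
def arrowEnd (i : Fin (k + 1)) (a : ℕ) : Module.End F (Fin (pathList n).length → F) :=
  pathExtend n (arrowPathAction A i a)

variable {A}

theorem self_mem_pathList (hk : 1 ≤ k) (v : Fin (k + 1)) :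
    (((v, v), 0) : PathIndex k) ∈ pathList n := by
  simp [mem_pathList, acts_self hk]

theorem snd_eq_zero_of_fst_eq (hk : 1 ≤ k) {b : PathIndex k} (hb : b ∈ pathList n)
    (h : b.1.1 = b.1.2) : b.2 = 0 := by
  obtain ⟨⟨u, w⟩, I⟩ := b
  dsimp only at h
  subst h
  rw [mem_pathList, acts_self hk] at hb
  exact funext fun i => hb.2.2 i (by simp)

theorem last_mem_pathList {a : ℕ} (ha : a < n (Fin.last k)) :
    (((0, Fin.last k), Pi.single (Fin.last k) a) : PathIndex k) ∈ pathList n := by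
  rw [mem_pathList, acts_full]
  refine ⟨Fin.zero_le _, by simpa using ha, fun i hi => ?_⟩
  exact Pi.single_eq_of_ne (by simpa using hi) _

theorem eq_last_of_mem_pathList {b : PathIndex k} (hb : b ∈ pathList n)
    (h : b.1 = (0, Fin.last k)) :
    ∃ a < n (Fin.last k), b = ((0, Fin.last k), Pi.single (Fin.last k) a) := by
  obtain ⟨B, I⟩ := b
  dsimp only at h
  subst h
  rw [mem_pathList, acts_full] at hb
  refine ⟨I (Fin.last k), hb.2.1 _ (by simp), Prod.ext rfl (funext fun i => ?_)⟩
  rcases eq_or_ne i (Fin.last k) with rfl | hi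
  · exact (Pi.single_eq_same (M := fun _ => ℕ) _ _).symm
  · exact (hb.2.2 i (by simpa using hi)).trans (Pi.single_eq_of_ne (M := fun _ => ℕ) hi _).symm

theorem tensorRow_eq_sum (I : Fin (k + 1) → ℕ) :
    tensorRow A I = ∑ a : Fin (n (Fin.last k)),
      tensorVal A (I + Pi.single (Fin.last k) (a : ℕ)) •
        pathSingle n F ((0, Fin.last k), Pi.single (Fin.last k) (a : ℕ)) := by
  funext c
  simp only [Finset.sum_apply, Pi.smul_apply, pathSingle, tensorRow, smul_eq_mul, mul_ite, mul_one,
    mul_zero]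
  split_ifs with h
  · obtain ⟨a, ha, hc⟩ := eq_last_of_mem_pathList ((pathList n).get_mem c) h
    rw [Finset.sum_eq_single ⟨a, ha⟩]
    · rw [hc, if_pos rfl]
    · intro a' _ hne
      rw [hc, if_neg]
      intro h
      apply hne
      have := congr_fun (Prod.mk.inj h).2 (Fin.last k)
      rw [Pi.single_eq_same, Pi.single_eq_same] at this
      exact Fin.ext this.symm
    · simp
  · refine (Finset.sum_eq_zero fun a _ => if_neg fun hc => h ?_).symm
    rw [hc]

theorem idemEnd_single {v : Fin (k + 1)} {b : PathIndex k} :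
    idemEnd n F v (pathSingle n F b) = if v = b.1.1 then pathSingle n F b else 0 := by
  by_cases hb : b ∈ pathList n
  · exact pathExtend_single _ hb
  · have : pathSingle n F b = 0 := by
      funext i
      refine if_neg ?_
      rintro rfl
      exact hb ((pathList n).get_mem i)
    simp [this]

theorem idemEnd_tensorRow {v : Fin (k + 1)} {I : Fin (k + 1) → ℕ} :
    idemEnd n F v (tensorRow A I) = if v = 0 then tensorRow A I else 0 := by
  rw [tensorRow_eq_sum, map_sum]
  simp only [map_smul, idemEnd_single]
  split_ifs <;> simp

theorem mem_pathList_append {u : Fin (k + 1)} {b : PathIndex k} (hb : b ∈ pathList n)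
    (hu : u ≤ b.1.1) (hne : (u, b.1.2) ≠ (0, Fin.last k)) {J : Fin (k + 1) → ℕ}
    (hJ : ∀ i ∈ steps u b.1.1, J i < n i) :
    (((u, b.1.2), restrictIndex (steps u b.1.1) J + b.2) : PathIndex k) ∈ pathList n := by
  have hb' : b.1 ≠ (0, Fin.last k) := by
    intro h
    rw [h] at hu hne
    exact hne (by rw [Fin.le_zero_iff.1 hu])
  rw [mem_pathList, acts_of_ne hb'] at hb
  rw [mem_pathList, acts_of_ne hne]
  obtain ⟨h₁, h₂, h₃⟩ := hb
  refine ⟨hu.trans h₁, fun i hi => ?_, fun i hi => ?_⟩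
  · simp only [Pi.add_apply, restrictIndex]
    split_ifs with h
    · rw [h₃ i, add_zero]
      · exact hJ i h
      · rw [mem_steps] at h ⊢
        exact fun h' => h'.1.not_gt h.2
    · rw [zero_add]
      refine h₂ i ?_
      rw [mem_steps] at h hi ⊢
      exact ⟨le_of_not_gt fun h' => h ⟨hi.1, h'⟩, hi.2⟩
  · simp only [Pi.add_apply, restrictIndex]
    rw [if_neg, h₃ i, add_zero]
    · rw [mem_steps] at hi ⊢
      exact fun h => hi ⟨hu.trans h.1, h.2⟩
    · rw [mem_steps] at hi ⊢
      exact fun h => hi ⟨h.1, h.2.trans_le h₁⟩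

theorem update_restrictIndex {u v w : Fin (k + 1)} (hv : (v : ℕ) = u + 1) (huw : u < w)
    {J I : Fin (k + 1) → ℕ} (hI : I u = 0) :
    update (restrictIndex (steps v w) J + I) u (J u) = restrictIndex (steps u w) J + I := by
  funext i
  rcases eq_or_ne i u with rfl | hi
  · simp [restrictIndex, hI, mem_steps, huw]
  · rw [update_of_ne hi]
    simp [restrictIndex, steps_eq_cons hv huw, hi]

/-- Acting by a path from `u` on a path from `w` concatenates them, if the result does not lead from
the first to the last vertex. -/
theorem prod_arrowEnd_single {u : Fin (k + 1)} {b : PathIndex k} (hb : b ∈ pathList n)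
    (hu : u ≤ b.1.1) (hne : (u, b.1.2) ≠ (0, Fin.last k)) {J : Fin (k + 1) → ℕ}
    (hJ : ∀ i ∈ steps u b.1.1, J i < n i) :
    ((steps u b.1.1).map fun i => arrowEnd A i (J i)).prod (pathSingle n F b) =
      pathSingle n F ((u, b.1.2), restrictIndex (steps u b.1.1) J + b.2) := by
  obtain ⟨d, hd⟩ : ∃ d, (b.1.1 : ℕ) = u + d := Nat.exists_eq_add_of_le hu
  induction d generalizing u with
  | zero =>
    have hub : u = b.1.1 := Fin.ext hd.symm
    have h₁ : restrictIndex [] J + b.2 = b.2 := by funext i; simp [restrictIndex]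
    subst hub
    rw [steps_self, h₁]
    rfl
  | succ d ih =>
    have hub : u < b.1.1 := by rw [Fin.lt_def]; omega
    obtain ⟨v, hv⟩ : ∃ v : Fin (k + 1), (v : ℕ) = u + 1 :=
      ⟨⟨u + 1, by have := b.1.1.isLt; omega⟩, rfl⟩
    have hs := steps_eq_cons hv hub
    have hul : u ≠ Fin.last k := (hub.trans_le (Fin.le_last _)).ne
    have hvt : v = arrowTarget u := Fin.ext (by rw [hv, val_arrowTarget hul])
    have hv0 : (v, b.1.2) ≠ (0, Fin.last k) := fun h => by
      have := congr_arg Fin.val (Prod.mk.inj h).1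
      simp only [Fin.val_zero] at this
      omega
    have hJ' : ∀ i ∈ steps v b.1.1, J i < n i := fun i hi => hJ i (hs ▸ List.mem_cons_of_mem _ hi)
    have hvb : v ≤ b.1.1 := by rw [Fin.le_def]; omega
    have hmem := mem_pathList_append hb hvb hv0 hJ'
    rw [hs, List.map_cons, List.prod_cons, Module.End.mul_apply, ih hvb hv0 hJ' (by omega), arrowEnd,
      pathExtend_single _ hmem, arrowPathAction, if_pos hvt]
    dsimp only
    have hb2 : b.2 u = 0 := by
      rw [mem_pathList] at hb
      refine hb.2.2 u ?_
      rw [acts_of_ne, mem_steps]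
      · exact fun h => h.1.not_gt hub
      · intro h
        rw [h] at hub
        exact Nat.not_lt_zero _ hub
    rw [arrowSource_of_ne hul, if_neg fun h => hne h.2, update_restrictIndex hv hub hb2, ← hs]

/-- Acting by a path from the first vertex on a path to the last vertex gives a row of the tensor. -/
theorem prod_arrowEnd_single_last (hk : 1 ≤ k) {b : PathIndex k} (hb : b ∈ pathList n)
    (h₀ : b.1.1 ≠ 0) (h₁ : b.1.2 = Fin.last k) {J : Fin (k + 1) → ℕ}
    (hJ : ∀ i ∈ steps 0 b.1.1, J i < n i) :
    ((steps 0 b.1.1).map fun i => arrowEnd A i (J i)).prod (pathSingle n F b) =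
      tensorRow A (restrictIndex (steps 0 b.1.1) J + b.2) := by
  have hub : 0 < b.1.1 := Fin.pos_iff_ne_zero.2 h₀
  obtain ⟨v, hv⟩ : ∃ v : Fin (k + 1), (v : ℕ) = (0 : Fin (k + 1)) + 1 :=
    ⟨⟨1, by omega⟩, by simp⟩
  have hs := steps_eq_cons hv hub
  have hul : (0 : Fin (k + 1)) ≠ Fin.last k := (hub.trans_le (Fin.le_last _)).ne
  have hvt : v = arrowTarget 0 := Fin.ext (by rw [hv, val_arrowTarget hul])
  have hv0 : (v, b.1.2) ≠ (0, Fin.last k) := fun h => by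
    have := congr_arg Fin.val (Prod.mk.inj h).1
    simp only [Fin.val_zero] at this hv
    omega
  have hJ' : ∀ i ∈ steps v b.1.1, J i < n i := fun i hi => hJ i (hs ▸ List.mem_cons_of_mem _ hi)
  have hvb : v ≤ b.1.1 := by
    rw [Fin.le_def]
    rw [Fin.lt_def] at hub
    omega
  have hmem := mem_pathList_append hb hvb hv0 hJ'
  rw [hs, List.map_cons, List.prod_cons, Module.End.mul_apply,
    prod_arrowEnd_single hb hvb hv0 hJ', arrowEnd, pathExtend_single _ hmem, arrowPathAction,
    if_pos hvt]
  dsimp only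
  have hb2 : b.2 0 = 0 := by
    rw [mem_pathList] at hb
    refine hb.2.2 0 ?_
    rw [acts_of_ne, mem_steps]
    · exact fun h => h.1.not_gt hub
    · intro h
      exact h₀ (congr_arg Prod.fst h)
  rw [arrowSource_of_ne hul, if_pos ⟨hul, by rw [h₁]⟩, update_restrictIndex hv hub hb2, ← hs]

theorem ofFn_eq_map_steps {α : Type*} (y : Fin (k + 1) → α) :
    (List.ofFn fun j : Fin k => y j.castSucc) = (steps 0 (Fin.last k)).map y := by
  rw [steps_zero_last, List.map_map, List.ofFn_eq_map]
  rfl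

/-- A nonempty product of consecutive arrows ends at the target of the last arrow. -/
theorem prod_steps_mul_idem {S : Type*} [Ring S] {e y : Fin (k + 1) → S}
    (h : ∀ i v, y i * e v = if v = arrowTarget i then y i else 0) {u w : Fin (k + 1)} (huw : u < w)
    (v : Fin (k + 1)) :
    ((steps u w).map y).prod * e v = if v = w then ((steps u w).map y).prod else 0 := by
  obtain ⟨d, hd⟩ : ∃ d, (w : ℕ) = u + d + 1 := Nat.exists_eq_add_of_lt huw
  have hul : u ≠ Fin.last k := (huw.trans_le (Fin.le_last _)).ne
  induction d generalizing u with
  | zero =>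
    have hw : w = arrowTarget u := Fin.ext (by rw [val_arrowTarget hul]; omega)
    rw [steps_eq_cons (v := w) (by omega) huw, steps_self, List.map_singleton,
      List.prod_singleton, h, hw]
  | succ d ih =>
    obtain ⟨u', hu'⟩ : ∃ u' : Fin (k + 1), (u' : ℕ) = u + 1 :=
      ⟨⟨u + 1, by have := w.isLt; omega⟩, rfl⟩
    have hlt : u' < w := by rw [Fin.lt_def]; omega
    rw [steps_eq_cons hu' huw, List.map_cons, List.prod_cons, mul_assoc,
      ih hlt (by omega) (hlt.trans_le (Fin.le_last _)).ne, mul_ite, mul_zero]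

variable (A)

theorem arrowEnd_single {i : Fin (k + 1)} {a : ℕ} {b : PathIndex k} (hb : b ∈ pathList n) :
    arrowEnd A i a (pathSingle n F b) = arrowPathAction A i a b :=
  pathExtend_single _ hb

theorem idemEnd_arrowPathAction (v i : Fin (k + 1)) (a : ℕ) (b : PathIndex k) :
    idemEnd n F v (arrowPathAction A i a b) =
      if v = arrowSource i then arrowPathAction A i a b else 0 := by
  rw [arrowPathAction]
  by_cases h₁ : b.1.1 = arrowTarget i
  · rw [if_pos h₁]
    by_cases h₂ : i ≠ Fin.last k ∧ (arrowSource i, b.1.2) = (0, Fin.last k)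
    · rw [if_pos h₂, idemEnd_tensorRow, (Prod.mk.inj h₂.2).1]
    · rw [if_neg h₂, idemEnd_single]
  · rw [if_neg h₁, map_zero, ite_self]

theorem arrowEnd_mul_idemEnd (i : Fin (k + 1)) (a : ℕ) (v : Fin (k + 1)) :
    arrowEnd A i a * idemEnd n F v = if v = arrowTarget i then arrowEnd A i a else 0 := by
  refine path_hom_ext fun b hb => ?_
  rw [Module.End.mul_apply, idemEnd_single]
  by_cases h₁ : v = b.1.1
  · rw [if_pos h₁]
    split_ifs with h₂
    · rfl
    · rw [arrowEnd_single A hb, arrowPathAction, if_neg (h₁ ▸ h₂), LinearMap.zero_apply]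
  · rw [if_neg h₁, map_zero]
    split_ifs with h₂
    · rw [arrowEnd_single A hb, arrowPathAction, if_neg fun h => h₁ (h₂.trans h.symm)]
    · rfl

/-- The endomorphisms of the space spanned by the paths satisfy the defining relations. -/
theorem isTensorRep_regular (hk : 1 ≤ k) :
    IsTensorRep A (idemEnd n F) (fun i a => arrowEnd A i (a : ℕ)) where
  idem_mul_idem v w := by
    refine path_hom_ext fun b _ => ?_
    rw [Module.End.mul_apply, idemEnd_single]
    by_cases h₁ : v = w
    · rw [if_pos h₁, idemEnd_single, h₁]
      split_ifs with h₂
      · rw [idemEnd_single, if_pos h₂]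
      · exact map_zero _
    · rw [if_neg h₁, LinearMap.zero_apply]
      split_ifs with h₂
      · rw [idemEnd_single, if_neg fun h => h₁ (h.trans h₂.symm)]
      · exact map_zero _
  idem_mul_arrow v i a := by
    refine path_hom_ext fun b hb => ?_
    rw [Module.End.mul_apply, arrowEnd_single A hb, idemEnd_arrowPathAction]
    split_ifs
    · exact (arrowEnd_single A hb).symm
    · rfl
  arrow_mul_idem i a := arrowEnd_mul_idemEnd A i a
  sum_idem := by
    refine path_hom_ext fun b _ => ?_
    rw [LinearMap.sum_apply]
    simp only [idemEnd_single, Finset.sum_ite_eq', Finset.mem_univ, if_true]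
    rfl
  prod_arrow I := by
    let J (i : Fin (k + 1)) : ℕ :=
      Fin.lastCases (motive := fun _ => ℕ) 0 (fun j => (I j : ℕ)) i
    have hJl : J (Fin.last k) = 0 := by simp [J]
    have hJc (j : Fin k) : J j.castSucc = I j := by simp [J]
    have hJ : ∀ i ∈ steps 0 (Fin.last k), J i < n i := by
      intro i hi
      obtain ⟨j, rfl⟩ := Fin.exists_castSucc_eq.2 (mem_steps.1 hi).2.ne
      rw [hJc]
      exact (I j).isLt
    have hprod := ofFn_eq_map_steps fun i => arrowEnd A i (J i)
    simp only [hJc] at hprod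
    rw [hprod]
    refine path_hom_ext fun b hb => ?_
    simp only [LinearMap.sum_apply, LinearMap.smul_apply]
    have hlast : (0 : Fin (k + 1)) < Fin.last k := by rw [Fin.lt_def]; simpa using Nat.lt_of_lt_of_le Nat.zero_lt_one hk
    by_cases hbl : b.1.1 = Fin.last k
    · have hb₂ : b.1.2 = Fin.last k :=
        (Fin.last_le_iff.1 (hbl ▸ (mem_pathList.1 hb).1))
      have hb0 := snd_eq_zero_of_fst_eq hk hb (hbl.trans hb₂.symm)
      have h := prod_arrowEnd_single_last (A := A) hk hb (hbl.trans_ne hlast.ne') hb₂ (J := J)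
        (hbl ▸ hJ)
      rw [hbl] at h
      rw [h, tensorRow_eq_sum]
      refine Finset.sum_congr rfl fun a _ => ?_
      rw [arrowEnd_single A hb, arrowPathAction, if_pos (by simpa using hbl), if_neg (by simp),
        arrowSource_last, hb₂, hb0, add_zero]
      have hval : restrictIndex (steps 0 (Fin.last k)) J + Pi.single (Fin.last k) (a : ℕ) =
          fun i => ((Fin.snoc (α := fun i => Fin (n i)) I a i : Fin (n i)) : ℕ) := by
        funext i
        induction i using Fin.lastCases with
        | last => simp [restrictIndex, mem_steps]
        | cast j => simp [restrictIndex, mem_steps, hJc, Fin.castSucc_lt_last]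
      rw [hval, tensorVal_coe]
      rfl
    · have h₁ : ((steps 0 (Fin.last k)).map fun i => arrowEnd A i (J i)).prod (pathSingle n F b) =
          0 := by
        have h := prod_steps_mul_idem (e := idemEnd n F) (y := fun i => arrowEnd A i (J i))
          (fun i v => arrowEnd_mul_idemEnd A i (J i) v) hlast b.1.1
        rw [if_neg hbl] at h
        have := LinearMap.congr_fun h (pathSingle n F b)
        rwa [Module.End.mul_apply, idemEnd_single, if_pos rfl] at this
      rw [h₁]
      refine (Finset.sum_eq_zero fun a _ => ?_).symm
      rw [arrowEnd_single A hb, arrowPathAction, if_neg (by simpa using hbl), smul_zero]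

end Regular

/-! ### The basis of paths -/

namespace TensorQuiverAlgebra

open Function

variable {k : ℕ} {n : Fin (k + 1) → ℕ} {F : Type*} [Field F] (A : Tensor F n)

/-- The arrow `x_{i,a}` for a natural number `a`, which is `0` if there is no such arrow. -/
noncomputable def natArrow (i : Fin (k + 1)) (a : ℕ) : TensorQuiverAlgebra A :=
  if h : a < n i then arrow A i ⟨a, h⟩ else 0

theorem natArrow_of_lt {i : Fin (k + 1)} {a : ℕ} (h : a < n i) :
    natArrow A i a = arrow A i ⟨a, h⟩ := dif_pos h

theorem natArrow_coe (i : Fin (k + 1)) (a : Fin (n i)) : natArrow A i a = arrow A i a :=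
  natArrow_of_lt A a.isLt

theorem natArrow_mul_idem (i : Fin (k + 1)) (a : ℕ) (v : Fin (k + 1)) :
    natArrow A i a * idem A v = if v = arrowTarget i then natArrow A i a else 0 := by
  by_cases h : a < n i
  · rw [natArrow_of_lt A h, (isTensorRep A).arrow_mul_idem]
  · rw [natArrow, dif_neg h, zero_mul, ite_self]

theorem idem_mul_natArrow (v i : Fin (k + 1)) (a : ℕ) :
    idem A v * natArrow A i a = if v = arrowSource i then natArrow A i a else 0 := by
  by_cases h : a < n i
  · rw [natArrow_of_lt A h, (isTensorRep A).idem_mul_arrow]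
  · rw [natArrow, dif_neg h, mul_zero, ite_self]

/-- The path with index `b` in the algebra of a tensor. -/
noncomputable def path (b : PathIndex k) : TensorQuiverAlgebra A :=
  idem A b.1.1 * ((acts b.1).map fun i => natArrow A i (b.2 i)).prod

/-- The element of the algebra of a tensor with given coordinates with respect to the paths. -/
noncomputable def pathValue : (Fin (pathList n).length → F) →ₗ[F] TensorQuiverAlgebra A :=
  pathExtend n (path A)

theorem pathValue_single {b : PathIndex k} (hb : b ∈ pathList n) :
    pathValue A (pathSingle n F b) = path A b :=
  pathExtend_single _ hb

theorem idem_mul_path (v : Fin (k + 1)) (b : PathIndex k) :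
    idem A v * path A b = if v = b.1.1 then path A b else 0 := by
  rw [path, ← mul_assoc, (isTensorRep A).idem_mul_idem]
  split_ifs with h
  · rw [h]
  · exact zero_mul _

theorem path_last {a : ℕ} (ha : a < n (Fin.last k)) :
    path A ((0, Fin.last k), Pi.single (Fin.last k) a) = arrow A (Fin.last k) ⟨a, ha⟩ := by
  rw [path, acts_full, List.map_singleton, List.prod_singleton, idem_mul_natArrow,
    if_pos arrowSource_last.symm]
  exact (congr_arg (natArrow A _) (Pi.single_eq_same (M := fun _ => ℕ) _ a)).trans
    (natArrow_of_lt A ha)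

theorem path_self (hk : 1 ≤ k) (v : Fin (k + 1)) (I : Fin (k + 1) → ℕ) :
    path A ((v, v), I) = idem A v := by
  rw [path, acts_self hk, List.map_nil, List.prod_nil, mul_one]

/-- The defining relation of the tensor, in coordinates. -/
theorem prod_natArrow {J : Fin (k + 1) → ℕ} (hJ : ∀ i ∈ steps 0 (Fin.last k), J i < n i)
    (hJl : J (Fin.last k) = 0) :
    ((steps 0 (Fin.last k)).map fun i => natArrow A i (J i)).prod = pathValue A (tensorRow A J) := by
  let I (j : Fin k) : Fin (n j.castSucc) :=
    ⟨J j.castSucc, hJ _ (mem_steps.2 ⟨Fin.zero_le _, Fin.castSucc_lt_last j⟩)⟩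
  have hI (j : Fin k) : natArrow A j.castSucc (J j.castSucc) = arrow A j.castSucc (I j) :=
    natArrow_of_lt A _
  have h := (isTensorRep A).prod_arrow I
  simp only [← hI] at h
  rw [ofFn_eq_map_steps fun i => natArrow A i (J i)] at h
  rw [h, tensorRow_eq_sum, map_sum]
  refine Finset.sum_congr rfl fun a _ => ?_
  rw [map_smul, pathValue_single A (last_mem_pathList a.isLt), path_last A a.isLt]
  have hval : J + Pi.single (Fin.last k) (a : ℕ) =
      fun i => ((Fin.snoc (α := fun i => Fin (n i)) I a i : Fin (n i)) : ℕ) := by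
    funext i
    induction i using Fin.lastCases with
    | last => simp [hJl]
    | cast j => simp [I]
  rw [hval, tensorVal_coe]

theorem idem_mul_pathValue (v : Fin (k + 1)) (m : Fin (pathList n).length → F) :
    idem A v * pathValue A m = pathValue A (idemEnd n F v m) := by
  let g : TensorQuiverAlgebra A →ₗ[F] TensorQuiverAlgebra A := LinearMap.mulLeft F (idem A v)
  have : g ∘ₗ pathValue A = pathValue A ∘ₗ (idemEnd n F v) := by
    refine path_hom_ext (F := F) (M := TensorQuiverAlgebra A) fun b hb => ?_
    rw [LinearMap.comp_apply, LinearMap.comp_apply, pathValue_single A hb,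
      LinearMap.mulLeft_apply, idem_mul_path, idemEnd_single]
    split_ifs
    · exact (pathValue_single A hb).symm
    · exact (map_zero _).symm
  exact LinearMap.congr_fun this m

theorem arrow_mul_path_eq_prod (hk : 1 ≤ k) {i : Fin (k + 1)} (hi : i ≠ Fin.last k) (a : Fin (n i))
    {b : PathIndex k} (hb : b ∈ pathList n) (h : b.1.1 = arrowTarget i) :
    arrow A i a * path A b =
      ((steps i b.1.2).map fun j => natArrow A j (update b.2 i a j)).prod := by
  have hv : (b.1.1 : ℕ) = i + 1 := h ▸ val_arrowTarget hi
  have hlt : i < b.1.2 := by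
    have := Fin.le_def.1 (mem_pathList.1 hb).1
    rw [Fin.lt_def]
    omega
  have hne : b.1 ≠ (0, Fin.last k) := fun h' =>
    arrowTarget_ne_zero hk i (h.symm.trans (congr_arg Prod.fst h'))
  rw [steps_eq_cons hv hlt, path, acts_of_ne hne, List.map_cons, List.prod_cons, update_self,
    natArrow_coe, ← mul_assoc, (isTensorRep A).arrow_mul_idem, if_pos h]
  congr 2
  refine List.map_congr_left fun j hj => ?_
  rw [update_of_ne]
  rintro rfl
  have := Fin.le_def.1 (mem_steps.1 hj).1
  omega

theorem arrow_mul_path (hk : 1 ≤ k) (i : Fin (k + 1)) (a : Fin (n i)) {b : PathIndex k}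
    (hb : b ∈ pathList n) :
    arrow A i a * path A b = pathValue A (arrowPathAction A i a b) := by
  rw [arrowPathAction]
  by_cases h₁ : b.1.1 = arrowTarget i
  swap
  · rw [if_neg h₁, path, ← mul_assoc, (isTensorRep A).arrow_mul_idem, if_neg h₁, zero_mul, map_zero]
  rw [if_pos h₁]
  by_cases hi : i = Fin.last k
  · subst hi
    rw [arrowTarget_last] at h₁
    obtain ⟨⟨u, w⟩, I⟩ := b
    dsimp only at h₁
    subst h₁
    obtain rfl : w = Fin.last k := Fin.last_le_iff.1 (mem_pathList.1 hb).1
    obtain rfl : I = 0 := snd_eq_zero_of_fst_eq hk hb rfl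
    rw [if_neg (by simp), arrowSource_last, path_self A hk, (isTensorRep A).arrow_mul_idem,
      if_pos arrowTarget_last.symm]
    exact ((pathValue_single A (last_mem_pathList a.isLt)).trans (path_last A a.isLt)).symm
  have hle := (mem_pathList.1 hb).1
  have hv : (b.1.1 : ℕ) = i + 1 := h₁ ▸ val_arrowTarget hi
  have hlt : i < b.1.1 := by rw [Fin.lt_def]; omega
  have hb' : b.1 ≠ (0, Fin.last k) := fun h' =>
    arrowTarget_ne_zero hk i (h₁.symm.trans (congr_arg Prod.fst h'))
  obtain ⟨-, hlow, hzero⟩ := mem_pathList.1 hb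
  rw [acts_of_ne hb'] at hlow hzero
  have hbound : ∀ j ∈ steps i b.1.2, update b.2 i (a : ℕ) j < n j := by
    intro j hj
    rcases eq_or_ne j i with rfl | hj'
    · simp
    · rw [update_of_ne hj']
      rw [steps_eq_cons hv (hlt.trans_le hle), List.mem_cons] at hj
      exact hlow j (hj.resolve_left hj')
  have hoff : ∀ j ∉ steps i b.1.2, update b.2 i (a : ℕ) j = 0 := by
    intro j hj
    rw [steps_eq_cons hv (hlt.trans_le hle), List.mem_cons, not_or] at hj
    rw [update_of_ne hj.1]
    exact hzero j hj.2
  rw [arrow_mul_path_eq_prod A hk hi a hb h₁, arrowSource_of_ne hi]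
  by_cases h₂ : (i, b.1.2) = (0, Fin.last k)
  · rw [if_pos ⟨hi, h₂⟩]
    rw [Prod.mk.injEq] at h₂
    obtain ⟨rfl, hw⟩ := h₂
    rw [hw] at hbound hoff ⊢
    exact prod_natArrow A hbound (hoff _ fun h => (mem_steps.1 h).2.ne rfl)
  · have hmem : (((i, b.1.2), update b.2 i (a : ℕ)) : PathIndex k) ∈ pathList n := by
      rw [mem_pathList, acts_of_ne h₂]
      exact ⟨(hlt.trans_le hle).le, hbound, hoff⟩
    rw [if_neg fun h => h₂ h.2, pathValue_single A hmem, path, acts_of_ne h₂]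
    dsimp only
    rw [steps_eq_cons hv (hlt.trans_le hle), List.map_cons, List.prod_cons, ← mul_assoc,
      idem_mul_natArrow, if_pos (arrowSource_of_ne hi).symm]

theorem arrow_mul_pathValue (hk : 1 ≤ k) (i : Fin (k + 1)) (a : Fin (n i))
    (m : Fin (pathList n).length → F) :
    arrow A i a * pathValue A m = pathValue A (arrowEnd A i a m) := by
  let g : TensorQuiverAlgebra A →ₗ[F] TensorQuiverAlgebra A := LinearMap.mulLeft F (arrow A i a)
  have : g ∘ₗ pathValue A = pathValue A ∘ₗ (arrowEnd A i a) := by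
    refine path_hom_ext (F := F) (M := TensorQuiverAlgebra A) fun b hb => ?_
    rw [LinearMap.comp_apply, LinearMap.comp_apply, pathValue_single A hb,
      LinearMap.mulLeft_apply, arrow_mul_path A hk i a hb, arrowEnd_single A hb]
  exact LinearMap.congr_fun this m

variable (n F) in
/-- The coordinates of the unit of the algebra of a tensor. -/
def oneCoord : Fin (pathList n).length → F := ∑ v, pathSingle n F ((v, v), 0)

theorem pathValue_oneCoord (hk : 1 ≤ k) : pathValue A (oneCoord n F) = 1 := by
  rw [oneCoord, map_sum, ← (isTensorRep A).sum_idem]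
  refine Finset.sum_congr rfl fun v _ => ?_
  rw [pathValue_single A (self_mem_pathList hk v), path_self A hk]

theorem idemEnd_oneCoord (v : Fin (k + 1)) :
    idemEnd n F v (oneCoord n F) = pathSingle n F ((v, v), 0) := by
  rw [oneCoord, map_sum]
  simp only [idemEnd_single, Finset.sum_ite_eq, Finset.mem_univ, if_true]

theorem path_mul_idem {b : PathIndex k} (hb : b.1.1 ≤ b.1.2) (v : Fin (k + 1)) :
    path A b * idem A v = if v = b.1.2 then path A b else 0 := by
  rw [path, mul_assoc]
  by_cases h : b.1 = (0, Fin.last k)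
  · rw [h, acts_full, List.map_singleton, List.prod_singleton, natArrow_mul_idem, arrowTarget_last,
      mul_ite, mul_zero]
  rw [acts_of_ne h]
  rcases eq_or_lt_of_le hb with h' | h'
  · rw [h', steps_self, List.map_nil, List.prod_nil, one_mul, mul_one,
      (isTensorRep A).idem_mul_idem]
    simp only [eq_comm]
  · rw [prod_steps_mul_idem (S := TensorQuiverAlgebra A) (fun i v => natArrow_mul_idem A i (b.2 i) v) h', mul_ite, mul_zero]

/-- The left regular representation in the coordinates given by the paths. -/
theorem exists_regular (hk : 1 ≤ k) :
    ∃ f : TensorQuiverAlgebra A →ₐ[F] Module.End F (Fin (pathList n).length → F),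
      (∀ v, f (idem A v) = idemEnd n F v) ∧ ∀ i a, a < n i → f (natArrow A i a) = arrowEnd A i a := by
  obtain ⟨f, h₁, h₂⟩ := exists_lift (isTensorRep_regular A hk)
  refine ⟨f, h₁, fun i a ha => ?_⟩
  rw [natArrow_of_lt A ha, h₂]

variable {A} in
/-- Multiplication in the algebra is computed by the regular representation. -/
theorem mul_pathValue {f : TensorQuiverAlgebra A →ₐ[F] Module.End F (Fin (pathList n).length → F)}
    (h₁ : ∀ v, f (idem A v) = idemEnd n F v)
    (h₂ : ∀ i a, a < n i → f (natArrow A i a) = arrowEnd A i a)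
    (hk : 1 ≤ k) (r : TensorQuiverAlgebra A) (m : Fin (pathList n).length → F) :
    r * pathValue A m = pathValue A (f r m) := by
  let T : Subalgebra F (TensorQuiverAlgebra A) :=
    { carrier := {r | ∀ m, r * pathValue A m = pathValue A (f r m)}
      mul_mem' := fun {r s} hr hs m => by
        rw [mul_assoc, hs, hr, map_mul, Module.End.mul_apply]
      add_mem' := fun {r s} hr hs m => by
        rw [add_mul, hs, hr, map_add, LinearMap.add_apply, map_add]
      algebraMap_mem' := fun c m => by
        rw [AlgHom.commutes, Module.algebraMap_end_apply, map_smul, ← Algebra.smul_def] }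
  have hT : T = ⊤ := by
    refine eq_top_of_mem T (fun v m => ?_) (fun i a m => ?_)
    · rw [idem_mul_pathValue, h₁]
    · rw [arrow_mul_pathValue A hk, ← natArrow_coe, h₂ _ _ a.isLt]
  have : r ∈ T := hT ▸ Algebra.mem_top
  exact this m

variable {A} in
/-- The structure constants are the matrix entries of the regular representation. -/
theorem regular_path_apply {f : TensorQuiverAlgebra A →ₐ[F] Module.End F (Fin (pathList n).length → F)}
    (h₁ : ∀ v, f (idem A v) = idemEnd n F v)
    (h₂ : ∀ i a, a < n i → f (natArrow A i a) = arrowEnd A i a)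
    (hk : 1 ≤ k) {b b' : PathIndex k} (hb : b ∈ pathList n)
    (hb' : b' ∈ pathList n) :
    f (path A b) (pathSingle n F b') = fun c => pathCoeff A b b' ((pathList n).get c) := by
  have hpath : f (path A b) =
      idemEnd n F b.1.1 * ((acts b.1).map fun i => arrowEnd A i (b.2 i)).prod := by
    rw [path, map_mul, map_list_prod, h₁, List.map_map]
    congr 2
    exact List.map_congr_left fun i hi => h₂ i _ ((mem_pathList.1 hb).2.1 i hi)
  have hcoeff (h : ¬ Rewrites b.1 b'.1) :
      (fun c => pathCoeff A b b' ((pathList n).get c)) =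
        if b.1.2 = b'.1.1 then pathSingle n F ((b.1.1, b'.1.2), b.2 + b'.2) else 0 := by
    funext c
    simp only [pathCoeff, if_neg h]
    by_cases h' : b.1.2 = b'.1.1
    · simp only [h', true_and, if_true, pathSingle]
    · simp only [h', false_and, if_false, Pi.zero_apply]
  obtain ⟨hle, hlow, hzero⟩ := mem_pathList.1 hb
  rw [hpath]
  by_cases hv : b.1.2 = b'.1.1
  swap
  · -- the paths do not match, so the action of `b` factors through a different idempotent
    rw [hcoeff fun h => hv h.1, if_neg hv]
    have h := congr_arg f (path_mul_idem A hle b'.1.1)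
    rw [if_neg (Ne.symm hv), map_mul, map_zero, h₁, hpath] at h
    have := LinearMap.congr_fun h (pathSingle n F b')
    rwa [Module.End.mul_apply, idemEnd_single, if_pos rfl] at this
  by_cases h : b.1 = (0, Fin.last k)
  · rw [hcoeff fun h' => h'.2.2.2.2 (congr_arg Prod.snd h), if_pos hv, h, acts_full,
      List.map_singleton, List.prod_singleton, Module.End.mul_apply, arrowEnd_single A hb',
      idemEnd_arrowPathAction, arrowSource_last, if_pos rfl, arrowPathAction, arrowTarget_last,
      if_pos (by rw [← hv, h]), if_neg (by simp), arrowSource_last]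
    obtain ⟨a, -, rfl⟩ := eq_last_of_mem_pathList hb h
    have hb'2 : b'.1.2 = Fin.last k :=
      Fin.last_le_iff.1 (hv.trans_le (mem_pathList.1 hb').1)
    rw [snd_eq_zero_of_fst_eq hk hb' (hv.symm.trans hb'2.symm), add_zero]
    congr 2
    exact congr_arg _ (Pi.single_eq_same (M := fun _ => ℕ) _ a)
  rw [acts_of_ne h] at hlow hzero ⊢
  have hrestrict : restrictIndex (steps b.1.1 b.1.2) b.2 = b.2 := by
    funext i
    rw [restrictIndex]
    split_ifs with hi
    · rfl
    · exact (hzero i hi).symm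
  rw [hv] at hlow hrestrict
  rw [Module.End.mul_apply]
  by_cases hne : (b.1.1, b'.1.2) = (0, Fin.last k)
  swap
  · have hR : ¬ Rewrites b.1 b'.1 := fun h' => hne (Prod.ext h'.2.1 h'.2.2.1)
    rw [hcoeff hR, if_pos hv, hv, prod_arrowEnd_single hb' (hv ▸ hle) hne hlow, idemEnd_single,
      if_pos rfl, hrestrict]
  rw [Prod.mk.injEq] at hne
  by_cases h0 : b.1.2 = 0
  · have hb2 := snd_eq_zero_of_fst_eq hk hb (hne.1.trans h0.symm)
    rw [hcoeff fun h' => h'.2.2.2.1 h0, if_pos hv, h0, hne.1, steps_self, hb2, zero_add, ← h0, hv]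
    simp [idemEnd_single]
  · have hl : b.1.2 ≠ Fin.last k := fun h' => h (Prod.ext hne.1 h')
    rw [hne.1] at hlow hrestrict ⊢
    rw [hv, prod_arrowEnd_single_last hk hb' (hv ▸ h0) hne.2 hlow, idemEnd_tensorRow, if_pos rfl,
      hrestrict]
    funext c
    rw [pathCoeff, if_pos ⟨hv, hne.1, hne.2, h0, hl⟩, tensorRow]

/-- The paths form a basis: `r ↦ f r 1`, with `f` the regular representation, inverts `pathValue`. -/
theorem pathValue_bijective (hk : 1 ≤ k) : Bijective (pathValue A) := by
  obtain ⟨f, h₁, h₂⟩ := exists_regular A hk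
  have hleft : ∀ m, f (pathValue A m) (oneCoord n F) = m := by
    intro m
    have : (LinearMap.applyₗ (oneCoord n F)) ∘ₗ f.toLinearMap ∘ₗ pathValue A = LinearMap.id := by
      refine path_hom_ext fun b hb => ?_
      have hself := path_mul_idem A (mem_pathList.1 hb).1 b.1.2
      rw [if_pos rfl] at hself
      rw [LinearMap.comp_apply, LinearMap.comp_apply, pathValue_single A hb,
        LinearMap.applyₗ_apply_apply, AlgHom.toLinearMap_apply, LinearMap.id_apply, ← hself,
        map_mul, Module.End.mul_apply, h₁, idemEnd_oneCoord,
        regular_path_apply h₁ h₂ hk hb (self_mem_pathList hk _)]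
      funext c
      have hR : ¬ Rewrites b.1 (b.1.2, b.1.2) := fun h => h.2.2.2.2 h.2.2.1
      simp [pathCoeff, hR, pathSingle]
    exact LinearMap.congr_fun this m
  refine ⟨fun m m' h => by rw [← hleft m, h, hleft], fun r => ⟨f r (oneCoord n F), ?_⟩⟩
  rw [← mul_pathValue h₁ h₂ hk, pathValue_oneCoord A hk, mul_one]

theorem isStructureArrayOf_tensorStructure (hk : 1 ≤ k) :
    IsStructureArrayOf (tensorStructure n A) (TensorQuiverAlgebra A) := by
  obtain ⟨f, h₁, h₂⟩ := exists_regular A hk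
  refine ⟨Module.Basis.ofEquivFun (LinearEquiv.ofBijective _ (pathValue_bijective A hk)).symm,
    fun i j => ?_⟩
  have hbas (i) : Module.Basis.ofEquivFun
      (LinearEquiv.ofBijective _ (pathValue_bijective A hk)).symm i =
        path A ((pathList n).get i) := by
    rw [Module.Basis.coe_ofEquivFun]
    dsimp only
    rw [← pathSingle_get]
    exact pathValue_single A ((pathList n).get_mem i)
  simp only [hbas]
  rw [← pathValue_single A ((pathList n).get_mem j), mul_pathValue h₁ h₂ hk,
    regular_path_apply h₁ h₂ hk ((pathList n).get_mem i) ((pathList n).get_mem j), pathValue,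
    pathExtend_apply]
  rfl

end TensorQuiverAlgebra

/-! ### Isomorphism of structure constants -/

section StructureConstants

variable {F : Type*} [Field F] {N : ℕ} {S T : StructureArray F N}

/-- The structure constants of the elements `∑ i, P i' i • b i`. -/
theorem IsStructureArrayOf.mul_change {R : Type*} [Ring R] [Algebra F R] {b : Fin N → R}
    (hb : ∀ i j, b i * b j = ∑ l, S i j l • b l) (P : Matrix.GeneralLinearGroup (Fin N) F)
    (i' j' : Fin N) :
    (∑ i, (P : Matrix (Fin N) (Fin N) F) i' i • b i) *
        (∑ j, (P : Matrix (Fin N) (Fin N) F) j' j • b j) =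
      ∑ l', (∑ i, ∑ j, ∑ l, S i j l *
        (P : Matrix (Fin N) (Fin N) F) i' i * (P : Matrix (Fin N) (Fin N) F) j' j *
        ((P⁻¹ : Matrix.GeneralLinearGroup (Fin N) F) : Matrix (Fin N) (Fin N) F) l l') •
          ∑ i, (P : Matrix (Fin N) (Fin N) F) l' i • b i := by
  have hinv (l : Fin N) : b l = ∑ l', ((P⁻¹ : Matrix.GeneralLinearGroup (Fin N) F) :
      Matrix (Fin N) (Fin N) F) l l' • ∑ i, (P : Matrix (Fin N) (Fin N) F) l' i • b i := by
    simp only [Finset.smul_sum, smul_smul]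
    rw [Finset.sum_comm]
    simp only [← Finset.sum_smul, ← Matrix.mul_apply]
    rw [← Units.val_mul, inv_mul_cancel]
    simp [Matrix.one_apply]
  rw [Finset.sum_mul_sum]
  simp only [Finset.sum_smul]
  conv_rhs => rw [Finset.sum_comm]
  refine Finset.sum_congr rfl fun i _ => ?_
  conv_rhs => rw [Finset.sum_comm]
  refine Finset.sum_congr rfl fun j _ => ?_
  conv_rhs => rw [Finset.sum_comm]
  rw [smul_mul_smul_comm, hb, Finset.smul_sum]
  refine Finset.sum_congr rfl fun l _ => ?_
  rw [hinv l, Finset.smul_sum, Finset.smul_sum]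
  refine Finset.sum_congr rfl fun l' _ => ?_
  rw [smul_smul, smul_smul]
  congr 1
  ring

/-- Algebras are isomorphic if and only if their arrays of structure constants are. -/
theorem structureArrayIso_iff {R R' : Type*} [Ring R] [Algebra F R] [Ring R'] [Algebra F R']
    (hS : IsStructureArrayOf S R) (hT : IsStructureArrayOf T R') :
    Nonempty (R ≃ₐ[F] R') ↔ StructureArrayIso S T := by
  obtain ⟨b, hb⟩ := hS
  obtain ⟨b', hb'⟩ := hT
  constructor
  · rintro ⟨φ⟩
    have hφ (r : R) : b'.repr (φ r) = ∑ i, b.repr r i • b'.repr (φ (b i)) := by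
      conv_lhs => rw [← b.sum_repr r]
      simp only [map_sum, map_smul]
    have hφ' (r : R') : b.repr (φ.symm r) = ∑ i, b'.repr r i • b.repr (φ.symm (b' i)) := by
      conv_lhs => rw [← b'.sum_repr r]
      simp only [map_sum, map_smul]
    let P : Matrix.GeneralLinearGroup (Fin N) F :=
      { val := .of fun i' i => b.repr (φ.symm (b' i')) i
        inv := .of fun l l' => b'.repr (φ (b l)) l'
        val_inv := by
          ext i l
          have := DFunLike.congr_fun (hφ (φ.symm (b' i))) l
          rw [φ.apply_symm_apply, Module.Basis.repr_self, Finsupp.finsetSum_apply] at this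
          rw [Matrix.mul_apply, Matrix.one_apply]
          simpa [Finsupp.single_apply, eq_comm] using this.symm
        inv_val := by
          ext i l
          have := DFunLike.congr_fun (hφ' (φ (b i))) l
          rw [φ.symm_apply_apply, Module.Basis.repr_self, Finsupp.finsetSum_apply] at this
          rw [Matrix.mul_apply, Matrix.one_apply]
          simpa [Finsupp.single_apply, eq_comm] using this.symm }
    refine ⟨P, fun i' j' l' => ?_⟩
    have hv (l' : Fin N) : ∑ i, (P : Matrix (Fin N) (Fin N) F) l' i • b i = φ.symm (b' l') :=
      b.sum_repr _
    have h := IsStructureArrayOf.mul_change hb P i' j'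
    simp only [hv] at h
    rw [← map_mul, hb', map_sum] at h
    simp only [← map_smul, ← map_sum] at h
    have h := congr_arg (fun r => b'.repr r l') (φ.symm.injective h)
    simpa only [Module.Basis.repr_sum_self] using h
  · rintro ⟨P, hP⟩
    let f : R' →ₗ[F] R := b'.constr F fun l' => ∑ i, (P : Matrix (Fin N) (Fin N) F) l' i • b i
    let g : R →ₗ[F] R' := b.constr F fun l => ∑ i,
      ((P⁻¹ : Matrix.GeneralLinearGroup (Fin N) F) : Matrix (Fin N) (Fin N) F) l i • b' i
    have hf (i) : f (b' i) = ∑ j, (P : Matrix (Fin N) (Fin N) F) i j • b j := b'.constr_basis F _ i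
    have hg (i) : g (b i) = ∑ j, ((P⁻¹ : Matrix.GeneralLinearGroup (Fin N) F) :
      Matrix (Fin N) (Fin N) F) i j • b' j := b.constr_basis F _ i
    have hfg : f ∘ₗ g = LinearMap.id := by
      refine b.ext fun l => ?_
      simp only [LinearMap.comp_apply, hg, hf, map_sum, map_smul, Finset.smul_sum, smul_smul]
      rw [Finset.sum_comm]
      simp only [← Finset.sum_smul, ← Matrix.mul_apply]
      rw [← Units.val_mul, inv_mul_cancel]
      simp [Matrix.one_apply]
    have hgf : g ∘ₗ f = LinearMap.id := by
      refine b'.ext fun l => ?_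
      simp only [LinearMap.comp_apply, hg, hf, map_sum, map_smul, Finset.smul_sum, smul_smul]
      rw [Finset.sum_comm]
      simp only [← Finset.sum_smul, ← Matrix.mul_apply]
      rw [← Units.val_mul, mul_inv_cancel]
      simp [Matrix.one_apply]
    have hmul (r s : R') : f (r * s) = f r * f s := by
      have : (LinearMap.mul F R').compr₂ f = (LinearMap.mul F R).compl₁₂ f f := by
        refine b'.ext fun i => b'.ext fun j => ?_
        rw [LinearMap.compr₂_apply, LinearMap.compl₁₂_apply, LinearMap.mul_apply',
          LinearMap.mul_apply', hb', map_sum]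
        simp only [map_smul]
        simp only [hf, IsStructureArrayOf.mul_change hb P, hP]
      exact LinearMap.congr_fun₂ this r s
    have hone : f 1 = 1 := by
      have h := hmul (g 1) 1
      rwa [mul_one, ← LinearMap.comp_apply, hfg, LinearMap.id_apply, one_mul, eq_comm] at h
    exact ⟨(AlgEquiv.ofLinearEquiv (LinearEquiv.ofLinearMap f g hfg hgf) hone hmul).symm⟩

end StructureConstants

/-! ### Isomorphism of tensors -/

section TensorIso

variable {k : ℕ} {n : Fin (k + 1) → ℕ} {F : Type*} [Field F]

/-- Moving the change of basis in the last direction to the other side. -/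
theorem tensorIso_iff {A B : Tensor F n} :
    TensorIso A B ↔ ∃ Q : ∀ i, Matrix.GeneralLinearGroup (Fin (n i)) F,
      ∀ (I : ∀ j : Fin k, Fin (n j.castSucc)) (c : Fin (n (Fin.last k))),
        ∑ a, A (Fin.snoc (α := fun i => Fin (n i)) I a) *
            (Q (Fin.last k) : Matrix (Fin (n (Fin.last k))) (Fin (n (Fin.last k))) F) a c =
          ∑ J : ∀ j : Fin k, Fin (n j.castSucc),
            (∏ j, (Q j.castSucc : Matrix (Fin (n j.castSucc)) (Fin (n j.castSucc)) F) (I j) (J j)) *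
              B (Fin.snoc (α := fun i => Fin (n i)) J c) := by
  let D (Q : ∀ i, Matrix.GeneralLinearGroup (Fin (n i)) F) (I : ∀ j : Fin k, Fin (n j.castSucc))
      (c : Fin (n (Fin.last k))) : F := ∑ J : ∀ j : Fin k, Fin (n j.castSucc),
    (∏ j, (Q j.castSucc : Matrix (Fin (n j.castSucc)) (Fin (n j.castSucc)) F) (I j) (J j)) *
      B (Fin.snoc (α := fun i => Fin (n i)) J c)
  let M (I : ∀ j : Fin k, Fin (n j.castSucc)) (a : Fin (n (Fin.last k))) : F :=
    A (Fin.snoc (α := fun i => Fin (n i)) I a)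
  have hsum (P : ∀ i, Matrix.GeneralLinearGroup (Fin (n i)) F) (I a) :
      ∑ J : ∀ i, Fin (n i), (∏ i, (P i : Matrix (Fin (n i)) (Fin (n i)) F)
        ((Fin.snoc I a : ∀ i, Fin (n i)) i) (J i)) * B J =
          ((P (Fin.last k)).1.mulVec (D P I)) a := by
    rw [← (Fin.snocEquiv fun i => Fin (n i)).sum_comp, Fintype.sum_prod_type]
    simp only [Matrix.mulVec, dotProduct, D, Finset.mul_sum]
    refine Finset.sum_congr rfl fun c _ => Finset.sum_congr rfl fun J _ => ?_
    simp only [Fin.snocEquiv, Equiv.coe_fn_mk, Fin.prod_univ_castSucc, Fin.snoc_castSucc,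
      Fin.snoc_last]
    ring
  have hiso (P : ∀ i, Matrix.GeneralLinearGroup (Fin (n i)) F) :
      (∀ I, A I = ∑ J : ∀ i, Fin (n i), (∏ i, (P i : Matrix (Fin (n i)) (Fin (n i)) F)
        (I i) (J i)) * B J) ↔ ∀ I, M I = (P (Fin.last k)).1.mulVec (D P I) := by
    constructor
    · intro h I
      funext a
      rw [← hsum P I a]
      exact h _
    · intro h I
      induction I using Fin.snocCases with
      | snoc I a => rw [hsum P I a, ← h I]
  have hD (P Q : ∀ i, Matrix.GeneralLinearGroup (Fin (n i)) F)
      (h : ∀ j : Fin k, P j.castSucc = Q j.castSucc) : D P = D Q := by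
    simp only [D, h]
  -- the contragredient change of basis in the last direction
  let contra (Q : ∀ i, Matrix.GeneralLinearGroup (Fin (n i)) F) :
      ∀ i, Matrix.GeneralLinearGroup (Fin (n i)) F :=
    Function.update Q (Fin.last k)
      { val := (Q (Fin.last k)).2.transpose
        inv := (Q (Fin.last k)).1.transpose
        val_inv := by rw [← Matrix.transpose_mul, Units.val_inv, Matrix.transpose_one]
        inv_val := by rw [← Matrix.transpose_mul, Units.inv_val, Matrix.transpose_one] }
  have hcontra (Q) : D (contra Q) = D Q :=
    hD _ _ fun j => Function.update_of_ne (Fin.castSucc_lt_last j).ne _ _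
  have hcl (Q) : (contra Q (Fin.last k)).1 = (Q (Fin.last k)).2.transpose :=
    congr_arg Units.val (Function.update_self (Fin.last k) _ Q)
  have hvec (Q : ∀ i, Matrix.GeneralLinearGroup (Fin (n i)) F) (I) :
      (fun c => ∑ a, A (Fin.snoc (α := fun i => Fin (n i)) I a) *
        (Q (Fin.last k) : Matrix (Fin (n (Fin.last k))) (Fin (n (Fin.last k))) F) a c) =
          (Q (Fin.last k)).1.transpose.mulVec (M I) := by
    rw [Matrix.mulVec_transpose]
    rfl
  constructor
  · rintro ⟨P, hP⟩
    rw [hiso] at hP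
    refine ⟨contra P, fun I c => ?_⟩
    refine (congr_fun (hvec (contra P) I) c).trans ((congr_fun ?_ c).trans
      (congr_fun₂ (hcontra P) I c).symm)
    rw [hcl, Matrix.transpose_transpose, hP, Matrix.mulVec_mulVec, Units.inv_val,
      Matrix.one_mulVec]
  · rintro ⟨Q, hQ⟩
    refine ⟨contra Q, (hiso _).2 fun I => ?_⟩
    have h : (Q (Fin.last k)).1.transpose.mulVec (M I) = D Q I :=
      (hvec Q I).symm.trans (funext (hQ I))
    rw [hcl, hcontra, ← h, Matrix.mulVec_mulVec, ← Matrix.transpose_mul, Units.val_inv,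
      Matrix.transpose_one, Matrix.one_mulVec]

/-- Expanding a noncommutative product of linear combinations. -/
theorem prod_ofFn_sum {S : Type*} [Ring S] [Algebra F S] {m : ℕ} {p : Fin m → ℕ}
    (c : ∀ j, Fin (p j) → F) (y : ∀ j, Fin (p j) → S) :
    (List.ofFn fun j => ∑ b, c j b • y j b).prod =
      ∑ J : ∀ j, Fin (p j), (∏ j, c j (J j)) • (List.ofFn fun j => y j (J j)).prod := by
  have h := (MultilinearMap.mkPiAlgebraFin F m S).map_sum fun j b => c j b • y j b
  simpa only [MultilinearMap.map_smul_univ, MultilinearMap.mkPiAlgebraFin_apply] using h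

/-- The product of the transformed arrows of `B` along `I`, expressed by arrows of `B` in the last
direction. -/
theorem IsTensorRep.prod_change {S : Type*} [Ring S] [Algebra F S] {B : Tensor F n}
    {e : Fin (k + 1) → S} {y : ∀ i, Fin (n i) → S} (h : IsTensorRep B e y)
    (Q : ∀ i, Matrix (Fin (n i)) (Fin (n i)) F) (I : ∀ j : Fin k, Fin (n j.castSucc)) :
    (List.ofFn fun j : Fin k => ∑ b, Q j.castSucc (I j) b • y j.castSucc b).prod =
      ∑ c, (∑ J : ∀ j : Fin k, Fin (n j.castSucc), (∏ j, Q j.castSucc (I j) (J j)) *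
        B (Fin.snoc (α := fun i => Fin (n i)) J c)) • y (Fin.last k) c := by
  rw [prod_ofFn_sum (fun j => Q j.castSucc (I j)) fun j => y j.castSucc]
  simp only [h.prod_arrow, Finset.smul_sum, Finset.sum_smul, smul_smul]
  exact Finset.sum_comm

end TensorIso

namespace TensorQuiverAlgebra

variable {k : ℕ} {n : Fin (k + 1) → ℕ} {F : Type*} [Field F]

/-- An isomorphism of tensors acts linearly on the arrows; the induced homomorphism is surjective
between algebras with bases of the same size. -/
theorem nonempty_algEquiv_of_tensorIso (hk : 1 ≤ k) {A B : Tensor F n} (h : TensorIso A B) :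
    Nonempty (TensorQuiverAlgebra A ≃ₐ[F] TensorQuiverAlgebra B) := by
  obtain ⟨Q, hQ⟩ := tensorIso_iff.1 h
  have hB := isTensorRep B
  have hrep : IsTensorRep A (idem B) fun i a => ∑ b, (Q i).1 a b • arrow B i b :=
    { idem_mul_idem := hB.idem_mul_idem
      idem_mul_arrow := fun v i a => by
        simp only [Finset.mul_sum, mul_smul_comm, hB.idem_mul_arrow]
        split_ifs <;> simp
      arrow_mul_idem := fun i a v => by
        simp only [Finset.sum_mul, smul_mul_assoc, hB.arrow_mul_idem]
        split_ifs <;> simp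
      sum_idem := hB.sum_idem
      prod_arrow := fun I => by
        rw [hB.prod_change fun i => (Q i).1]
        simp only [Finset.smul_sum, smul_smul]
        rw [Finset.sum_comm]
        simp only [← Finset.sum_smul, hQ] }
  obtain ⟨f, hf₁, hf₂⟩ := exists_lift hrep
  have hsurj : Function.Surjective f := by
    rw [← AlgHom.range_eq_top]
    refine eq_top_of_mem _ (fun v => ⟨_, hf₁ v⟩) fun i b => ?_
    have h : arrow B i b = ∑ a, (Q i).2 b a • f (arrow A i a) := by
      simp only [hf₂, Finset.smul_sum, smul_smul]
      rw [Finset.sum_comm]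
      simp only [← Finset.sum_smul, ← Matrix.mul_apply, Units.inv_val]
      simp [Matrix.one_apply]
    rw [h]
    exact sum_mem fun a _ => Subalgebra.smul_mem _ (AlgHom.mem_range_self f _) _
  let LA := LinearEquiv.ofBijective _ (pathValue_bijective A hk)
  let LB := LinearEquiv.ofBijective _ (pathValue_bijective B hk)
  have hinj : Function.Injective (LB.symm.toLinearMap ∘ₗ f.toLinearMap ∘ₗ LA.toLinearMap) :=
    LinearMap.injective_iff_surjective.2
      (LB.symm.surjective.comp (hsurj.comp LA.surjective))
  refine ⟨AlgEquiv.ofBijective f ⟨fun r s hrs => ?_, hsurj⟩⟩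
  apply LA.symm.injective
  apply hinj
  simp [hrs]

end TensorQuiverAlgebra

/-! ### Recovering the tensor from its algebra -/

namespace TensorQuiverAlgebra

variable {k : ℕ} {n : Fin (k + 1) → ℕ} {F : Type*} [Field F] (A : Tensor F n)

theorem idem_mul_path_mul_idem {b : PathIndex k} (hb : b.1.1 ≤ b.1.2) (u w : Fin (k + 1)) :
    idem A u * path A b * idem A w = if b.1 = (u, w) then path A b else 0 := by
  rw [idem_mul_path, ite_mul, zero_mul, path_mul_idem A hb]
  simp only [Prod.ext_iff, ← ite_and, eq_comm]

/-- An element of the corner between `u` and `w` is a combination of paths from `u` to `w`. -/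
theorem corner_mem (hk : 1 ≤ k) {u w : Fin (k + 1)} {T : Submodule F (TensorQuiverAlgebra A)}
    (hT : ∀ b ∈ pathList n, b.1 = (u, w) → path A b ∈ T) (r : TensorQuiverAlgebra A) :
    idem A u * r * idem A w ∈ T := by
  obtain ⟨m, rfl⟩ := (pathValue_bijective A hk).2 r
  rw [pathValue, pathExtend_apply, Finset.mul_sum, Finset.sum_mul]
  refine sum_mem fun i _ => ?_
  have hb := (pathList n).get_mem i
  rw [mul_smul_comm, smul_mul_assoc, idem_mul_path_mul_idem A (mem_pathList.1 hb).1]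
  refine T.smul_mem _ ?_
  split_ifs with h
  · exact hT _ hb h
  · exact T.zero_mem

theorem corner_eq_zero (hk : 1 ≤ k) {u w : Fin (k + 1)} (h : ¬ u ≤ w)
    (r : TensorQuiverAlgebra A) : idem A u * r * idem A w = 0 := by
  refine (Submodule.mem_bot F).1 (corner_mem A hk (fun b hb hbu => absurd ?_ h) r)
  have := (mem_pathList.1 hb).1
  rwa [hbu] at this

theorem path_ne_zero (hk : 1 ≤ k) {b : PathIndex k} (hb : b ∈ pathList n) : path A b ≠ 0 := by
  rw [← pathValue_single A hb, Ne, (pathValue_bijective A hk).1.eq_iff' (map_zero _)]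
  obtain ⟨i, rfl⟩ := List.mem_iff_get.1 hb
  rw [pathSingle_get, Pi.single_eq_zero_iff]
  exact one_ne_zero

theorem exists_corner_ne_zero (hk : 1 ≤ k) (hn : ∀ i, 0 < n i) {u w : Fin (k + 1)} (h : u ≤ w) :
    ∃ r, idem A u * r * idem A w ≠ 0 := by
  have hb : (((u, w), 0) : PathIndex k) ∈ pathList n :=
    mem_pathList.2 ⟨h, fun i _ => hn i, fun i _ => rfl⟩
  refine ⟨path A ((u, w), 0), ?_⟩
  rw [idem_mul_path_mul_idem A h, if_pos rfl]
  exact path_ne_zero A hk hb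

theorem arrowSource_le_arrowTarget (i : Fin (k + 1)) : arrowSource i ≤ arrowTarget i := by
  by_cases hi : i = Fin.last k
  · rw [hi, arrowSource_last]
    exact Fin.zero_le _
  · rw [arrowSource_of_ne hi, Fin.le_def, val_arrowTarget hi]
    exact Nat.le_succ _

theorem acts_arrow (hk : 2 ≤ k) (i : Fin (k + 1)) : acts (arrowSource i, arrowTarget i) = [i] := by
  by_cases hi : i = Fin.last k
  · rw [hi, arrowSource_last, arrowTarget_last, acts_full]
  · have hv := val_arrowTarget hi
    rw [arrowSource_of_ne hi, acts_of_ne, steps_eq_cons hv, steps_self]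
    · exact Fin.lt_def.2 (show (i : ℕ) < arrowTarget i by omega)
    · rw [Ne, Prod.mk.injEq, Fin.ext_iff, Fin.ext_iff, hv, Fin.val_last, Fin.val_zero]
      omega

theorem arrow_mem_pathList (hk : 2 ≤ k) (i : Fin (k + 1)) (a : Fin (n i)) :
    (((arrowSource i, arrowTarget i), Pi.single i (a : ℕ)) : PathIndex k) ∈ pathList n := by
  rw [mem_pathList, acts_arrow hk]
  exact ⟨arrowSource_le_arrowTarget i, by simp, fun j hj =>
    Pi.single_eq_of_ne (M := fun _ => ℕ) (by simpa using hj) _⟩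

theorem path_arrow (hk : 2 ≤ k) (i : Fin (k + 1)) (I : Fin (k + 1) → ℕ) :
    path A ((arrowSource i, arrowTarget i), I) = natArrow A i (I i) := by
  rw [path, acts_arrow hk, List.map_singleton, List.prod_singleton, idem_mul_natArrow, if_pos rfl]

/-- The corner between the end points of the arrows in direction `i` is spanned by these arrows.
For quivers with two vertices this fails, which is why at least three directions are needed. -/
theorem corner_arrow (hk : 2 ≤ k) (i : Fin (k + 1)) (r : TensorQuiverAlgebra A) :
    ∃ c : Fin (n i) → F,
      idem A (arrowSource i) * r * idem A (arrowTarget i) = ∑ a, c a • arrow A i a := by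
  have h := corner_mem A (one_le_two.trans hk) (u := arrowSource i) (w := arrowTarget i)
    (T := Submodule.span F (Set.range (arrow A i))) (fun b hb hbi => ?_) r
  · obtain ⟨c, hc⟩ := (Submodule.mem_span_range_iff_exists_fun F).1 h
    exact ⟨c, hc.symm⟩
  · obtain ⟨B, I⟩ := b
    dsimp only at hbi
    subst hbi
    have hI : I i < n i := (mem_pathList.1 hb).2.1 i (by simp [acts_arrow hk])
    rw [path_arrow A hk, natArrow_of_lt A hI]
    exact Submodule.subset_span ⟨_, rfl⟩

/-- The arrows in one direction are linearly independent. -/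
theorem coeff_arrow_injective (hk : 2 ≤ k) (i : Fin (k + 1)) {c d : Fin (n i) → F}
    (h : ∑ a, c a • arrow A i a = ∑ a, d a • arrow A i a) : c = d := by
  let p (a : Fin (n i)) : PathIndex k :=
    ((arrowSource i, arrowTarget i), Pi.single i (a : ℕ))
  have hval (c : Fin (n i) → F) :
      pathValue A (∑ a, c a • pathSingle n F (p a)) = ∑ a, c a • arrow A i a := by
    rw [map_sum]
    refine Finset.sum_congr rfl fun a _ => ?_
    rw [map_smul, pathValue_single A (arrow_mem_pathList hk i a), path_arrow A hk,
      Pi.single_eq_same, natArrow_coe]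
  rw [← hval, ← hval] at h
  replace h := (pathValue_bijective A (one_le_two.trans hk)).1 h
  funext a
  obtain ⟨l, hl⟩ := List.mem_iff_get.1 (arrow_mem_pathList (n := n) hk i a)
  have hcoord (c : Fin (n i) → F) : (∑ a, c a • pathSingle n F (p a)) l = c a := by
    rw [Finset.sum_apply, Finset.sum_eq_single a]
    · rw [Pi.smul_apply, pathSingle, hl, if_pos rfl, smul_eq_mul, mul_one]
    · intro a' _ ha'
      rw [Pi.smul_apply, pathSingle, hl, if_neg, smul_zero]
      rw [Prod.mk.injEq, (Pi.single_injective i).eq_iff]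
      exact fun h => ha' (Fin.ext h.2.symm)
    · simp
  rw [← hcoord c, h, hcoord]

/-- The character of the algebra which is `1` on the vertex `v` and `0` on the other vertices and the
arrows. -/
theorem exists_character (hk : 1 ≤ k) (v : Fin (k + 1)) :
    ∃ ε : TensorQuiverAlgebra A →ₐ[F] F, (∀ w, ε (idem A w) = if v = w then 1 else 0) ∧
      ∀ r, idem A v * r * idem A v = ε r • idem A v := by
  have hrep : IsTensorRep A (fun w => if v = w then (1 : F) else 0) fun _ _ => 0 :=
    { idem_mul_idem := fun u w => by by_cases h₁ : v = u <;> by_cases h₂ : v = w <;> grind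
      idem_mul_arrow := by simp
      arrow_mul_idem := by simp
      sum_idem := by simp
      prod_arrow := fun I => by
        obtain ⟨m, rfl⟩ := Nat.exists_eq_add_of_le' hk
        simp [List.ofFn_succ] }
  obtain ⟨ε, hε₁, -⟩ := exists_lift hrep
  refine ⟨ε, hε₁, fun r => ?_⟩
  obtain ⟨m, rfl⟩ := (pathValue_bijective A hk).2 r
  rw [pathValue, pathExtend_apply, Finset.mul_sum, Finset.sum_mul, map_sum, Finset.sum_smul]
  refine Finset.sum_congr rfl fun i _ => ?_
  have hb := (mem_pathList.1 ((pathList n).get_mem i)).1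
  generalize (pathList n).get i = b at hb
  rw [mul_smul_comm, smul_mul_assoc, map_smul, smul_assoc, idem_mul_path_mul_idem A hb]
  congr 1
  obtain ⟨⟨u, w⟩, I⟩ := b
  by_cases hu : v = u
  · by_cases hw : v = w
    · subst hu hw
      rw [if_pos rfl, path_self A hk, hε₁, if_pos rfl, one_smul]
    · have h := congr_arg ε (path_mul_idem A hb w)
      rw [if_pos rfl, map_mul, hε₁, if_neg hw, mul_zero] at h
      rw [← h, zero_smul, if_neg]
      exact fun h => hw (Prod.mk.inj h).2.symm
  · have h := congr_arg ε (idem_mul_path A u ((u, w), I))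
    rw [if_pos rfl, map_mul, hε₁, if_neg hu, zero_mul] at h
    rw [← h, zero_smul, if_neg]
    exact fun h => hu (Prod.mk.inj h).1.symm

/-- An element which is killed by all characters is nilpotent: its powers move strictly forward
along the vertices. -/
theorem isNilpotent_of_corner_eq_zero (hk : 1 ≤ k) {r : TensorQuiverAlgebra A}
    (h : ∀ v, idem A v * r * idem A v = 0) : IsNilpotent r := by
  have hsum := (isTensorRep A).sum_idem
  have hpow (m : ℕ) : ∀ u w : Fin (k + 1), (w : ℕ) < u + m →
      idem A u * r ^ m * idem A w = 0 := by
    induction m with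
    | zero => exact fun u w huw => corner_eq_zero A hk (by rw [Fin.le_def]; omega) _
    | succ m ih =>
      intro u w huw
      have hsplit : idem A u * r ^ (m + 1) * idem A w =
          ∑ v, (idem A u * r ^ m * idem A v) * (idem A v * r * idem A w) := by
        have hv (v : Fin (k + 1)) : (idem A u * r ^ m * idem A v) * (idem A v * r * idem A w) =
            idem A u * r ^ m * (idem A v * (r * idem A w)) := by
          have := (isTensorRep A).idem_mul_idem v v
          rw [if_pos rfl] at this
          rw [mul_assoc (idem A v) r, mul_assoc _ (idem A v), ← mul_assoc (idem A v) (idem A v),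
            this]
        simp only [hv]
        rw [← Finset.mul_sum, ← Finset.sum_mul, hsum, one_mul, pow_succ]
        simp only [mul_assoc]
      rw [hsplit]
      refine Finset.sum_eq_zero fun v _ => ?_
      rcases lt_trichotomy v w with hvw | rfl | hvw
      · rw [ih u v (by rw [Fin.lt_def] at hvw; omega), zero_mul]
      · rw [h, mul_zero]
      · rw [corner_eq_zero A hk hvw.not_ge, mul_zero]
  refine ⟨k + 1, ?_⟩
  rw [← one_mul (r ^ (k + 1)), ← mul_one (1 * r ^ (k + 1)), ← hsum, Finset.sum_mul,
    Finset.sum_mul_sum]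
  exact Finset.sum_eq_zero fun u _ => Finset.sum_eq_zero fun w _ => hpow _ u w (by omega)

variable {A} {B : Tensor F n}

/-- After an inner automorphism, an isomorphism permutes the idempotents of the vertices. -/
theorem exists_algEquiv_idem (hk : 1 ≤ k) (φ : TensorQuiverAlgebra A ≃ₐ[F] TensorQuiverAlgebra B) :
    ∃ (ψ : TensorQuiverAlgebra A ≃ₐ[F] TensorQuiverAlgebra B) (τ : Fin (k + 1) → Fin (k + 1)),
      Function.Bijective τ ∧ ∀ v, ψ (idem A (τ v)) = idem B v := by
  choose εA hεA _ using exists_character A hk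
  choose ε hε hεc using exists_character B hk
  have hmul (i j) : φ (idem A i) * φ (idem A j) = if i = j then φ (idem A i) else 0 := by
    rw [← map_mul, (isTensorRep A).idem_mul_idem, apply_ite φ, map_zero]
  have hnil {r : TensorQuiverAlgebra B} (hr : ∀ v, ε v r = 0) : IsNilpotent r :=
    isNilpotent_of_corner_eq_zero B hk fun v => by rw [hεc, hr, zero_smul]
  -- each character of `B` is `1` on the image of exactly one vertex `τ v` of `A`
  have hex (v) : ∃ i, ε v (φ (idem A i)) ≠ 0 := by
    by_contra! h
    have h₁ := congr_arg (fun r => ε v (φ r)) (isTensorRep A).sum_idem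
    simp [h] at h₁
  choose τ hτ using hex
  have hτ₁ (v) : ε v (φ (idem A (τ v))) = 1 := by
    have h := congr_arg (ε v) (hmul (τ v) (τ v))
    rw [if_pos rfl, map_mul] at h
    exact mul_eq_left₀ (hτ v) |>.1 h
  have hτ₀ (v i) (hi : i ≠ τ v) : ε v (φ (idem A i)) = 0 := by
    have h := congr_arg (ε v) (hmul i (τ v))
    rwa [if_neg hi, map_mul, hτ₁, mul_one, map_zero] at h
  -- an idempotent killed by all characters is nilpotent, hence `0`
  have hsurj : Function.Surjective τ := by
    intro i
    by_contra! h
    obtain ⟨m, hm⟩ := hnil fun v => hτ₀ v i (h v).symm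
    have hidem : IsIdempotentElem (φ (idem A i)) := by
      have := hmul i i
      rwa [if_pos rfl] at this
    have h0 : φ (idem A i) = 0 := by
      rw [← hidem.pow_succ_eq m, pow_succ, hm, zero_mul]
    rw [map_eq_zero_iff φ φ.injective] at h0
    have := hεA i i
    rw [h0, map_zero, if_pos rfl] at this
    exact zero_ne_one this
  have hbij : Function.Bijective τ := Finite.surjective_iff_bijective.1 hsurj
  -- the sum `U` intertwines the two families of idempotents, and it is unipotent
  let U := ∑ v, φ (idem A (τ v)) * idem B v
  have hU : IsUnit U := by
    have h : IsNilpotent (1 - U) := hnil fun v => by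
      rw [map_sub (ε v), map_one, map_sum]
      simp [hε, hτ₁]
    have h' := IsNilpotent.isUnit_one_sub (R := TensorQuiverAlgebra B) h
    have hU : 1 - (1 - U) = U := sub_sub_cancel 1 U
    exact hU ▸ h'
  obtain ⟨u, hu⟩ := hU
  have hleft (v) : φ (idem A (τ v)) * u = φ (idem A (τ v)) * idem B v := by
    rw [hu, Finset.mul_sum, Finset.sum_eq_single v]
    · rw [← mul_assoc, hmul, if_pos rfl]
    · intro w _ hw
      rw [← mul_assoc, hmul, if_neg fun h => hw (hbij.1 h).symm, zero_mul]
    · simp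
  have hright (v) : u * idem B v = φ (idem A (τ v)) * idem B v := by
    rw [hu, Finset.sum_mul, Finset.sum_eq_single v]
    · rw [mul_assoc, (isTensorRep B).idem_mul_idem, if_pos rfl]
    · intro w _ hw
      rw [mul_assoc, (isTensorRep B).idem_mul_idem, if_neg hw, mul_zero]
    · simp
  refine ⟨φ.trans (MulSemiringAction.toAlgEquiv F _ (ConjAct.toConjAct u⁻¹)), τ, hbij, fun v => ?_⟩
  rw [AlgEquiv.trans_apply, MulSemiringAction.toAlgEquiv_apply, ConjAct.units_smul_def,
    ConjAct.ofConjAct_toConjAct, inv_inv, mul_assoc, hleft, ← hright, Units.inv_mul_cancel_left]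

/-- The order of the vertices is determined by the algebra if all corners are nonzero. -/
theorem exists_algEquiv_idem_eq (hk : 1 ≤ k) (hn : ∀ i, 0 < n i)
    (φ : TensorQuiverAlgebra A ≃ₐ[F] TensorQuiverAlgebra B) :
    ∃ ψ : TensorQuiverAlgebra A ≃ₐ[F] TensorQuiverAlgebra B, ∀ v, ψ (idem A v) = idem B v := by
  obtain ⟨ψ, τ, hτ, hψ⟩ := exists_algEquiv_idem hk φ
  have hmono : Monotone τ := by
    intro v w hvw
    by_contra h
    obtain ⟨r, hr⟩ := exists_corner_ne_zero B hk hn hvw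
    apply hr
    obtain ⟨s, rfl⟩ := ψ.surjective r
    rw [← hψ, ← hψ, ← map_mul, ← map_mul, corner_eq_zero A hk h, map_zero]
  have hid : τ = id := by
    let e : Fin (k + 1) ≃o Fin (k + 1) :=
      (hmono.strictMono_of_injective hτ.1).orderIsoOfSurjective τ hτ.2
    have : e = OrderIso.refl _ := Subsingleton.elim _ _
    exact congr_arg (fun e : Fin (k + 1) ≃o Fin (k + 1) => (e : Fin (k + 1) → Fin (k + 1))) this
  subst hid
  exact ⟨ψ, hψ⟩

/-- An isomorphism that fixes the vertices acts on the arrows in each direction by an invertible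
matrix, and these matrices form an isomorphism of tensors. -/
theorem tensorIso_of_algEquiv (hk : 2 ≤ k)
    (φ : TensorQuiverAlgebra A ≃ₐ[F] TensorQuiverAlgebra B) : TensorIso A B := by
  by_cases hn : ∀ i, 0 < n i
  swap
  · -- both tensors have no entries
    push Not at hn
    obtain ⟨i, hi⟩ := hn
    exact ⟨1, fun I => absurd (I i).isLt (by omega)⟩
  obtain ⟨ψ, hψ⟩ := exists_algEquiv_idem_eq (one_le_two.trans hk) hn φ
  have hψ' (v) : ψ.symm (idem B v) = idem A v := by rw [← hψ, ψ.symm_apply_apply]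
  have hcorner (C : Tensor F n) (i : Fin (k + 1)) (a : Fin (n i)) :
      idem C (arrowSource i) * arrow C i a * idem C (arrowTarget i) = arrow C i a := by
    rw [(isTensorRep C).idem_mul_arrow, if_pos rfl, (isTensorRep C).arrow_mul_idem, if_pos rfl]
  have hQ (i : Fin (k + 1)) (a : Fin (n i)) : ∃ c : Fin (n i) → F,
      ψ (arrow A i a) = ∑ b, c b • arrow B i b := by
    rw [← hcorner A, map_mul, map_mul, hψ, hψ]
    exact corner_arrow B hk i _
  have hQ' (i : Fin (k + 1)) (b : Fin (n i)) : ∃ c : Fin (n i) → F,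
      ψ.symm (arrow B i b) = ∑ a, c a • arrow A i a := by
    rw [← hcorner B, map_mul, map_mul, hψ', hψ']
    exact corner_arrow A hk i _
  choose Q hQ using hQ
  choose Q' hQ' using hQ'
  have hind (i : Fin (k + 1)) : Matrix.of (Q i) * Matrix.of (Q' i) = 1 := by
    ext a a'
    have h := congr_arg ψ.symm (hQ i a)
    simp only [ψ.symm_apply_apply, map_sum, map_smul, hQ', Finset.smul_sum, smul_smul] at h
    rw [Finset.sum_comm] at h
    simp only [← Finset.sum_smul] at h
    have h₁ : arrow A i a = ∑ a', (if a = a' then (1 : F) else 0) • arrow A i a' := by simp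
    have h₂ := congr_fun (coeff_arrow_injective A hk i (h₁.symm.trans h)) a'
    rw [Matrix.mul_apply, Matrix.one_apply, h₂]
    rfl
  refine tensorIso_iff.2 ⟨fun i => ⟨.of (Q i), .of (Q' i), hind i,
    mul_eq_one_comm.1 (hind i)⟩, fun I c => ?_⟩
  have h := congr_arg ψ ((isTensorRep A).prod_arrow I)
  rw [map_list_prod, List.map_ofFn, map_sum] at h
  simp only [Function.comp_def, hQ, map_smul, Finset.smul_sum, smul_smul] at h
  rw [(isTensorRep B).prod_change Q, Finset.sum_comm] at h
  simp only [← Finset.sum_smul] at h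
  exact (congr_fun (coeff_arrow_injective B hk _ h) c).symm

theorem tensorIso_iff_nonempty_algEquiv (hk : 2 ≤ k) (A B : Tensor F n) :
    TensorIso A B ↔ Nonempty (TensorQuiverAlgebra A ≃ₐ[F] TensorQuiverAlgebra B) :=
  ⟨nonempty_algEquiv_of_tensorIso (one_le_two.trans hk), fun ⟨φ⟩ => tensorIso_of_algEquiv hk φ⟩

end TensorQuiverAlgebra

/-! ### The reduction -/

theorem mainTheorem2 :
    ∃ C : ℕ, ∀ k : ℕ, 2 ≤ k →
      ∃ N : (Fin (k + 1) → ℕ) → ℕ,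
        (∀ n : Fin (k + 1) → ℕ, 1 ≤ Finset.univ.sup n →
          N n ≤ C * (k + 1) ^ 2 * (Finset.univ.sup n) ^ k) ∧
        ∀ (F : Type*) [Field F],
          ∃ r : ∀ n : Fin (k + 1) → ℕ, Tensor F n → StructureArray F (N n),
            (∀ (n : Fin (k + 1) → ℕ) (A : Tensor F n),
              IsStructureArrayOf (r n A) (TensorQuiverAlgebra A)) ∧
            (∀ (n : Fin (k + 1) → ℕ) (A B : Tensor F n),
              TensorIso A B ↔ Nonempty (TensorQuiverAlgebra A ≃ₐ[F] TensorQuiverAlgebra B)) ∧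
            (∀ (n : Fin (k + 1) → ℕ) (A B : Tensor F n),
              TensorIso A B ↔ StructureArrayIso (r n A) (r n B)) ∧
            PolyTimeBSS F (encodeTensor 1 0 fun x => [x]) (encodeStructureArray 1 0 fun x => [x])
              (fun X : Σ n : Fin (k + 1) → ℕ, Tensor F n =>
                (⟨N X.1, r X.1 X.2⟩ : Σ N : ℕ, StructureArray F N)) ∧
            ∀ (Γ : Type) [Finite Γ] (enc : Computability.Encoding F Γ),
              PolyTimeTuring
                (encodeTensor (Sum.inr true) (Sum.inr false) (turingToken enc))
                (encodeStructureArray (Sum.inr true) (Sum.inr false) (turingToken enc))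
                (fun X : Σ n : Fin (k + 1) → ℕ, Tensor F n =>
                  (⟨N X.1, r X.1 X.2⟩ : Σ N : ℕ, StructureArray F N)) := by
  refine ⟨1, fun k hk => ⟨fun n => (pathList n).length, fun n hn => ?_, fun F _ => ?_⟩⟩
  · rw [one_mul]
    exact length_pathList_le (one_le_two.trans hk) n hn
  have hk' : 1 ≤ k := one_le_two.trans hk
  have hstr (n : Fin (k + 1) → ℕ) (A : Tensor F n) :=
    TensorQuiverAlgebra.isStructureArrayOf_tensorStructure A hk'
  have hiso (n : Fin (k + 1) → ℕ) (A B : Tensor F n) :=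
    TensorQuiverAlgebra.tensorIso_iff_nonempty_algEquiv hk A B
  exact ⟨tensorStructure, hstr, hiso,
    fun n A B => (hiso n A B).trans (structureArrayIso_iff (hstr n A) (hstr n B)),
    polyTimeBSS_tensorStructure hk', fun Γ _ enc => polyTimeTuring_tensorStructure hk' enc⟩
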